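/- \textbf{Model.} For each sample size $n$ let $p=p_n\in\mathbb N$ and let $(Y,X)\in\{1,-1\}\times\mathbb R^p$ follow a semiparametric LDA model: $\Pr(Y=1)=\pi_+$, $\Pr(Y=-1)=\pi_-=1-\pi_+$ with $0<\pi_+<1$, and $h(X)=(h_1(X_1),\dots,h_p(X_p))^{\mathsf T}$ satisfies $h(X)\mid Y=\pm1\sim N(\mu_\pm,\Sigma)$, where each $h_j$ is strictly monotone on a set that contains $X_j$ almost surely, $\Sigma$ is positive definite, $\Sigma_{jj}=1$ for all $j$, and $\mu_+=0$. All these objects may depend on $n$. Put $\Omega=\mathrm{Cov}\{h(X)\}$, $\beta=\beta^\star=\Omega^{-1}(\mu_+-\mu_-)$, $A=\{j:\beta_j\ne0\}$, $s=|A|\ge1$, and $$\kappa=\|\Omega_{A^cA}(\Omega_{AA})^{-1}\|_\infty,\quad \varphi=\|(\Omega_{AA})^{-1}\|_\infty,\quad \Delta=\|\mu_{+A}-\mu_{-A}\|_\infty,$$ where $\|M\|_\infty=\max_i\sum_j|M_{ij}|$ for matrices and $\|u\|_\infty=\max_j|u_j|$ for vectors. The Bayes error is $R=\Pr\{Y\ne\mathrm{sign}(h(X)^{\mathsf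 T}\beta^\star+\beta_0)\}$ with $$\beta_0=-\tfrac12(\mu_++\mu_-)^{\mathsf T}\beta^\star+\log(\pi_+/\pi_-)\,\frac{\beta^{\star\mathsf T}\Sigma\beta^\star}{(\mu_+-\mu_-)^{\mathsf T}\beta^\star}.$$ \textbf{SSDA.} Let $(Y^i,X^i)$, $1\le i\le n$, be i.i.d. copies of $(Y,X)$, and let $n_\pm$ be the number of $i$ with $Y^i=\pm1$. Let $\tilde F_{+j}$ be the empirical distribution function of the $X^i_j$ with $Y^i=1$, let $\hat F_{+j}$ be $\tilde F_{+j}$ Winsorized at $(1/n_+^2,\,1-1/n_+^2)$, and let $\hat h_j=\Phi^{-1}\circ\hat F_{+j}$, with $\Phi$ the standard normal distribution function. For $\lambda=\lambda_n>0$ let $\hat\beta$ be the slope part of any minimizer of $$(\beta_0,\beta)\mapsto n^{-1}\sum_{i=1}^n\{Y^i-\beta_0-\hat h(X^i)^{\mathsf T}\beta\}^2+\sum_{j=1}^p\lambda|\beta_j| ,$$ and let $$\hat\beta_0=-\tfrac12(\hat\mu_++\hat\mu_-)^{\mathsf T}\hat\beta+\log(\hat\pi_+/\hat\pi_-)\,\frac{\hat\beta^{\mathsf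 T}\hat\Sigma\hat\beta}{(\hat\mu_+-\hat\mu_-)^{\mathsf T}\hat\beta},$$ where $\hat\pi_\pm=n_\pm/n$, $\hat\mu_\pm$ are the within-class sample means and $\hat\Sigma$ is the pooled within-class sample covariance matrix (with denominator $n-2$) of the pseudo data $\hat h(X^i)$. Let $R_n=\Pr\{Y\ne\mathrm{sign}(\hat h(X)^{\mathsf T}\hat\beta+\hat\beta_0)\}$ be the conditional error probability, given the sample, on a new independent observation $(Y,X)$. \textbf{Claim.} Suppose that $\pi_+$ and $\pi_-$ are bounded away from $0$, that $\varphi$ and $\Delta$ are bounded, and that $\kappa\le\kappa_0$ for a constant $\kappa_0<1$, all uniformly in $n$. Suppose that for some $\rho\in(0,1/3)$, as $n\to\infty$, (C1) $p\to\infty$ and $s^2\log(ps)/n^{1/3-\rho}\to0$; (C2) $\min_{j\in A}|\beta_j|\gg\max\big[sn^{-\rho/2},\ s\{\log(ps)/n^{1/3-\rho}\}^{1/2}\big]$, and that $\lambda_n\ll\min_{j\in A}|\beta_j|$ and $\lambda_n\gg\{\log(ps)\,s^2/n^{1/3-\rho}\}^{1/2}$, where $a_n\ll b_n$ means $a_n/b_n\to0$.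 Then $R_n-R\to0$ in probability. -/

import Mathlib

open MeasureTheory ProbabilityTheory Filter Topology Asymptotics

noncomputable section

namespace SSDA

/-! ### Matrix and vector norms -/

/-- The norm `‖M‖_∞ = max_i ∑_j |M i j|` of a matrix (it is `0` if there are no rows). -/
def rowSumNorm {m k : Type*} [Fintype k] (M : Matrix m k ℝ) : ℝ :=
  ⨆ i, ∑ j, |M i j|

/-! ### The semiparametric LDA model

One observation is a pair `(Y, X)` in `ℝ × (Fin p → ℝ)`, the label `Y` being `1` or `-1`. -/

/-- The parameters of a semiparametric LDA model with `p` predictors: the probability `π₊` of the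
class `Y = 1`, the univariate transformations `h_j`, the class means `μ₊`, `μ₋` and the common
within-class covariance matrix `Σ` of `h(X)`. -/
structure Params (p : ℕ) where
  priorPos : ℝ
  h : Fin p → ℝ → ℝ
  muPos : Fin p → ℝ
  muNeg : Fin p → ℝ
  Sigma : Matrix (Fin p) (Fin p) ℝ

namespace Params

variable {p : ℕ} (θ : Params p)

/-- The prior probability `π₋ = 1 - π₊` of the class `Y = -1`. -/
def priorNeg : ℝ := 1 - θ.priorPos

/-- The transformed predictor `h(x) = (h_1(x_1), …, h_p(x_p))`. -/
def transform (x : Fin p → ℝ) : Fin p → ℝ := fun j => θ.h j (x j)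

/-- The mean difference `μ₊ - μ₋`. -/
def delta : Fin p → ℝ := θ.muPos - θ.muNeg

end Params

/-- `P` is the law of a pair `(Y, X)` which follows the semiparametric LDA model with
parameters `θ`: `h(X)` given `Y = ±1` is `N(μ_±, Σ)`, where each `h_j` is strictly monotone
on a set that carries the law of `X_j`, with the normalization `μ₊ = 0`, `Σ_jj = 1`. -/
structure IsSeLDA {p : ℕ} (P : Measure (ℝ × (Fin p → ℝ))) (θ : Params p) : Prop where
  isProbabilityMeasure : IsProbabilityMeasure P
  label : ∀ᵐ z ∂P, z.1 = 1 ∨ z.1 = -1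
  prior_pos : 0 < θ.priorPos
  prior_lt_one : θ.priorPos < 1
  prior_eq : P.real {z | z.1 = 1} = θ.priorPos
  strictMono : ∀ j, ∃ S : Set ℝ, (StrictMonoOn (θ.h j) S ∨ StrictAntiOn (θ.h j) S) ∧
    ∀ᵐ z ∂P, z.2 j ∈ S
  posDef : θ.Sigma.PosDef
  diag_eq_one : ∀ j, θ.Sigma j j = 1
  muPos_eq_zero : θ.muPos = 0
  law_pos : HasLaw (fun z => WithLp.toLp 2 (θ.transform z.2))
    (multivariateGaussian (WithLp.toLp 2 θ.muPos) θ.Sigma) (cond P {z | z.1 = 1})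
  law_neg : HasLaw (fun z => WithLp.toLp 2 (θ.transform z.2))
    (multivariateGaussian (WithLp.toLp 2 θ.muNeg) θ.Sigma) (cond P {z | z.1 = -1})

section Population

variable {p : ℕ} (P : Measure (ℝ × (Fin p → ℝ))) (θ : Params p)

/-- The (unconditional) covariance matrix `Ω` of `h(X)`. -/
def Omega : Matrix (Fin p) (Fin p) ℝ :=
  Matrix.of fun j k => covariance (fun z => θ.transform z.2 j) (fun z => θ.transform z.2 k) P

/-- The discriminant direction `β⋆ = Ω⁻¹ (μ₊ - μ₋)`. -/
def betaStar : Fin p → ℝ := Matrix.mulVec (Omega P θ)⁻¹ θ.delta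

open Classical in
/-- The set `A = {j : β⋆_j ≠ 0}` of the important predictors. -/
def active : Finset (Fin p) := Finset.univ.filter fun j => betaStar P θ j ≠ 0

/-- The block `Ω_AA`. -/
def OmegaAA : Matrix {j // j ∈ active P θ} {j // j ∈ active P θ} ℝ :=
  (Omega P θ).submatrix (fun j => j.1) (fun k => k.1)

/-- The block `Ω_{A^c A}`. -/
def OmegaAcA : Matrix {j // j ∉ active P θ} {j // j ∈ active P θ} ℝ :=
  (Omega P θ).submatrix (fun j => j.1) (fun k => k.1)

/-- `κ = ‖Ω_{A^c A} (Ω_AA)⁻¹‖_∞`. -/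
def kappa : ℝ := rowSumNorm (OmegaAcA P θ * (OmegaAA P θ)⁻¹)

/-- `φ = ‖(Ω_AA)⁻¹‖_∞`. -/
def phi : ℝ := rowSumNorm (OmegaAA P θ)⁻¹

/-- `Δ = ‖μ_{+A} - μ_{-A}‖_∞`. -/
def Delta : ℝ := ⨆ j : {j // j ∈ active P θ}, |θ.delta j.1|

/-- `min_{j ∈ A} |β⋆_j|` (used for nonempty `A` only). -/
def minSignal : ℝ := ⨅ j : {j // j ∈ active P θ}, |betaStar P θ j.1|

/-- The intercept that belongs to the direction `β⋆`,
`β₀ = -(μ₊ + μ₋)ᵀ β⋆ / 2 + log (π₊ / π₋) · (β⋆ᵀ Σ β⋆) / ((μ₊ - μ₋)ᵀ β⋆)`. Since `β⋆` is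
`c Σ⁻¹ (μ₊ - μ₋)` with `c > 0`, the last quotient is `c`, and `h(x)ᵀ β⋆ + β₀` is `c` times
`(h(x) - (μ₊ + μ₋) / 2)ᵀ Σ⁻¹ (μ₊ - μ₋) + log (π₊ / π₋)`. -/
def betaStarZero : ℝ :=
  -((θ.muPos + θ.muNeg) ⬝ᵥ betaStar P θ) / 2 +
    Real.log (θ.priorPos / θ.priorNeg) *
      (betaStar P θ ⬝ᵥ Matrix.mulVec θ.Sigma (betaStar P θ)) / (θ.delta ⬝ᵥ betaStar P θ)

/-- The Bayes error rate `R = Pr(Y ≠ sign(h(X)ᵀ β⋆ + β₀))`. -/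
def bayesError : ℝ :=
  P.real {z | z.1 ≠ Real.sign (θ.transform z.2 ⬝ᵥ betaStar P θ + betaStarZero P θ)}

end Population

/-! ### The estimator -/

/-- The quantile function `Φ⁻¹` of the standard normal distribution (on `(0, 1)`). -/
def probit (u : ℝ) : ℝ := sInf {x : ℝ | u ≤ cdf (gaussianReal 0 1) x}

section Estimator

variable {n p : ℕ} (D : Fin n → ℝ × (Fin p → ℝ))

/-- The indices of the observations of the sample `D` with label `y`. -/
def classIdx (y : ℝ) : Finset (Fin n) := Finset.univ.filter fun i => (D i).1 = y

/-- The number `n_y` of observations with label `y`. -/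
def classSize (y : ℝ) : ℝ := ((classIdx D y).card : ℝ)

/-- The proportion `n_y / n` of observations with label `y`. -/
def classProp (y : ℝ) : ℝ := classSize D y / n

/-- The empirical distribution function of `X_j` within the class `Y = 1`. -/
def ecdfPos (j : Fin p) (x : ℝ) : ℝ :=
  (((classIdx D 1).filter fun i => (D i).2 j ≤ x).card : ℝ) / classSize D 1

/-- Winsorization of `t` at `(a, b)`. -/
def winsorize (a b t : ℝ) : ℝ := if b < t then b else if t < a then a else t

/-- The estimated transformation `ĥ_j = Φ⁻¹ ∘ F̂_{+j}`, where `F̂_{+j}` is the empirical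
distribution function Winsorized at `(1 / n₊², 1 - 1 / n₊²)`. -/
def hHat (j : Fin p) (x : ℝ) : ℝ :=
  probit (winsorize (1 / classSize D 1 ^ 2) (1 - 1 / classSize D 1 ^ 2) (ecdfPos D j x))

/-- The estimated transformation of a vector, `ĥ(x) = (ĥ_1(x_1), …, ĥ_p(x_p))`. -/
def transformHat (x : Fin p → ℝ) : Fin p → ℝ := fun j => hHat D j (x j)

/-- The sample mean `μ̂_y` of the pseudo data `ĥ(X^i)` in the class with label `y`. -/
def muHat (y : ℝ) : Fin p → ℝ :=
  fun j => (∑ i ∈ classIdx D y, transformHat D (D i).2 j) / classSize D y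

/-- The pooled within-class sample covariance matrix `Σ̂` of the pseudo data. -/
def SigmaHat : Matrix (Fin p) (Fin p) ℝ :=
  Matrix.of fun j k =>
    (∑ i, (transformHat D (D i).2 j - muHat D (D i).1 j) *
      (transformHat D (D i).2 k - muHat D (D i).1 k)) / ((n : ℝ) - 2)

/-- The lasso objective
`n⁻¹ ∑_i (Y^i - β₀ - ĥ(X^i)ᵀ β)² + ∑_j λ |β_j|` of the pseudo data. -/
def lassoObjective (lam b₀ : ℝ) (b : Fin p → ℝ) : ℝ :=
  (n : ℝ)⁻¹ * ∑ i, ((D i).1 - b₀ - transformHat D (D i).2 ⬝ᵥ b) ^ 2 + ∑ j, lam * |b j|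

/-- `b` is the slope part of a minimizer of the lasso objective. -/
def IsLassoSlope (lam : ℝ) (b : Fin p → ℝ) : Prop :=
  ∃ b₀ : ℝ, ∀ (c₀ : ℝ) (c : Fin p → ℝ), lassoObjective D lam b₀ b ≤ lassoObjective D lam c₀ c

/-- The intercept `β̂₀` of the classifier,
`-(μ̂₊ + μ̂₋)ᵀ β̂ / 2 + log (π̂₊ / π̂₋) · (β̂ᵀ Σ̂ β̂) / ((μ̂₊ - μ̂₋)ᵀ β̂)`. -/
def betaHatZero (b : Fin p → ℝ) : ℝ :=
  -((muHat D 1 + muHat D (-1)) ⬝ᵥ b) / 2 +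
    Real.log (classProp D 1 / classProp D (-1)) *
      (b ⬝ᵥ Matrix.mulVec (SigmaHat D) b) / ((muHat D 1 - muHat D (-1)) ⬝ᵥ b)

/-- The error rate `R_n = Pr(Y ≠ sign(ĥ(X)ᵀ β̂ + β̂₀))` of the fitted classifier with slope
`b = β̂`: the probability, for the given sample `D`, that it misclassifies
a new observation `(Y, X)` with law `P`. -/
def ssdaError (P : Measure (ℝ × (Fin p → ℝ))) (b : Fin p → ℝ) : ℝ :=
  P.real {z | z.1 ≠ Real.sign (transformHat D z.2 ⬝ᵥ b + betaHatZero D b)}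

end Estimator

end SSDA

end

/-! Write δ = μ₊ - μ₋, c = 2π₊π₋ and m = δᵀβ⋆ (`signal`). Since Cov(Y, h(X)) = cδ, the population
regression of Y on h(X) has slope cβ⋆. A discriminant rule does not change when its slope is
multiplied by a positive number, because the intercept is homogeneous of degree one in the slope. So
it suffices that β̂/c is close to β⋆. As m need not stay away from 0, all errors have to be measured
against m or √m, not absolutely.

Margin. Given the class, the Bayes discriminant is normal with variance q = m - π₊π₋m² and mean ±m/2
+ log(π₊/π₋)q/m. By `exists_margin` it exceeds ξ(√m + |log(π₊/π₋)|) in absolute value except with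
small probability, uniformly in m. By `abs_error_sub_le` the two error rates are then close as soon
as the two discriminants differ by less than this with high probability.

Lasso. No support recovery is needed. The bounds on κ and φ give an ℓ¹ inequality for the
coordinates in A (`sum_abs_le_of_blocks`). Combined with the cone condition and the stationarity
conditions of the lasso, it bounds the ℓ¹ error by a multiple of sλ and the error in the quadratic
form of Ω by a multiple of sλ² (`lasso_error_le`). Since s·min|β⋆_j|² ≤ ‖β⋆‖² ≤ φm, the condition λ
≪ min|β⋆_j| makes sλ² ≪ m: the slope error is negligible against √m in L².

Transformation. A decreasing h_j is estimated up to its sign, and changing signs of coordinates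
affects neither the lasso nor the classifier. Split at M = √((2/3) log n). On |h_j| ≤ M the normal
density is at least n^(-1/3-o(1)), so an error τ of the empirical distribution function becomes an
error τ·n^(1/3+o(1)) of ĥ_j. Beyond M, Winsorization gives |ĥ_j| ≤ K = 2 log n + 1, while the tail
second moment of h_j is at most n^(-1/3+o(1)). With e² = log p / n^(1/3-ρ) and τ = e·n^(-1/3-ρ/4)
(`Scale.of_log`), the first error is at most e and the mean square of the second is of order e²;
this balance is where the exponent 1/3 comes from. Hoeffding's inequality and a union bound over
O(p²n²) test functions give precision τ with failure probability at most 28/n, because nτ² = n^(ρ/2)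
log p.

All first and second sample moments of the pseudo data are thus within O(e) of their population
values, and the lower bound on λ together with (C1) gives se ≪ λ and se → 0, which is what the
deterministic comparison `exists_closeness` asks for. -/

noncomputable section

namespace SSDA

open Matrix

/-! ### Deterministic analysis of the lasso -/

/-- The average of a finite sequence. -/
def sampleMean {n : ℕ} (f : Fin n → ℝ) : ℝ := (n : ℝ)⁻¹ * ∑ i, f i

/-- The empirical covariance, with denominator `n`, of two finite sequences. -/
def sampleCov {n : ℕ} (f g : Fin n → ℝ) : ℝ :=
  sampleMean (fun i => f i * g i) - sampleMean f * sampleMean g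

section SampleMean

variable {n : ℕ}

lemma sampleMean_add (f g : Fin n → ℝ) :
    sampleMean (fun i => f i + g i) = sampleMean f + sampleMean g := by
  simp [sampleMean, Finset.sum_add_distrib, mul_add]

lemma sampleMean_sub (f g : Fin n → ℝ) :
    sampleMean (fun i => f i - g i) = sampleMean f - sampleMean g := by
  simp [sampleMean, Finset.sum_sub_distrib, mul_sub]

lemma sampleMean_const_mul (c : ℝ) (f : Fin n → ℝ) :
    sampleMean (fun i => c * f i) = c * sampleMean f := by
  simp only [sampleMean, ← Finset.mul_sum]; ring

lemma sampleMean_const (hn : n ≠ 0) (c : ℝ) : sampleMean (fun _ : Fin n => c) = c := by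
  have : (n : ℝ) ≠ 0 := by exact_mod_cast hn
  simp [sampleMean, this]

lemma sampleMean_mono {f g : Fin n → ℝ} (h : ∀ i, f i ≤ g i) : sampleMean f ≤ sampleMean g := by
  unfold sampleMean
  gcongr with i
  exact h i

lemma sampleMean_nonneg {f : Fin n → ℝ} (h : ∀ i, 0 ≤ f i) : 0 ≤ sampleMean f := by
  unfold sampleMean
  exact mul_nonneg (by positivity) (Finset.sum_nonneg fun i _ => h i)

lemma abs_sampleMean_le (f : Fin n → ℝ) : |sampleMean f| ≤ sampleMean fun i => |f i| := by
  unfold sampleMean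
  rw [abs_mul, abs_of_nonneg (by positivity : (0 : ℝ) ≤ (n : ℝ)⁻¹)]
  gcongr
  exact Finset.abs_sum_le_sum_abs _ _

lemma sampleMean_sum {ι : Type*} (t : Finset ι) (f : ι → Fin n → ℝ) :
    sampleMean (fun i => ∑ k ∈ t, f k i) = ∑ k ∈ t, sampleMean (f k) := by
  simp only [sampleMean, Finset.mul_sum]
  rw [Finset.sum_comm]

lemma sampleCov_comm (f g : Fin n → ℝ) : sampleCov f g = sampleCov g f := by
  simp only [sampleCov, mul_comm]

lemma sampleCov_dot_right {p : ℕ} (f : Fin n → ℝ) (H : Fin n → Fin p → ℝ) (v : Fin p → ℝ) :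
    sampleCov f (fun i => H i ⬝ᵥ v) = ∑ k, sampleCov f (fun i => H i k) * v k := by
  have h1 : sampleMean (fun i => f i * (H i ⬝ᵥ v))
      = ∑ k, v k * sampleMean (fun i => f i * H i k) := by
    simp_rw [← sampleMean_const_mul, ← sampleMean_sum]
    congr 1; ext i
    simp only [dotProduct, Finset.mul_sum]
    exact Finset.sum_congr rfl fun k _ => by ring
  have h2 : sampleMean (fun i => H i ⬝ᵥ v) = ∑ k, v k * sampleMean (fun i => H i k) := by
    simp_rw [← sampleMean_const_mul, ← sampleMean_sum]
    congr 1; ext i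
    simp only [dotProduct]
    exact Finset.sum_congr rfl fun k _ => by ring
  simp only [sampleCov, h1, h2, Finset.mul_sum, ← Finset.sum_sub_distrib]
  exact Finset.sum_congr rfl fun k _ => by ring

lemma sampleCov_self_nonneg (f : Fin n → ℝ) : 0 ≤ sampleCov f f := by
  rcases Nat.eq_zero_or_pos n with rfl | hn
  · simp [sampleCov, sampleMean]
  have h : sampleCov f f = sampleMean fun i => (f i - sampleMean f) ^ 2 := by
    set m := sampleMean f with hm
    have : (fun i => (f i - m) ^ 2) = fun i => (f i * f i - 2 * m * f i) + m ^ 2 := by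
      ext i; ring
    rw [this, sampleMean_add, sampleMean_sub, sampleMean_const_mul, sampleMean_const hn.ne',
      sampleCov, ← hm]
    ring
  rw [h]
  exact sampleMean_nonneg fun i => sq_nonneg _

end SampleMean

/-- The empirical covariance matrix of the rows of `H`. -/
def sampleCovMatrix {n p : ℕ} (H : Fin n → Fin p → ℝ) : Matrix (Fin p) (Fin p) ℝ :=
  Matrix.of fun j k => sampleCov (fun i => H i j) (fun i => H i k)

lemma sampleCov_dot_dot {n p : ℕ} (H : Fin n → Fin p → ℝ) (u v : Fin p → ℝ) :
    sampleCov (fun i => H i ⬝ᵥ u) (fun i => H i ⬝ᵥ v) = (sampleCovMatrix H *ᵥ u) ⬝ᵥ v := by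
  rw [sampleCov_dot_right]
  simp only [dotProduct, mulVec]
  refine Finset.sum_congr rfl fun k _ => ?_
  congr 1
  rw [sampleCov_comm]
  exact sampleCov_dot_right _ _ _

lemma sampleCovMatrix_quadForm_nonneg {n p : ℕ} (H : Fin n → Fin p → ℝ) (u : Fin p → ℝ) :
    0 ≤ u ⬝ᵥ (sampleCovMatrix H *ᵥ u) := by
  rw [dotProduct_comm, ← sampleCov_dot_dot]
  exact sampleCov_self_nonneg _

/-- The variational inequality which characterizes the slope of a minimizer of the lasso
objective. -/
lemma lasso_variational {n p : ℕ} (hn : n ≠ 0) (Y : Fin n → ℝ) (H : Fin n → Fin p → ℝ)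
    {lam b₀ : ℝ} (hlam : 0 ≤ lam) {b : Fin p → ℝ}
    (hmin : ∀ (c₀ : ℝ) (c : Fin p → ℝ),
      (n : ℝ)⁻¹ * ∑ i, (Y i - b₀ - H i ⬝ᵥ b) ^ 2 + ∑ j, lam * |b j| ≤
      (n : ℝ)⁻¹ * ∑ i, (Y i - c₀ - H i ⬝ᵥ c) ^ 2 + ∑ j, lam * |c j|) (v : Fin p → ℝ) :
    ((fun j => sampleCov Y (fun i => H i j)) - sampleCovMatrix H *ᵥ b) ⬝ᵥ v ≤
      lam / 2 * (∑ j, |b j + v j| - ∑ j, |b j|) := by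
  -- The intercept moves so that the perturbation `c₀ + H i ⬝ᵥ v` has mean zero. The first-order
  -- term is then a covariance, and `b₀` drops out of it.
  set c₀ : ℝ := -sampleMean (fun i => H i ⬝ᵥ v) with hc₀
  set G := sampleMean (fun i => (Y i - b₀ - H i ⬝ᵥ b) * (c₀ + H i ⬝ᵥ v)) with hG
  set S := sampleMean (fun i => (c₀ + H i ⬝ᵥ v) ^ 2) with hS
  have hS0 : 0 ≤ S := sampleMean_nonneg fun i => sq_nonneg _
  set d := ∑ j, |b j + v j| - ∑ j, |b j| with hd
  -- Minimality along the segment from `b` to `b + v`: the loss is quadratic in `t` and the penalty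
  -- is convex. After division by `t`, letting `t` tend to 0 removes `S`.
  have hkey : ∀ t : ℝ, 0 < t → t ≤ 1 → 2 * G ≤ t * S + lam * d := by
    intro t ht ht1
    have h := hmin (b₀ + t * c₀) (b + t • v)
    have hq : (n : ℝ)⁻¹ * ∑ i, (Y i - (b₀ + t * c₀) - H i ⬝ᵥ (b + t • v)) ^ 2
        = (n : ℝ)⁻¹ * ∑ i, (Y i - b₀ - H i ⬝ᵥ b) ^ 2 - 2 * t * G + t ^ 2 * S := by
      have e1 : (n : ℝ)⁻¹ * ∑ i, (Y i - (b₀ + t * c₀) - H i ⬝ᵥ (b + t • v)) ^ 2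
          = sampleMean fun i => ((Y i - b₀ - H i ⬝ᵥ b) ^ 2
            - (2 * t) * ((Y i - b₀ - H i ⬝ᵥ b) * (c₀ + H i ⬝ᵥ v)))
            + t ^ 2 * (c₀ + H i ⬝ᵥ v) ^ 2 := by
        unfold sampleMean
        congr 1
        refine Finset.sum_congr rfl fun i _ => ?_
        rw [dotProduct_add, dotProduct_smul, smul_eq_mul]
        ring
      rw [e1, sampleMean_add, sampleMean_sub, sampleMean_const_mul, sampleMean_const_mul]
      rfl
    have hl : ∑ j, |(b + t • v) j| ≤ ∑ j, |b j| + t * d := by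
      rw [hd, mul_sub, Finset.mul_sum, Finset.mul_sum, ← Finset.sum_sub_distrib,
        ← Finset.sum_add_distrib]
      refine Finset.sum_le_sum fun j _ => ?_
      have : (b + t • v) j = (1 - t) * b j + t * (b j + v j) := by
        simp only [Pi.add_apply, Pi.smul_apply, smul_eq_mul]; ring
      rw [this]
      calc |(1 - t) * b j + t * (b j + v j)| ≤ |(1 - t) * b j| + |t * (b j + v j)| := abs_add_le _ _
        _ = (1 - t) * |b j| + t * |b j + v j| := by
          rw [abs_mul, abs_mul, abs_of_nonneg (by linarith : 0 ≤ 1 - t), abs_of_pos ht]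
        _ = _ := by ring
    rw [hq, ← Finset.mul_sum, ← Finset.mul_sum] at h
    have h2 : lam * ∑ j, |(b + t • v) j| ≤ lam * (∑ j, |b j| + t * d) := by gcongr
    have h3 : 0 ≤ t * (t * S + lam * d - 2 * G) := by nlinarith
    have := nonneg_of_mul_nonneg_right h3 ht
    linarith
  have hlim : 2 * G ≤ lam * d := by
    refine le_of_forall_pos_le_add fun ε hε => ?_
    rcases hS0.eq_or_lt with h0 | hpos
    · have := hkey 1 one_pos le_rfl
      rw [← h0] at this; linarith
    · have := hkey (min 1 (ε / S)) (lt_min one_pos (by positivity)) (min_le_left _ _)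
      have h2 : min 1 (ε / S) * S ≤ ε := by
        calc _ ≤ ε / S * S := by gcongr; exact min_le_right _ _
          _ = ε := by field_simp
      linarith
  have hGeq : G = ((fun j => sampleCov Y (fun i => H i j)) - sampleCovMatrix H *ᵥ b) ⬝ᵥ v := by
    rw [sub_dotProduct, ← sampleCov_dot_dot]
    have : (fun j => sampleCov Y (fun i => H i j)) ⬝ᵥ v = sampleCov Y (fun i => H i ⬝ᵥ v) := by
      rw [sampleCov_dot_right]; rfl
    rw [this, hG]
    set w := fun i => H i ⬝ᵥ v with hw
    set u := fun i => H i ⬝ᵥ b with hu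
    have e : (fun i => (Y i - b₀ - u i) * (c₀ + w i))
        = fun i => ((Y i * w i - u i * w i) + c₀ * Y i) - (c₀ * u i + b₀ * w i) - b₀ * c₀ := by
      ext i; ring
    change sampleMean (fun i => (Y i - b₀ - u i) * (c₀ + w i)) = _
    rw [e, sampleMean_sub, sampleMean_sub, sampleMean_add, sampleMean_add, sampleMean_sub,
      sampleMean_const_mul, sampleMean_const_mul, sampleMean_const_mul, sampleMean_const hn,
      sampleCov, sampleCov, hc₀]
    ring
  rw [← hGeq]; linarith

lemma abs_dotProduct_le_of_abs_le {p : ℕ} {x y : Fin p → ℝ} {u : ℝ} (h : ∀ j, |x j| ≤ u) :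
    |x ⬝ᵥ y| ≤ u * ∑ j, |y j| := by
  unfold dotProduct
  refine (Finset.abs_sum_le_sum_abs _ _).trans ?_
  rw [Finset.mul_sum]
  refine Finset.sum_le_sum fun j _ => ?_
  rw [abs_mul]; gcongr; exact h j

lemma abs_mulVec_sub_le {p : ℕ} {V W : Matrix (Fin p) (Fin p) ℝ} {e : ℝ}
    (h : ∀ j k, |V j k - W j k| ≤ e) (x : Fin p → ℝ) (j : Fin p) :
    |(V *ᵥ x) j - (W *ᵥ x) j| ≤ e * ∑ k, |x k| := by
  have : (V *ᵥ x) j - (W *ᵥ x) j = (fun k => V j k - W j k) ⬝ᵥ x := by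
    simp [mulVec, dotProduct, sub_mul, Finset.sum_sub_distrib]
  rw [this]
  exact abs_dotProduct_le_of_abs_le (h j)

lemma abs_quadForm_sub_le {p : ℕ} {V W : Matrix (Fin p) (Fin p) ℝ} {e : ℝ}
    (h : ∀ j k, |V j k - W j k| ≤ e) (x : Fin p → ℝ) :
    |x ⬝ᵥ (V *ᵥ x) - x ⬝ᵥ (W *ᵥ x)| ≤ e * (∑ k, |x k|) ^ 2 := by
  rw [← dotProduct_sub, dotProduct_comm]
  calc _ ≤ (e * ∑ k, |x k|) * ∑ k, |x k| :=
        abs_dotProduct_le_of_abs_le fun j => abs_mulVec_sub_le h x j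
    _ = _ := by ring

/-- Error bounds for the lasso under an irrepresentable condition. -/
lemma lasso_error_le {p : ℕ} {W V : Matrix (Fin p) (Fin p) ℝ} {A : Finset (Fin p)}
    {γ γ' β b : Fin p → ℝ} {e φ κ lam s g : ℝ} (hβ : ∀ j ∉ A, β j = 0) (hγ : W *ᵥ β = γ)
    (hV : ∀ x, 0 ≤ x ⬝ᵥ (V *ᵥ x)) (hVW : ∀ j k, |V j k - W j k| ≤ e)
    (hγγ : ∀ j, |γ' j - γ j| ≤ e)
    (hrestr : ∀ (x : Fin p → ℝ) (u : ℝ), (∀ j ∈ A, |(W *ᵥ x) j| ≤ u) →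
      ∑ j ∈ A, |x j| ≤ s * φ * u + κ * ∑ j ∈ Aᶜ, |x j|)
    (hvar : ∀ v, (γ' - V *ᵥ b) ⬝ᵥ v ≤ lam / 2 * (∑ j, |b j + v j| - ∑ j, |b j|))
    (he0 : 0 ≤ e) (hlam : 0 < lam) (hs : 0 ≤ s) (hφ : 0 ≤ φ) (hκ : 0 ≤ κ) (hg : 0 < g) (hκg : κ ≤ 1 - g)
    (hτ : e * (∑ j, |β j| + 1) ≤ g / 4 * (lam / 2)) (hse : s * φ * e ≤ g / 16) :
    ∑ j, |b j - β j| ≤ 12 * s * φ * lam / g ∧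
      (b - β) ⬝ᵥ (W *ᵥ (b - β)) ≤ 12 * s * φ * lam ^ 2 / g := by
  set ℓ := lam / 2 with hℓ
  have hℓ0 : 0 < ℓ := by positivity
  set Δ := b - β with hΔ
  set D := ∑ j ∈ A, |Δ j| with hD
  set E := ∑ j ∈ Aᶜ, |Δ j| with hE
  set N := ∑ j, |Δ j| with hN
  have hNDE : N = D + E := (Finset.sum_add_sum_compl A fun j => |Δ j|).symm
  have hD0 : 0 ≤ D := Finset.sum_nonneg fun _ _ => abs_nonneg _
  have hE0 : 0 ≤ E := Finset.sum_nonneg fun _ _ => abs_nonneg _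
  -- The noise: the half-gradient of the empirical loss at the target `β`. By `hτ` it is at most a
  -- fraction `g / 4` of the effective penalty `ℓ`.
  set r := V *ᵥ β - γ' with hr
  have hg1 : g ≤ 1 := by linarith
  have hr_le : ∀ j, |r j| ≤ g / 4 * ℓ := by
    intro j
    have h1 := abs_mulVec_sub_le hVW β j
    have h2 := hγγ j
    have h3 : r j = ((V *ᵥ β) j - (W *ᵥ β) j) - (γ' j - γ j) := by
      rw [hr, hγ]; simp
    rw [h3]
    calc _ ≤ |(V *ᵥ β) j - (W *ᵥ β) j| + |γ' j - γ j| := abs_sub _ _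
      _ ≤ e * ∑ k, |β k| + e := add_le_add h1 h2
      _ ≤ _ := by linarith
  have hid : γ' - V *ᵥ b = -(V *ᵥ Δ) - r := by
    rw [hΔ, mulVec_sub, hr]; abel
  have hbasic : Δ ⬝ᵥ (V *ᵥ Δ) + r ⬝ᵥ Δ ≤ ℓ * (D - E) := by
    have h1 := hvar (-Δ)
    have h2 : ∑ j, |b j + (-Δ) j| - ∑ j, |b j| ≤ D - E := by
      rw [← Finset.sum_add_sum_compl A (fun j => |b j + (-Δ) j|),
        ← Finset.sum_add_sum_compl A (fun j => |b j|)]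
      have e1 : ∑ j ∈ Aᶜ, |b j + (-Δ) j| = 0 := by
        refine Finset.sum_eq_zero fun j hj => ?_
        have : b j + (-Δ) j = β j := by simp [hΔ]
        rw [this, hβ j (by simpa using hj), abs_zero]
      have e2 : ∑ j ∈ Aᶜ, |b j| = E := by
        refine Finset.sum_congr rfl fun j hj => ?_
        simp [hΔ, hβ j (by simpa using hj)]
      have e3 : ∑ j ∈ A, |b j + (-Δ) j| ≤ ∑ j ∈ A, |b j| + D := by
        rw [hD, ← Finset.sum_add_distrib]
        refine Finset.sum_le_sum fun j _ => ?_
        simpa using abs_add_le (b j) ((-Δ) j)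
      linarith
    rw [hid, dotProduct_neg, sub_dotProduct, neg_dotProduct, dotProduct_comm (V *ᵥ Δ)] at h1
    have h3 := mul_le_mul_of_nonneg_left h2 hℓ0.le
    linarith
  have hrΔ : |r ⬝ᵥ Δ| ≤ g / 4 * ℓ * N := abs_dotProduct_le_of_abs_le hr_le
  have hrΔ' := abs_le.1 hrΔ
  -- Cone condition: `hbasic` with the nonnegative quadratic form dropped.
  have hcone : E * (1 - g / 4) ≤ (1 + g / 4) * D := by
    have h1 := hV Δ
    rw [hNDE] at hrΔ'
    have : ℓ * (E * (1 - g / 4)) ≤ ℓ * ((1 + g / 4) * D) := by nlinarith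
    exact le_of_mul_le_mul_left this hℓ0
  -- Stationarity, coordinate by coordinate: the variational inequality is tested with plus and
  -- minus a unit vector.
  have hgrad : ∀ j, |(V *ᵥ b) j - γ' j| ≤ ℓ := by
    intro j
    have key : ∀ σ : ℝ, |σ| = 1 → (γ' j - (V *ᵥ b) j) * σ ≤ ℓ := by
      intro σ hσ
      have h1 := hvar (Pi.single j σ)
      rw [dotProduct_single] at h1
      have h2 : ∑ k, |b k + (Pi.single j σ : Fin p → ℝ) k| - ∑ k, |b k| ≤ 1 := by
        rw [← Finset.sum_sub_distrib]
        calc _ ≤ ∑ k, |(Pi.single j σ : Fin p → ℝ) k| :=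
              Finset.sum_le_sum fun k _ => by linarith [abs_add_le (b k) ((Pi.single j σ : Fin p → ℝ) k)]
          _ = 1 := by
            rw [Finset.sum_eq_single j]
            · simpa using hσ
            · intro k _ hk; simp [Pi.single_eq_of_ne hk]
            · simp
      have h3 := mul_le_mul_of_nonneg_left h2 hℓ0.le
      simp only [Pi.sub_apply] at h1
      linarith
    have k1 := key 1 (by simp)
    have k2 := key (-1) (by simp)
    rw [abs_le]; constructor <;> linarith
  have hVΔ : ∀ j, |(V *ᵥ Δ) j| ≤ ℓ * (1 + g / 4) := by
    intro j
    have : (V *ᵥ Δ) j = ((V *ᵥ b) j - γ' j) - r j := by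
      rw [hΔ, mulVec_sub, hr]; simp
    rw [this]
    linarith [abs_sub ((V *ᵥ b) j - γ' j) (r j), hgrad j, hr_le j]
  have hWΔ : ∀ j ∈ A, |(W *ᵥ Δ) j| ≤ ℓ * (1 + g / 4) + e * N := by
    intro j _
    have h1 := abs_mulVec_sub_le hVW Δ j
    have : (W *ᵥ Δ) j = (V *ᵥ Δ) j - ((V *ᵥ Δ) j - (W *ᵥ Δ) j) := by ring
    rw [this]
    linarith [abs_sub ((V *ᵥ Δ) j) ((V *ᵥ Δ) j - (W *ᵥ Δ) j), hVΔ j]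
  have hmain := hrestr Δ _ hWΔ
  change D ≤ s * φ * (ℓ * (1 + g / 4) + e * N) + κ * E at hmain
  have hsφ : 0 ≤ s * φ := mul_nonneg hs hφ
  have hN3 : N ≤ 3 * D := by
    rw [hNDE]
    nlinarith
  -- Here the irrepresentable condition beats the cone constant: (1 - g)(1 + g/4) ≤ (1 - g/2)(1 -
  -- g/4). Half of the gap survives, and 3g/16 of it pays for replacing `V` by `W` in `hseN`. The
  -- remaining 5g/16 against the factor 5/4 gives the constant 4 in `hDle`.
  have hκE : κ * E ≤ (1 - g / 2) * D := by
    have h1 : κ * E * (1 - g / 4) ≤ (1 - g) * ((1 + g / 4) * D) := by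
      calc κ * E * (1 - g / 4) = κ * (E * (1 - g / 4)) := by ring
        _ ≤ κ * ((1 + g / 4) * D) := by gcongr
        _ ≤ (1 - g) * ((1 + g / 4) * D) := by gcongr
    have h2 : (1 - g) * ((1 + g / 4) * D) ≤ ((1 - g / 2) * D) * (1 - g / 4) := by
      nlinarith [mul_nonneg (sq_nonneg g) hD0]
    exact le_of_mul_le_mul_right (h1.trans h2) (by linarith)
  have hseN : s * φ * (e * N) ≤ g / 16 * (3 * D) := by
    calc s * φ * (e * N) = (s * φ * e) * N := by ring
      _ ≤ g / 16 * N := by gcongr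
      _ ≤ _ := by gcongr
  have hDle : D * g ≤ 4 * (s * φ * ℓ) := by
    have h0 : 0 ≤ s * φ * ℓ := by positivity
    have h1 : s * φ * (ℓ * (1 + g / 4)) ≤ s * φ * ℓ * (5 / 4) := by
      have : s * φ * (ℓ * (1 + g / 4)) = s * φ * ℓ * (1 + g / 4) := by ring
      rw [this]; gcongr; linarith
    nlinarith
  have hD' : D ≤ 2 * (s * φ * lam) / g := by
    rw [le_div_iff₀ hg]; rw [hℓ] at hDle; linarith
  have hN' : N ≤ 12 * s * φ * lam / g := by
    have : 0 ≤ s * φ * lam / g := by positivity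
    calc N ≤ 3 * D := hN3
      _ ≤ 3 * (2 * (s * φ * lam) / g) := by gcongr
      _ = 6 * (s * φ * lam / g) := by ring
      _ ≤ 12 * (s * φ * lam / g) := by linarith
      _ = _ := by ring
  refine ⟨hN', ?_⟩
  have hq1 : Δ ⬝ᵥ (V *ᵥ Δ) ≤ lam * D := by
    rw [hNDE] at hrΔ'
    have : g / 4 * ℓ * (D + E) ≤ ℓ * (D + E) := by
      have : 0 ≤ ℓ * (D + E) := by positivity
      nlinarith
    have h2 : ℓ * (D - E) + ℓ * (D + E) = lam * D := by rw [hℓ]; ring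
    linarith [hrΔ'.1]
  have hq2 := (abs_le.1 (abs_quadForm_sub_le hVW Δ)).1
  have hN0 : 0 ≤ N := by rw [hNDE]; positivity
  have hN6 : N ≤ 6 * (s * φ * lam) / g := by
    calc N ≤ 3 * D := hN3
      _ ≤ 3 * (2 * (s * φ * lam) / g) := by gcongr
      _ = _ := by ring
  have hq3 : e * N ^ 2 ≤ 3 * (s * φ * lam ^ 2) / g := by
    calc e * N ^ 2 = e * N * N := by ring
      _ ≤ e * (6 * (s * φ * lam) / g) * (6 * (s * φ * lam) / g) := by gcongr
      _ = (s * φ * e) * (36 * (s * φ * lam ^ 2) / g ^ 2) := by ring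
      _ ≤ g / 16 * (36 * (s * φ * lam ^ 2) / g ^ 2) := by gcongr
      _ = 9 / 4 * (s * φ * lam ^ 2 / g) := by field_simp; ring
      _ ≤ 3 * (s * φ * lam ^ 2 / g) := by gcongr; norm_num
      _ = _ := by ring
  have hq4 : lam * D ≤ 2 * (s * φ * lam ^ 2) / g := by
    calc lam * D ≤ lam * (2 * (s * φ * lam) / g) := by gcongr
      _ = _ := by ring
  have hnn : 0 ≤ s * φ * lam ^ 2 / g := by positivity
  have : 12 * s * φ * lam ^ 2 / g = 12 * (s * φ * lam ^ 2 / g) := by ring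
  rw [this]
  have e5 : 2 * (s * φ * lam ^ 2) / g = 2 * (s * φ * lam ^ 2 / g) := by ring
  have e6 : 3 * (s * φ * lam ^ 2) / g = 3 * (s * φ * lam ^ 2 / g) := by ring
  linarith

/-! ### Consequences of bounds on the blocks of a covariance matrix -/

lemma sum_abs_le_rowSumNorm {m k : Type*} [Finite m] [Fintype k] (M : Matrix m k ℝ) (i : m) :
    ∑ j, |M i j| ≤ rowSumNorm M :=
  le_ciSup (f := fun i => ∑ j, |M i j|) (Set.finite_range _).bddAbove i

lemma rowSumNorm_nonneg {m k : Type*} [Fintype k] (M : Matrix m k ℝ) : 0 ≤ rowSumNorm M :=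
  Real.iSup_nonneg fun _ => Finset.sum_nonneg fun _ _ => abs_nonneg _

lemma abs_mulVec_le_rowSumNorm {m k : Type*} [Finite m] [Fintype k] (M : Matrix m k ℝ)
    {x : k → ℝ} {u : ℝ} (hx : ∀ j, |x j| ≤ u) (hu : 0 ≤ u) (i : m) :
    |(M *ᵥ x) i| ≤ rowSumNorm M * u := by
  calc |(M *ᵥ x) i| ≤ ∑ j, |M i j * x j| := Finset.abs_sum_le_sum_abs _ _
    _ ≤ ∑ j, |M i j| * u := Finset.sum_le_sum fun j _ => by rw [abs_mul]; gcongr; exact hx j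
    _ = (∑ j, |M i j|) * u := by rw [Finset.sum_mul]
    _ ≤ _ := by gcongr; exact sum_abs_le_rowSumNorm M i

/-- Duality: the row sum norm is the ℓ^∞ operator norm of `M`, hence bounds the ℓ¹ operator norm of
its transpose. This is how κ acts on ℓ¹ errors. -/
lemma sum_abs_vecMul_le_rowSumNorm {m k : Type*} [Fintype m] [Fintype k] (M : Matrix m k ℝ)
    (x : m → ℝ) : ∑ j, |(x ᵥ* M) j| ≤ rowSumNorm M * ∑ i, |x i| := by
  calc ∑ j, |(x ᵥ* M) j| ≤ ∑ j, ∑ i, |x i * M i j| :=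
        Finset.sum_le_sum fun j _ => Finset.abs_sum_le_sum_abs _ _
    _ = ∑ i, |x i| * ∑ j, |M i j| := by
      rw [Finset.sum_comm]
      simp only [abs_mul, Finset.mul_sum]
    _ ≤ ∑ i, |x i| * rowSumNorm M := by
      gcongr with i; exact sum_abs_le_rowSumNorm M i
    _ = _ := by rw [← Finset.sum_mul, mul_comm]

/-- The quadratic form of a symmetric matrix is bounded by its row sum norm. -/
lemma quadForm_le_rowSumNorm {k : Type*} [Fintype k] {M : Matrix k k ℝ} (hM : M.IsHermitian)
    (x : k → ℝ) : x ⬝ᵥ (M *ᵥ x) ≤ rowSumNorm M * ∑ j, x j ^ 2 := by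
  have hsymm : ∀ i j, M i j = M j i := fun i j => by
    have := hM.apply j i
    simpa using this
  have h1 : x ⬝ᵥ (M *ᵥ x) ≤ ∑ i, ∑ j, |M i j| * ((x i ^ 2 + x j ^ 2) / 2) := by
    simp only [dotProduct, mulVec, Finset.mul_sum]
    refine Finset.sum_le_sum fun i _ => Finset.sum_le_sum fun j _ => ?_
    have h2 : |x i| * |x j| ≤ (x i ^ 2 + x j ^ 2) / 2 := by
      nlinarith [sq_nonneg (|x i| - |x j|), sq_abs (x i), sq_abs (x j)]
    calc x i * (M i j * x j) ≤ |x i * (M i j * x j)| := le_abs_self _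
      _ = |M i j| * (|x i| * |x j|) := by rw [abs_mul, abs_mul]; ring
      _ ≤ _ := by gcongr
  have h3 : ∑ i, ∑ j, |M i j| * ((x i ^ 2 + x j ^ 2) / 2) = ∑ i, (∑ j, |M i j|) * x i ^ 2 := by
    have e1 : ∑ i, ∑ j, |M i j| * ((x i ^ 2 + x j ^ 2) / 2)
        = ∑ i, ∑ j, |M i j| * (x i ^ 2 / 2) + ∑ i, ∑ j, |M i j| * (x j ^ 2 / 2) := by
      simp only [← Finset.sum_add_distrib]
      refine Finset.sum_congr rfl fun i _ => Finset.sum_congr rfl fun j _ => by ring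
    have e2 : ∑ i, ∑ j, |M i j| * (x j ^ 2 / 2) = ∑ i, ∑ j, |M i j| * (x i ^ 2 / 2) := by
      rw [Finset.sum_comm]
      refine Finset.sum_congr rfl fun i _ => Finset.sum_congr rfl fun j _ => by rw [hsymm j i]
    rw [e1, e2, ← Finset.sum_add_distrib]
    refine Finset.sum_congr rfl fun i _ => ?_
    rw [← Finset.sum_mul]; ring
  rw [h3] at h1
  refine h1.trans ?_
  rw [Finset.mul_sum]
  gcongr with i
  exact sum_abs_le_rowSumNorm M i

section Blocks

variable {p : ℕ} {W : Matrix (Fin p) (Fin p) ℝ} {A : Finset (Fin p)}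

/-- The block of a matrix with rows and columns in `A`. -/
abbrev blockAA (W : Matrix (Fin p) (Fin p) ℝ) (A : Finset (Fin p)) :
    Matrix {j // j ∈ A} {j // j ∈ A} ℝ :=
  W.submatrix (fun j => j.1) (fun k => k.1)

/-- The block of a matrix with rows outside of `A` and columns in `A`. -/
abbrev blockAcA (W : Matrix (Fin p) (Fin p) ℝ) (A : Finset (Fin p)) :
    Matrix {j // j ∉ A} {j // j ∈ A} ℝ :=
  W.submatrix (fun j => j.1) (fun k => k.1)

lemma sum_mem_eq_sum_subtype (f : Fin p → ℝ) : ∑ j ∈ A, f j = ∑ j : {j // j ∈ A}, f j.1 :=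
  (Finset.sum_coe_sort A f).symm

lemma sum_compl_eq_sum_subtype (f : Fin p → ℝ) : ∑ j ∈ Aᶜ, f j = ∑ j : {j // j ∉ A}, f j.1 :=
  Finset.sum_subtype _ (by simp) f

lemma sum_eq_sum_subtype_add (f : Fin p → ℝ) :
    ∑ j, f j = ∑ j : {j // j ∈ A}, f j.1 + ∑ j : {j // j ∉ A}, f j.1 := by
  rw [← Finset.sum_add_sum_compl A f, sum_mem_eq_sum_subtype, sum_compl_eq_sum_subtype]

lemma posDef_blockAA (hW : W.PosDef) : (blockAA W A).PosDef :=
  hW.submatrix Subtype.val_injective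

lemma isUnit_det_blockAA (hW : W.PosDef) : IsUnit (blockAA W A).det :=
  (Matrix.isUnit_iff_isUnit_det _).1 (posDef_blockAA hW).isUnit

/-- Solve the rows of `W x` in `A` for the coordinates of `x` in `A`. By symmetry the coefficient
matrix of the other coordinates is the transpose of the matrix whose norm is κ, so it acts here from
the right. -/
lemma restrict_eq_of_posDef (hW : W.PosDef) (x : Fin p → ℝ) :
    (fun j : {j // j ∈ A} => x j.1) =
      (blockAA W A)⁻¹ *ᵥ (fun j : {j // j ∈ A} => (W *ᵥ x) j.1) -
      (fun j : {j // j ∉ A} => x j.1) ᵥ* (blockAcA W A * (blockAA W A)⁻¹) := by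
  have hsymm : ∀ i j, W i j = W j i := fun i j => by
    have := hW.1.apply j i
    simpa using this
  have h1 : (fun j : {j // j ∈ A} => (W *ᵥ x) j.1) =
      blockAA W A *ᵥ (fun j => x j.1) + (fun j : {j // j ∉ A} => x j.1) ᵥ* blockAcA W A := by
    ext j
    simp only [mulVec, vecMul, dotProduct, Pi.add_apply, submatrix_apply]
    rw [sum_eq_sum_subtype_add (A := A)]
    congr 1
    exact Finset.sum_congr rfl fun k _ => by rw [hsymm, mul_comm]
  have hinv : ((blockAA W A)⁻¹).IsHermitian := (posDef_blockAA hW).1.inv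
  have hT : ((blockAA W A)⁻¹)ᵀ = (blockAA W A)⁻¹ := by
    simpa [Matrix.IsHermitian, conjTranspose_eq_transpose_of_trivial] using hinv
  rw [h1, mulVec_add, mulVec_mulVec, nonsing_inv_mul _ (isUnit_det_blockAA hW), one_mulVec,
    ← vecMul_vecMul]
  have hQ : ∀ y, y ᵥ* (blockAA W A)⁻¹ = (blockAA W A)⁻¹ *ᵥ y := fun y => by
    rw [← vecMul_transpose, hT]
  rw [hQ, add_sub_cancel_right]

/-- An `ℓ¹` bound on the coordinates in `A` of a vector `x` in terms of the coordinates
in `A` of `W x` and the coordinates of `x` outside of `A`. -/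
lemma sum_abs_le_of_blocks (hW : W.PosDef) {φ κ : ℝ} (hφ : rowSumNorm (blockAA W A)⁻¹ ≤ φ)
    (hκ : rowSumNorm (blockAcA W A * (blockAA W A)⁻¹) ≤ κ) (x : Fin p → ℝ) (u : ℝ)
    (hu : ∀ j ∈ A, |(W *ᵥ x) j| ≤ u) :
    ∑ j ∈ A, |x j| ≤ A.card * φ * u + κ * ∑ j ∈ Aᶜ, |x j| := by
  rw [sum_mem_eq_sum_subtype, sum_compl_eq_sum_subtype]
  have hx := restrict_eq_of_posDef (A := A) hW x
  have h1 : ∀ j : {j // j ∈ A}, |x j.1| ≤ φ * u +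
      |((fun j : {j // j ∉ A} => x j.1) ᵥ* (blockAcA W A * (blockAA W A)⁻¹)) j| := by
    intro j
    have hu0 : 0 ≤ u := (abs_nonneg _).trans (hu j.1 j.2)
    have h2 := congrFun hx j
    simp only [Pi.sub_apply] at h2
    rw [h2]
    refine (abs_sub _ _).trans ?_
    gcongr
    calc _ ≤ rowSumNorm (blockAA W A)⁻¹ * u :=
          abs_mulVec_le_rowSumNorm _ (fun k => hu k.1 k.2) hu0 j
      _ ≤ _ := by gcongr
  calc ∑ j : {j // j ∈ A}, |x j.1| ≤ ∑ j : {j // j ∈ A}, (φ * u +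
      |((fun j : {j // j ∉ A} => x j.1) ᵥ* (blockAcA W A * (blockAA W A)⁻¹)) j|) :=
        Finset.sum_le_sum fun j _ => h1 j
    _ ≤ A.card * φ * u + rowSumNorm (blockAcA W A * (blockAA W A)⁻¹) *
        ∑ j : {j // j ∉ A}, |x j.1| := by
      rw [Finset.sum_add_distrib]
      gcongr
      · simp [mul_assoc]
      · exact sum_abs_vecMul_le_rowSumNorm _ _
    _ ≤ _ := by gcongr

variable {β : Fin p → ℝ}

lemma mulVec_eq_of_support (hβ : ∀ j ∉ A, β j = 0) (i : Fin p) :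
    (W *ᵥ β) i = ∑ k : {j // j ∈ A}, W i k.1 * β k.1 := by
  simp only [mulVec, dotProduct]
  rw [sum_eq_sum_subtype_add (A := A), add_eq_left]
  exact Finset.sum_eq_zero fun k _ => by rw [hβ k.1 k.2, mul_zero]

/-- The quadratic form of `W` dominates the squared Euclidean norm of vectors supported by `A`. -/
lemma sum_sq_le_of_blocks (hW : W.PosDef) {φ : ℝ} (hφ : rowSumNorm (blockAA W A)⁻¹ ≤ φ)
    (hφ0 : 0 < φ) (hβ : ∀ j ∉ A, β j = 0) :
    ∑ j, β j ^ 2 ≤ φ * (β ⬝ᵥ (W *ᵥ β)) := by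
  set x : {j // j ∈ A} → ℝ := fun j => β j.1 with hx
  have hq : β ⬝ᵥ (W *ᵥ β) = x ⬝ᵥ (blockAA W A *ᵥ x) := by
    simp only [dotProduct]
    rw [sum_eq_sum_subtype_add (A := A)]
    have : ∑ j : {j // j ∉ A}, β j.1 * (W *ᵥ β) j.1 = 0 :=
      Finset.sum_eq_zero fun k _ => by rw [hβ k.1 k.2, zero_mul]
    rw [this, add_zero]
    refine Finset.sum_congr rfl fun j _ => ?_
    rw [mulVec_eq_of_support hβ]
    rfl
  have hn : ∑ j, β j ^ 2 = x ⬝ᵥ x := by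
    rw [sum_eq_sum_subtype_add (A := A)]
    have : ∑ j : {j // j ∉ A}, β j.1 ^ 2 = 0 :=
      Finset.sum_eq_zero fun k _ => by rw [hβ k.1 k.2]; simp
    rw [this, add_zero]
    exact Finset.sum_congr rfl fun j _ => by simp only [hx]; ring
  set Q := (blockAA W A)⁻¹ with hQ
  have hpd := posDef_blockAA (A := A) hW
  have hsq : ∑ j, x j ^ 2 = x ⬝ᵥ x := Finset.sum_congr rfl fun j _ => by ring
  have h1 : x ⬝ᵥ (Q *ᵥ x) ≤ φ * (x ⬝ᵥ x) := by
    have := quadForm_le_rowSumNorm hpd.1.inv x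
    rw [hsq] at this
    refine this.trans ?_
    gcongr
    rw [← hsq]; positivity
  have hBQ : blockAA W A *ᵥ (Q *ᵥ x) = x := by
    rw [mulVec_mulVec, mul_nonsing_inv _ (isUnit_det_blockAA hW), one_mulVec]
  have hsymm : (Q *ᵥ x) ⬝ᵥ (blockAA W A *ᵥ x) = x ⬝ᵥ x := by
    have hT : (blockAA W A)ᵀ = blockAA W A := by
      simpa [Matrix.IsHermitian, conjTranspose_eq_transpose_of_trivial] using hpd.1
    rw [dotProduct_mulVec, ← mulVec_transpose, hT, hBQ]
  -- Completing a square replaces a spectral argument: an upper bound `φ` for the form of the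
  -- inverse `Q` gives the lower bound `φ⁻¹` for the form of the block itself.
  have h2 : 0 ≤ (x - φ⁻¹ • (Q *ᵥ x)) ⬝ᵥ (blockAA W A *ᵥ (x - φ⁻¹ • (Q *ᵥ x))) := by
    have := hpd.posSemidef.dotProduct_mulVec_nonneg (x - φ⁻¹ • (Q *ᵥ x))
    simpa using this
  have h3 : (x - φ⁻¹ • (Q *ᵥ x)) ⬝ᵥ (blockAA W A *ᵥ (x - φ⁻¹ • (Q *ᵥ x)))
      = x ⬝ᵥ (blockAA W A *ᵥ x) - 2 * φ⁻¹ * (x ⬝ᵥ x) + φ⁻¹ ^ 2 * (x ⬝ᵥ (Q *ᵥ x)) := by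
    rw [mulVec_sub, mulVec_smul, hBQ, sub_dotProduct, dotProduct_sub, dotProduct_sub,
      smul_dotProduct, smul_dotProduct, dotProduct_smul, dotProduct_smul, hsymm,
      dotProduct_comm (Q *ᵥ x) x]
    simp only [smul_eq_mul]
    ring
  rw [hq, hn]
  rw [h3] at h2
  have h4 : φ⁻¹ ^ 2 * (x ⬝ᵥ (Q *ᵥ x)) ≤ φ⁻¹ * (x ⬝ᵥ x) := by
    calc _ ≤ φ⁻¹ ^ 2 * (φ * (x ⬝ᵥ x)) := by gcongr
      _ = _ := by field_simp
  have h5 : φ⁻¹ * (x ⬝ᵥ x) ≤ x ⬝ᵥ (blockAA W A *ᵥ x) := by linarith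
  calc x ⬝ᵥ x = φ * (φ⁻¹ * (x ⬝ᵥ x)) := by field_simp
    _ ≤ _ := by gcongr

/-- If `β` is supported by `A`, then a bound on the coordinates of `W β` in `A` is a bound
on all of its coordinates. -/
lemma abs_mulVec_le_of_blocks (hW : W.PosDef)
    (hκ : rowSumNorm (blockAcA W A * (blockAA W A)⁻¹) ≤ 1) (hβ : ∀ j ∉ A, β j = 0) {D : ℝ}
    (hD0 : 0 ≤ D) (hD : ∀ j ∈ A, |(W *ᵥ β) j| ≤ D) (j : Fin p) : |(W *ᵥ β) j| ≤ D := by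
  by_cases hj : j ∈ A
  · exact hD j hj
  have h1 := restrict_eq_of_posDef (A := A) hW β
  have h0 : (fun j : {j // j ∉ A} => β j.1) = 0 := by ext k; exact hβ k.1 k.2
  rw [h0, zero_vecMul, sub_zero] at h1
  -- With `β` supported by `A`, the coordinates of `W β` outside of `A` are a linear image of those
  -- in `A`, under the matrix whose norm is κ.
  have h2 : (W *ᵥ β) j = ((blockAcA W A * (blockAA W A)⁻¹) *ᵥ
      (fun j : {j // j ∈ A} => (W *ᵥ β) j.1)) ⟨j, hj⟩ := by
    rw [← mulVec_mulVec, ← h1, mulVec_eq_of_support hβ]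
    rfl
  rw [h2]
  calc _ ≤ rowSumNorm (blockAcA W A * (blockAA W A)⁻¹) * D :=
        abs_mulVec_le_rowSumNorm _ (fun k => hD k.1 k.2) hD0 _
    _ ≤ 1 * D := by gcongr
    _ = D := one_mul D

end Blocks

/-! ### Population moments -/

section GaussianVector

variable {α : Type*} [MeasurableSpace α] {p : ℕ} {Q : Measure α}
  {T : α → Fin p → ℝ} {μ : Fin p → ℝ} {S : Matrix (Fin p) (Fin p) ℝ}

lemma measurePreserving_dot_multivariateGaussian (hS : S.PosSemidef) (b : Fin p → ℝ) :
    MeasurePreserving (fun x : EuclideanSpace ℝ (Fin p) => x.ofLp ⬝ᵥ b)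
      (multivariateGaussian (WithLp.toLp 2 μ) S)
      (gaussianReal (μ ⬝ᵥ b) (b ⬝ᵥ (S *ᵥ b)).toNNReal) := by
  have hf : (fun x : EuclideanSpace ℝ (Fin p) => x.ofLp ⬝ᵥ b) =
      (innerSL ℝ (WithLp.toLp 2 b : EuclideanSpace ℝ (Fin p))) := by
    ext x
    simp [PiLp.inner_apply, dotProduct]
  refine ⟨?_, ?_⟩
  · rw [hf]; exact (innerSL ℝ (WithLp.toLp 2 b : EuclideanSpace ℝ (Fin p))).continuous.measurable
  rw [hf, IsGaussian.map_eq_gaussianReal,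
    ContinuousLinearMap.integral_comp_id_comm IsGaussian.integrable_id,
    integral_id_multivariateGaussian]
  congr 1
  · have := covarianceBilin_self (μ := multivariateGaussian (WithLp.toLp 2 μ) S)
      IsGaussian.memLp_two_id (WithLp.toLp 2 b)
    rw [covarianceBilin_multivariateGaussian hS] at this
    congr 1
    exact this.symm

variable (h : HasLaw (fun z => WithLp.toLp 2 (T z)) (multivariateGaussian (WithLp.toLp 2 μ) S) Q)
include h

lemma hasLaw_dot (hS : S.PosSemidef) (b : Fin p → ℝ) :
    HasLaw (fun z => T z ⬝ᵥ b) (gaussianReal (μ ⬝ᵥ b) (b ⬝ᵥ (S *ᵥ b)).toNNReal) Q :=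
  (measurePreserving_dot_multivariateGaussian hS b).fun_comp_hasLaw h

lemma hasLaw_coord (hS : S.PosSemidef) (j : Fin p) :
    HasLaw (fun z => T z j) (gaussianReal (μ j) (S j j).toNNReal) Q :=
  (measurePreserving_eval_multivariateGaussian hS (i := j)).fun_comp_hasLaw h

lemma memLp_coord (hS : S.PosSemidef) (j : Fin p) : MemLp (fun z => T z j) 2 Q := by
  have h1 := hasLaw_coord h hS j
  have h2 : MemLp id 2 (Q.map fun z => T z j) := by
    rw [h1.map_eq]; exact memLp_id_gaussianReal' 2 (by simp)
  exact (memLp_map_measure_iff h2.1 h1.aemeasurable).1 h2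

lemma integral_coord (hS : S.PosSemidef) (j : Fin p) : ∫ z, T z j ∂Q = μ j := by
  have h1 := hasLaw_coord h hS j
  rw [h1.integral_eq]
  exact integral_id_gaussianReal

lemma integral_coord_mul_coord (hS : S.PosSemidef) (j k : Fin p) :
    ∫ z, T z j * T z k ∂Q = S j k + μ j * μ k := by
  have hQ : IsProbabilityMeasure Q := h.isProbabilityMeasure
  have h1 : cov[fun z => T z j, fun z => T z k; Q] = S j k := by
    rw [← covariance_eval_multivariateGaussian (μ := WithLp.toLp 2 μ) hS j k]
    exact h.covariance_fun_comp (f := fun x => x j) (g := fun x => x k)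
      (by fun_prop) (by fun_prop)
  rw [covariance_eq_sub (memLp_coord h hS j) (memLp_coord h hS k), integral_coord h hS,
    integral_coord h hS] at h1
  have h2 : ∫ z, ((fun z => T z j) * fun z => T z k) z ∂Q = ∫ z, T z j * T z k ∂Q := rfl
  rw [h2] at h1
  linarith

end GaussianVector

lemma Params.priorPos_add_priorNeg {p : ℕ} (θ : Params p) : θ.priorPos + θ.priorNeg = 1 := by
  unfold Params.priorNeg; ring

lemma measurableSet_label {p : ℕ} (y : ℝ) : MeasurableSet {z : ℝ × (Fin p → ℝ) | z.1 = y} :=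
  measurable_fst (measurableSet_singleton y)

lemma ae_cond_label {p : ℕ} {P : Measure (ℝ × (Fin p → ℝ))} (y : ℝ) : ∀ᵐ z ∂(cond P {z | z.1 = y}), z.1 = y := by
  have h1 : ∀ᵐ z ∂(P.restrict {z | z.1 = y}), z.1 = y :=
    ae_restrict_mem (measurableSet_label y)
  exact Measure.ae_smul_measure h1 _

namespace IsSeLDA

variable {p : ℕ} {P : Measure (ℝ × (Fin p → ℝ))} {θ : Params p} (h : IsSeLDA P θ)
include h

lemma priorNeg_pos : 0 < θ.priorNeg := by
  have := h.prior_lt_one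
  unfold Params.priorNeg; linarith

lemma measureReal_neg : P.real {z | z.1 = -1} = θ.priorNeg := by
  have := h.isProbabilityMeasure
  have h1 : P.real {z | z.1 = 1}ᶜ = P.real {z | z.1 = -1} := by
    refine measureReal_congr ?_
    filter_upwards [h.label] with z hz
    refine propext ⟨fun h1 => hz.resolve_left h1, fun h1 (h2 : z.1 = 1) => ?_⟩
    have h3 : z.1 = -1 := h1
    rw [h2] at h3; norm_num at h3
  rw [← h1, probReal_compl_eq_one_sub (measurableSet_label 1), h.prior_eq]
  rfl

/-- Total probability over the two classes. Besides moments, it transfers almost everywhere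
measurability of the `h_j` from the class laws to `P`; the `h_j` are not assumed measurable. -/
lemma measure_eq : P = ENNReal.ofReal θ.priorPos • cond P {z | z.1 = 1} +
    ENNReal.ofReal θ.priorNeg • cond P {z | z.1 = -1} := by
  have := h.isProbabilityMeasure
  have key : ∀ y π : ℝ, 0 < π → P.real {z | z.1 = y} = π →
      ENNReal.ofReal π • cond P {z | z.1 = y} = P.restrict {z | z.1 = y} := by
    intro y π hπ hy
    have h1 : P {z | z.1 = y} = ENNReal.ofReal π := by
      rw [← hy, ofReal_measureReal]
    rw [ProbabilityTheory.cond, h1, smul_smul, ENNReal.mul_inv_cancel, one_smul]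
    · simpa using hπ
    · simp
  rw [key 1 _ h.prior_pos h.prior_eq, key (-1) _ h.priorNeg_pos h.measureReal_neg,
    ← Measure.restrict_union _ (measurableSet_label (-1))]
  · refine (Measure.restrict_eq_self_of_ae_mem ?_).symm
    filter_upwards [h.label] with z hz using hz
  · rw [Set.disjoint_left]
    intro z (h1 : z.1 = 1) (h2 : z.1 = -1)
    rw [h1] at h2; norm_num at h2

lemma integral_eq {f : ℝ × (Fin p → ℝ) → ℝ} (h1 : Integrable f (cond P {z | z.1 = 1}))
    (h2 : Integrable f (cond P {z | z.1 = -1})) :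
    ∫ z, f z ∂P = θ.priorPos * ∫ z, f z ∂(cond P {z | z.1 = 1}) +
      θ.priorNeg * ∫ z, f z ∂(cond P {z | z.1 = -1}) := by
  conv_lhs => rw [h.measure_eq]
  rw [integral_add_measure (h1.smul_measure (by simp)) (h2.smul_measure (by simp)),
    integral_smul_measure, integral_smul_measure, ENNReal.toReal_ofReal h.prior_pos.le,
    ENNReal.toReal_ofReal h.priorNeg_pos.le]
  simp

lemma integrable {f : ℝ × (Fin p → ℝ) → ℝ} (h1 : Integrable f (cond P {z | z.1 = 1}))
    (h2 : Integrable f (cond P {z | z.1 = -1})) : Integrable f P := by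
  rw [h.measure_eq]
  exact (h1.smul_measure (by simp)).add_measure (h2.smul_measure (by simp))

lemma measureReal_eq (s : Set (ℝ × (Fin p → ℝ))) :
    P.real s = θ.priorPos * (cond P {z | z.1 = 1}).real s +
      θ.priorNeg * (cond P {z | z.1 = -1}).real s := by
  have := h.isProbabilityMeasure
  have := h.law_pos.isProbabilityMeasure
  have := h.law_neg.isProbabilityMeasure
  conv_lhs => rw [h.measure_eq]
  rw [measureReal_add_apply (by simp [ENNReal.mul_eq_top]) (by simp [ENNReal.mul_eq_top]),
    measureReal_ennreal_smul_apply, measureReal_ennreal_smul_apply,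
    ENNReal.toReal_ofReal h.prior_pos.le, ENNReal.toReal_ofReal h.priorNeg_pos.le]

lemma posSemidef : θ.Sigma.PosSemidef := h.posDef.posSemidef

lemma aemeasurable_coord (j : Fin p) : AEMeasurable (fun z => θ.transform z.2 j) P := by
  rw [h.measure_eq]
  exact ((hasLaw_coord h.law_pos h.posSemidef j).aemeasurable.smul_measure _).add_measure
    ((hasLaw_coord h.law_neg h.posSemidef j).aemeasurable.smul_measure _)

lemma memLp_coord (j : Fin p) : MemLp (fun z => θ.transform z.2 j) 2 P := by
  have := h.isProbabilityMeasure
  rw [memLp_two_iff_integrable_sq (h.aemeasurable_coord j).aestronglyMeasurable]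
  exact h.integrable (SSDA.memLp_coord h.law_pos h.posSemidef j).integrable_sq
    (SSDA.memLp_coord h.law_neg h.posSemidef j).integrable_sq

lemma integrable_coord_mul (j k : Fin p) :
    Integrable (fun z => θ.transform z.2 j * θ.transform z.2 k) P :=
  (h.memLp_coord j).integrable_mul (h.memLp_coord k)

lemma integral_coord (j : Fin p) : ∫ z, θ.transform z.2 j ∂P = θ.priorNeg * θ.muNeg j := by
  have := h.law_pos.isProbabilityMeasure
  have := h.law_neg.isProbabilityMeasure
  rw [h.integral_eq ((SSDA.memLp_coord h.law_pos h.posSemidef j).integrable (by norm_num))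
    ((SSDA.memLp_coord h.law_neg h.posSemidef j).integrable (by norm_num)),
    SSDA.integral_coord h.law_pos h.posSemidef, SSDA.integral_coord h.law_neg h.posSemidef,
    h.muPos_eq_zero]
  simp

lemma integral_coord_mul (j k : Fin p) :
    ∫ z, θ.transform z.2 j * θ.transform z.2 k ∂P =
      θ.Sigma j k + θ.priorNeg * (θ.muNeg j * θ.muNeg k) := by
  have h1 : Integrable (fun z => θ.transform z.2 j * θ.transform z.2 k) (cond P {z | z.1 = 1}) :=
    (SSDA.memLp_coord h.law_pos h.posSemidef j).integrable_mul
    (SSDA.memLp_coord h.law_pos h.posSemidef k)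
  have h2 : Integrable (fun z => θ.transform z.2 j * θ.transform z.2 k) (cond P {z | z.1 = -1}) :=
    (SSDA.memLp_coord h.law_neg h.posSemidef j).integrable_mul
    (SSDA.memLp_coord h.law_neg h.posSemidef k)
  rw [h.integral_eq h1 h2, integral_coord_mul_coord h.law_pos h.posSemidef,
    integral_coord_mul_coord h.law_neg h.posSemidef, h.muPos_eq_zero]
  have := θ.priorPos_add_priorNeg
  simp only [Pi.zero_apply]
  linear_combination θ.Sigma j k * this

lemma integral_label : ∫ z, z.1 ∂P = θ.priorPos - θ.priorNeg := by
  have := h.law_pos.isProbabilityMeasure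
  have := h.law_neg.isProbabilityMeasure
  have e1 : (fun z : ℝ × (Fin p → ℝ) => z.1) =ᵐ[cond P {z | z.1 = 1}] fun _ => (1 : ℝ) :=
    ae_cond_label 1
  have e2 : (fun z : ℝ × (Fin p → ℝ) => z.1) =ᵐ[cond P {z | z.1 = -1}] fun _ => (-1 : ℝ) :=
    ae_cond_label (-1)
  rw [h.integral_eq ((integrable_const _).congr e1.symm) ((integrable_const _).congr e2.symm),
    integral_congr_ae e1, integral_congr_ae e2]
  simp; ring

lemma integral_label_mul_coord (j : Fin p) :
    ∫ z, z.1 * θ.transform z.2 j ∂P = -(θ.priorNeg * θ.muNeg j) := by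
  have := h.law_pos.isProbabilityMeasure
  have := h.law_neg.isProbabilityMeasure
  have e1 : (fun z : ℝ × (Fin p → ℝ) => z.1 * θ.transform z.2 j)
      =ᵐ[cond P {z | z.1 = 1}] fun z => 1 * θ.transform z.2 j := by
    filter_upwards [ae_cond_label 1] with z hz
    rw [hz]
  have e2 : (fun z : ℝ × (Fin p → ℝ) => z.1 * θ.transform z.2 j)
      =ᵐ[cond P {z | z.1 = -1}] fun z => (-1) * θ.transform z.2 j := by
    filter_upwards [ae_cond_label (-1)] with z hz
    rw [hz]
  have i1 := (SSDA.memLp_coord h.law_pos h.posSemidef j).integrable (by norm_num)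
  have i2 := (SSDA.memLp_coord h.law_neg h.posSemidef j).integrable (by norm_num)
  rw [h.integral_eq ((i1.const_mul 1).congr e1.symm) ((i2.const_mul (-1)).congr e2.symm),
    integral_congr_ae e1, integral_congr_ae e2, integral_const_mul, integral_const_mul,
    SSDA.integral_coord h.law_pos h.posSemidef, SSDA.integral_coord h.law_neg h.posSemidef,
    h.muPos_eq_zero]
  simp

lemma delta_eq : θ.delta = -θ.muNeg := by
  simp [Params.delta, h.muPos_eq_zero]

/-- Law of total covariance: the label contributes a rank one term in δ. -/
lemma Omega_apply (j k : Fin p) : Omega P θ j k =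
    θ.Sigma j k + θ.priorPos * θ.priorNeg * (θ.delta j * θ.delta k) := by
  have := h.isProbabilityMeasure
  have h0 : Omega P θ j k
      = cov[fun z => θ.transform z.2 j, fun z => θ.transform z.2 k; P] := rfl
  have h2 : ∫ z, ((fun z : ℝ × (Fin p → ℝ) => θ.transform z.2 j) *
      fun z : ℝ × (Fin p → ℝ) => θ.transform z.2 k) z ∂P = ∫ z, θ.transform z.2 j * θ.transform z.2 k ∂P := rfl
  rw [h0, covariance_eq_sub (h.memLp_coord j) (h.memLp_coord k), h2, h.integral_coord_mul,
    h.integral_coord, h.integral_coord, h.delta_eq]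
  have := θ.priorPos_add_priorNeg
  simp only [Pi.neg_apply]
  linear_combination (-θ.priorNeg * θ.muNeg j * θ.muNeg k) * this

lemma Omega_mulVec (x : Fin p → ℝ) : Omega P θ *ᵥ x =
    θ.Sigma *ᵥ x + (θ.priorPos * θ.priorNeg * (θ.delta ⬝ᵥ x)) • θ.delta := by
  ext j
  simp only [mulVec, dotProduct, h.Omega_apply, Pi.add_apply, Pi.smul_apply, smul_eq_mul, add_mul,
    Finset.sum_add_distrib, Finset.mul_sum, Finset.sum_mul]
  congr 1
  exact Finset.sum_congr rfl fun k _ => by ring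

lemma Omega_quadForm (x : Fin p → ℝ) : x ⬝ᵥ (Omega P θ *ᵥ x) =
    x ⬝ᵥ (θ.Sigma *ᵥ x) + θ.priorPos * θ.priorNeg * (θ.delta ⬝ᵥ x) ^ 2 := by
  rw [h.Omega_mulVec, dotProduct_add, dotProduct_smul, smul_eq_mul, dotProduct_comm x θ.delta]
  ring

lemma Omega_posDef : (Omega P θ).PosDef := by
  have hs : ∀ j k, θ.Sigma k j = θ.Sigma j k := fun j k => by
    simpa using h.posDef.1.apply j k
  refine Matrix.PosDef.of_dotProduct_mulVec_pos ?_ fun x hx => ?_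
  · ext j k
    simp only [conjTranspose_apply, star_trivial, h.Omega_apply, hs]
    ring
  · rw [star_trivial, h.Omega_quadForm]
    have h1 : 0 < x ⬝ᵥ (θ.Sigma *ᵥ x) := by simpa using h.posDef.dotProduct_mulVec_pos hx
    have h2 : 0 ≤ θ.priorPos * θ.priorNeg * (θ.delta ⬝ᵥ x) ^ 2 :=
      mul_nonneg (mul_nonneg h.prior_pos.le h.priorNeg_pos.le) (sq_nonneg _)
    linarith

lemma Omega_mulVec_betaStar : Omega P θ *ᵥ betaStar P θ = θ.delta := by
  rw [betaStar, mulVec_mulVec, mul_nonsing_inv _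
    ((Matrix.isUnit_iff_isUnit_det _).1 h.Omega_posDef.isUnit), one_mulVec]

end IsSeLDA

lemma betaStar_eq_zero_of_notMem {p : ℕ} {P : Measure (ℝ × (Fin p → ℝ))} {θ : Params p}
    {j : Fin p} (hj : j ∉ active P θ) : betaStar P θ j = 0 := by
  classical
  simpa [active] using hj

/-! ### The standard normal distribution function and its inverse -/

/-- The standard normal distribution function. -/
abbrev stdCdf : ℝ → ℝ := cdf (gaussianReal 0 1)

/-- The standard normal density. -/
abbrev stdPdf : ℝ → ℝ := gaussianPDFReal 0 1

lemma stdPdf_eq (x : ℝ) : stdPdf x = (√(2 * Real.pi))⁻¹ * Real.exp (-x ^ 2 / 2) := by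
  simp [stdPdf, gaussianPDFReal]

lemma stdPdf_pos (x : ℝ) : 0 < stdPdf x := gaussianPDFReal_pos 0 1 x one_ne_zero

lemma stdPdf_le_of_abs_le {x R : ℝ} (h : |x| ≤ R) : stdPdf R ≤ stdPdf x := by
  rw [stdPdf_eq, stdPdf_eq]
  gcongr _ * Real.exp (-?_ / 2)
  rw [← sq_abs x]
  gcongr

lemma stdCdf_sub_ge {x y R : ℝ} (hx : -R ≤ x) (hxy : x ≤ y) (hy : y ≤ R) :
    (y - x) * stdPdf R ≤ stdCdf y - stdCdf x := by
  have h1 : stdCdf y - stdCdf x = (gaussianReal 0 1).real (Set.Ioc x y) := by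
    have h2 : gaussianReal 0 1 (Set.Ioc x y) = ENNReal.ofReal (stdCdf y - stdCdf x) := by
      conv_lhs => rw [← measure_cdf (gaussianReal 0 1)]
      exact StieltjesFunction.measure_Ioc _ _ _
    rw [measureReal_def, h2, ENNReal.toReal_ofReal]
    exact sub_nonneg.2 (monotone_cdf _ hxy)
  have h3 : (gaussianReal 0 1).real (Set.Ioc x y) = ∫ t in Set.Ioc x y, stdPdf t := by
    rw [measureReal_def, gaussianReal_apply_eq_integral _ one_ne_zero, ENNReal.toReal_ofReal]
    exact integral_nonneg fun t => (stdPdf_pos t).le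
  rw [h1, h3]
  have h4 : (y - x) * stdPdf R = ∫ _ in Set.Ioc x y, stdPdf R := by
    simp [hxy]
  rw [h4]
  refine setIntegral_mono_on (by simp) (integrable_gaussianPDFReal 0 1).integrableOn
    measurableSet_Ioc fun t ht => stdPdf_le_of_abs_le (abs_le.2 ⟨by linarith [ht.1], by linarith [ht.2]⟩)

lemma strictMono_stdCdf : StrictMono stdCdf := by
  intro x y hxy
  have h := stdCdf_sub_ge (R := max |x| |y|) (by linarith [neg_abs_le x, le_max_left |x| |y|])
    hxy.le ((le_abs_self y).trans (le_max_right _ _))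
  have h2 : 0 < (y - x) * stdPdf (max |x| |y|) := mul_pos (sub_pos.2 hxy) (stdPdf_pos _)
  linarith

/-- Positivity of `u` makes the set in `probit` bounded below; otherwise `sInf` would take its
default value. In `le_probit` the condition `u < 1` plays this role by making the set nonempty. -/
lemma probit_le {u x : ℝ} (hu : 0 < u) (h : u ≤ stdCdf x) : probit u ≤ x := by
  refine csInf_le ?_ h
  obtain ⟨y, hy⟩ := ((tendsto_cdf_atBot (gaussianReal 0 1)).eventually (gt_mem_nhds hu)).exists
  refine ⟨y, fun z hz => ?_⟩
  by_contra hlt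
  have h1 := (strictMono_stdCdf (not_le.1 hlt)).le
  have h2 : u ≤ stdCdf z := hz
  exact absurd (h2.trans h1) (not_le.2 hy)

lemma le_probit {u x : ℝ} (hu : u < 1) (h : stdCdf x ≤ u) : x ≤ probit u := by
  refine le_csInf ?_ fun z hz => ?_
  · obtain ⟨y, hy⟩ := ((tendsto_cdf_atTop (gaussianReal 0 1)).eventually (lt_mem_nhds hu)).exists
    exact ⟨y, hy.le⟩
  · by_contra hlt
    have h1 := strictMono_stdCdf (not_le.1 hlt)
    have h2 : u ≤ stdCdf z := hz
    linarith

/-- Chernoff's bound with exponent -1. An exponential tail is enough, since it only serves to bound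
the Winsorized pseudo data by a multiple of log n. -/
lemma stdCdf_neg_le (x : ℝ) : stdCdf (-x) ≤ Real.exp (1 / 2 - x) := by
  have h1 := measure_le_le_exp_mul_mgf (μ := gaussianReal 0 1) (X := id) (-x) (t := -1)
    (by norm_num) (integrable_exp_mul_gaussianReal (-1))
  rw [mgf_id_gaussianReal, ← Real.exp_add] at h1
  rw [stdCdf, cdf_eq_real]
  refine h1.trans_eq ?_
  congr 1
  norm_num
  ring

lemma one_sub_stdCdf_le (x : ℝ) : 1 - stdCdf x ≤ Real.exp (1 / 2 - x) := by
  have h1 := measure_ge_le_exp_mul_mgf (μ := gaussianReal 0 1) (X := id) x (t := 1)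
    (by norm_num) (integrable_exp_mul_gaussianReal 1)
  rw [mgf_id_gaussianReal, ← Real.exp_add] at h1
  rw [stdCdf, cdf_eq_real, ← probReal_compl_eq_one_sub measurableSet_Iic]
  calc _ ≤ (gaussianReal 0 1).real {ω | x ≤ id ω} := by
        refine measureReal_mono fun t ht => ?_
        simp only [Set.mem_compl_iff, Set.mem_Iic, not_le] at ht
        exact ht.le
    _ ≤ _ := h1
    _ = _ := by congr 1; norm_num; ring

lemma winsorize_mem {a F : ℝ} (ha : a ≤ 1 / 2) :
    a ≤ winsorize a (1 - a) F ∧ winsorize a (1 - a) F ≤ 1 - a := by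
  unfold winsorize
  split_ifs with h1 h2
  · constructor <;> linarith
  · constructor <;> linarith
  · exact ⟨not_lt.1 h2, not_lt.1 h1⟩

lemma abs_probit_winsorize_le {a F K : ℝ} (ha0 : 0 < a) (ha : a ≤ 1 / 2)
    (hK : Real.exp (1 / 2 - K) ≤ a) : |probit (winsorize a (1 - a) F)| ≤ K := by
  obtain ⟨h1, h2⟩ := winsorize_mem (F := F) ha
  rw [abs_le]
  constructor
  · exact le_probit (by linarith) (by linarith [stdCdf_neg_le K])
  · exact probit_le (by linarith) (by linarith [one_sub_stdCdf_le K])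

/-- For `|z| ≤ M` Winsorization does no harm: the normal law puts mass at least `stdPdf (M + 1) ≥ a`
on each of [-M-1, -M] and [M, M+1], so the cutoffs `a` and `1 - a` are compatible with the bracket
[Φ(z - B), Φ(z + B)]. -/
lemma abs_probit_winsorize_sub_le {a F z B M : ℝ} (ha0 : 0 < a) (ha : a ≤ 1 / 2)
    (haM : a ≤ stdPdf (M + 1)) (hB0 : 0 ≤ B) (hz : |z| ≤ M)
    (h1 : F ≤ stdCdf (z + B)) (h2 : stdCdf (z - B) ≤ F) :
    |probit (winsorize a (1 - a) F) - z| ≤ B := by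
  obtain ⟨hz1, hz2⟩ := abs_le.1 hz
  have hM : 0 ≤ M := (abs_nonneg z).trans hz
  obtain ⟨w1, w2⟩ := winsorize_mem (F := F) ha
  have hlow : a ≤ stdCdf (z + B) := by
    have e1 := stdCdf_sub_ge (x := -M - 1) (y := -M) (R := M + 1) (by linarith) (by linarith)
      (by linarith)
    have e2 : stdCdf (-M) ≤ stdCdf (z + B) := monotone_cdf _ (by linarith)
    have e3 : 0 ≤ stdCdf (-M - 1) := cdf_nonneg _ _
    have e4 : (-M - (-M - 1)) * stdPdf (M + 1) = stdPdf (M + 1) := by ring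
    linarith
  have hup : stdCdf (z - B) ≤ 1 - a := by
    have e1 := stdCdf_sub_ge (x := M) (y := M + 1) (R := M + 1) (by linarith) (by linarith)
      (by linarith)
    have e2 : stdCdf (z - B) ≤ stdCdf M := monotone_cdf _ (by linarith)
    have e3 : stdCdf (M + 1) ≤ 1 := cdf_le_one _ _
    have e4 : (M + 1 - M) * stdPdf (M + 1) = stdPdf (M + 1) := by ring
    linarith
  have hw : winsorize a (1 - a) F ≤ stdCdf (z + B) ∧ stdCdf (z - B) ≤ winsorize a (1 - a) F := by
    unfold winsorize
    split_ifs with c1 c2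
    · exact ⟨by linarith, hup⟩
    · exact ⟨hlow, by linarith⟩
    · exact ⟨h1, h2⟩
  have r1 := probit_le (by linarith) hw.1
  have r2 := le_probit (by linarith) hw.2
  rw [abs_le]
  constructor <;> linarith

/-! ### Truncated second moments -/

lemma sq_le_two_mul_exp {t : ℝ} (ht : 0 ≤ t) : t ^ 2 ≤ 2 * Real.exp t := by
  have := Real.quadratic_le_exp_of_nonneg ht
  linarith

/-- For u > M one has u² ≤ 2exp(u) and u ≤ (M + 1)u - M². The tilt M + 1 turns the truncated second
moment into moment generating functions and yields the Gaussian rate exp(-M²/2) up to a factor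
exp(O(M)). -/
lemma tail_sq_le {t M : ℝ} (hM : 0 ≤ M) :
    (if M < |t| then t ^ 2 else 0) ≤ 2 * Real.exp (-M ^ 2) *
      (Real.exp ((M + 1) * t) + Real.exp (-(M + 1) * t)) := by
  split_ifs with h
  · have key : ∀ u : ℝ, M < u → u ^ 2 ≤ 2 * Real.exp (-M ^ 2) * Real.exp ((M + 1) * u) := by
      intro u hu
      have h1 := sq_le_two_mul_exp (hM.trans hu.le)
      have h2 : Real.exp u ≤ Real.exp (-M ^ 2) * Real.exp ((M + 1) * u) := by
        rw [← Real.exp_add]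
        exact Real.exp_le_exp.2 (by nlinarith)
      linarith
    have e1 : 0 < Real.exp (-M ^ 2) * Real.exp ((M + 1) * t) := by positivity
    have e2 : 0 < Real.exp (-M ^ 2) * Real.exp (-(M + 1) * t) := by positivity
    rcases lt_abs.1 h with h | h
    · have := key t h
      nlinarith
    · have := key (-t) h
      rw [neg_sq, show (M + 1) * -t = -(M + 1) * t by ring] at this
      nlinarith
  · positivity

lemma integral_tail_sq_le {ν D M : ℝ} (hM : 0 ≤ M) (hν : |ν| ≤ D) :
    ∫ t, (if M < |t| then t ^ 2 else 0) ∂(gaussianReal ν 1) ≤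
      4 * Real.exp (-M ^ 2 / 2 + (M + 1) * (D + 1)) := by
  have i1 := integrable_exp_mul_gaussianReal (μ := ν) (v := 1) (M + 1)
  have i2 := integrable_exp_mul_gaussianReal (μ := ν) (v := 1) (-(M + 1))
  have m : ∀ s : ℝ, ∫ t, Real.exp (s * t) ∂(gaussianReal ν 1) = Real.exp (ν * s + s ^ 2 / 2) := by
    intro s
    have := congrFun (mgf_fun_id_gaussianReal (μ := ν) (v := 1)) s
    simpa [mgf] using this
  calc ∫ t, (if M < |t| then t ^ 2 else 0) ∂(gaussianReal ν 1)
      ≤ ∫ t, 2 * Real.exp (-M ^ 2) * (Real.exp ((M + 1) * t) + Real.exp (-(M + 1) * t))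
          ∂(gaussianReal ν 1) := by
        refine integral_mono_of_nonneg (ae_of_all _ fun t => ?_) ((i1.add i2).const_mul _)
          (ae_of_all _ fun t => tail_sq_le hM)
        simp only [Pi.zero_apply]
        split_ifs <;> positivity
    _ = 2 * Real.exp (-M ^ 2) * (Real.exp (ν * (M + 1) + (M + 1) ^ 2 / 2) +
          Real.exp (ν * -(M + 1) + (-(M + 1)) ^ 2 / 2)) := by
        rw [integral_const_mul, integral_add i1 i2, m, m]
    _ ≤ 2 * Real.exp (-M ^ 2) * (Real.exp (D * (M + 1) + (M + 1) ^ 2 / 2) +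
          Real.exp (D * (M + 1) + (M + 1) ^ 2 / 2)) := by
        obtain ⟨h1, h2⟩ := abs_le.1 hν
        gcongr 2 * Real.exp (-M ^ 2) * (Real.exp (?_ + _) + Real.exp ?_)
        · gcongr
        · nlinarith
    _ = 4 * Real.exp (-M ^ 2 + (D * (M + 1) + (M + 1) ^ 2 / 2)) := by
        rw [Real.exp_add (-M ^ 2)]; ring
    _ ≤ _ := by
        gcongr 4 * Real.exp ?_
        nlinarith

/-! ### The estimated transformation -/

section Transformation

variable {n p : ℕ} (D : Fin n → ℝ × (Fin p → ℝ))

lemma classSize_eq (y : ℝ) : classSize D y = ∑ i, if (D i).1 = y then (1 : ℝ) else 0 := by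
  simp [classSize, classIdx]

/-- Ranks are invariant under strictly increasing maps, so the empirical distribution function only
sees the transformed observations, which are normal in the class `Y = 1`. -/
lemma ecdfPos_eq {g : ℝ → ℝ} {S : Set ℝ} {j : Fin p} (hg : StrictMonoOn g S)
    (hD : ∀ i, (D i).2 j ∈ S) {x : ℝ} (hx : x ∈ S) :
    ecdfPos D j x =
      (∑ i, if (D i).1 = 1 ∧ g ((D i).2 j) ≤ g x then (1 : ℝ) else 0) / classSize D 1 := by
  unfold ecdfPos classIdx
  congr 1
  rw [Finset.filter_filter, Finset.sum_boole]
  simp only [hg.le_iff_le (hD _) hx]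

lemma abs_hHat_le {j : Fin p} {x K : ℝ} (h2 : 2 ≤ classSize D 1)
    (hK : Real.exp (1 / 2 - K) ≤ 1 / classSize D 1 ^ 2) : |hHat D j x| ≤ K := by
  refine abs_probit_winsorize_le (by positivity) ?_ hK
  rw [div_le_div_iff₀ (by positivity) (by norm_num)]
  nlinarith

/-- If the empirical distribution function of the transformed observations of the class `Y = 1`
is close to the normal distribution function on a grid, then the estimated transformation is
close to the true one. -/
lemma abs_hHat_sub_le {g : ℝ → ℝ} {S : Set ℝ} {j : Fin p} (hg : StrictMonoOn g S)
    (hD : ∀ i, (D i).2 j ∈ S) {x : ℝ} (hx : x ∈ S) {π π₀ t M B : ℝ} (hπ₀ : 0 < π₀) (hπ : π₀ ≤ π)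
    (hn : 0 < n) (hMn : M + 1 ≤ n) (hnB : 1 / (n : ℝ) ≤ B / 2) (hB : B ≤ 1)
    (ht : t ≤ π₀ / 2) (htB : 4 * t / π₀ ≤ B / 2 * stdPdf (M + 1))
    (hsize : |sampleMean (fun i => if (D i).1 = 1 then (1 : ℝ) else 0) - π| ≤ t)
    (hgrid : ∀ k : ℤ, |k| ≤ (n : ℤ) ^ 2 →
      |sampleMean (fun i => if (D i).1 = 1 ∧ g ((D i).2 j) ≤ k / n then (1 : ℝ) else 0) -
        π * stdCdf (k / n)| ≤ t)
    (h2 : 2 ≤ classSize D 1) (hM : 1 / classSize D 1 ^ 2 ≤ stdPdf (M + 1)) (hgx : |g x| ≤ M) :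
    |hHat D j x - g x| ≤ B := by
  have hn' : (0 : ℝ) < n := by exact_mod_cast hn
  set z := g x with hz
  obtain ⟨hz1, hz2⟩ := abs_le.1 hgx
  set N : ℝ → ℝ := fun u => sampleMean fun i => if (D i).1 = 1 ∧ g ((D i).2 j) ≤ u then (1 : ℝ) else 0
    with hN
  set π' := sampleMean (fun i => if (D i).1 = 1 then (1 : ℝ) else 0) with hπ'
  have hπ'_pos : π₀ / 2 ≤ π' := by linarith [(abs_le.1 hsize).1]
  have hπ'_nonneg : 0 ≤ π' := by linarith
  have hecdf : ecdfPos D j x = N z / π' := by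
    rw [ecdfPos_eq D hg hD hx, classSize_eq, hN, hπ']
    simp only [sampleMean]
    rw [mul_div_mul_left _ _ (by positivity)]
  have hNmono : Monotone N := by
    intro u v huv
    refine sampleMean_mono fun i => ?_
    split_ifs with c1 c2
    · exact le_rfl
    · exact absurd ⟨c1.1, c1.2.trans huv⟩ c2
    · norm_num
    · exact le_rfl
  -- Numerator and denominator of the empirical distribution function are each off by at most `t`,
  -- and the denominator is at least `π₀ / 2`.
  have hgrid' : ∀ k : ℤ, |k| ≤ (n : ℤ) ^ 2 → |N (k / n) / π' - stdCdf (k / n)| ≤ 4 * t / π₀ := by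
    intro k hk
    have h1 := hgrid k hk
    have hπ'0 : 0 < π' := by linarith
    have h3 : N (k / n) / π' - stdCdf (k / n)
        = ((N (k / n) - π * stdCdf (k / n)) - (π' - π) * stdCdf (k / n)) / π' := by
      field_simp; ring
    rw [h3, abs_div, abs_of_pos hπ'0, div_le_div_iff₀ hπ'0 hπ₀]
    have h4 : |(π' - π) * stdCdf (k / n)| ≤ t := by
      rw [abs_mul, abs_of_nonneg (cdf_nonneg _ _)]
      calc _ ≤ |π' - π| * 1 := by gcongr; exact cdf_le_one _ _
        _ ≤ t := by linarith
    have h5 := abs_sub (N (k / n) - π * stdCdf (k / n)) ((π' - π) * stdCdf (k / n))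
    have h6 : |N (k / n) - π * stdCdf (k / n) - (π' - π) * stdCdf (k / n)| ≤ 2 * t := by
      have : |N (k / n) - π * stdCdf (k / n)| ≤ t := h1
      linarith
    have ht0 : 0 ≤ t := (abs_nonneg _).trans hsize
    calc _ ≤ 2 * t * π₀ := by gcongr
      _ ≤ 4 * t * π' := by nlinarith
  have hMn2 : (M + 1) * n ≤ (n : ℝ) ^ 2 := by nlinarith
  have hn1 : (1 : ℝ) ≤ n := by exact_mod_cast hn
  refine abs_probit_winsorize_sub_le (by positivity) ?_ hM (by
    have : 0 ≤ 1 / (n : ℝ) := by positivity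
    linarith) hgx ?_ ?_
  · rw [div_le_div_iff₀ (by positivity) (by norm_num)]
    nlinarith
  · rw [hecdf]
    -- Monotonicity allows `z` to be rounded up to the grid, at a cost of at most 1/n ≤ B/2. The
    -- other half of `B` pays for the stochastic error: Φ(z + B) - Φ(z + B/2) ≥ (B/2)·`stdPdf (M +
    -- 1)`, which is at least 4t/π₀. The grid reaches far enough because M + 1 ≤ n.
    set k := ⌈z * n⌉ with hk
    have k1 : z * n ≤ k := Int.le_ceil _
    have k2 : (k : ℝ) < z * n + 1 := Int.ceil_lt_add_one _
    have k3 : |k| ≤ (n : ℤ) ^ 2 := by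
      rw [abs_le]
      constructor
      · have : (-((n : ℤ) ^ 2) : ℝ) ≤ k := by push_cast; nlinarith
        exact_mod_cast this
      · have : (k : ℝ) ≤ (n : ℝ) ^ 2 := by nlinarith
        exact_mod_cast this
    have k4 : z ≤ k / n := by rw [le_div_iff₀ hn']; exact k1
    have k5 : (k : ℝ) / n ≤ z + B / 2 := by
      calc (k : ℝ) / n ≤ (z * n + 1) / n := by gcongr
        _ = z + 1 / n := by field_simp
        _ ≤ _ := by linarith
    have e1 : N z / π' ≤ N (k / n) / π' := by
      have := hNmono k4
      gcongr
    have e2 := (abs_le.1 (hgrid' k k3)).2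
    have e3 : stdCdf (k / n) ≤ stdCdf (z + B / 2) := monotone_cdf _ k5
    have hB0 : 0 < B := by
      have : 0 < 1 / (n : ℝ) := by positivity
      linarith
    have e4 := stdCdf_sub_ge (x := z + B / 2) (y := z + B) (R := M + 1) (by linarith)
      (by linarith) (by linarith)
    have e5 : (z + B - (z + B / 2)) * stdPdf (M + 1) = B / 2 * stdPdf (M + 1) := by ring
    linarith
  · rw [hecdf]
    set k := ⌊z * n⌋ with hk
    have k1 : (k : ℝ) ≤ z * n := Int.floor_le _
    have k2 : z * n - 1 < k := Int.sub_one_lt_floor _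
    have k3 : |k| ≤ (n : ℤ) ^ 2 := by
      rw [abs_le]
      constructor
      · have : (-((n : ℤ) ^ 2) : ℝ) ≤ k := by push_cast; nlinarith
        exact_mod_cast this
      · have : (k : ℝ) ≤ (n : ℝ) ^ 2 := by nlinarith
        exact_mod_cast this
    have k4 : (k : ℝ) / n ≤ z := by rw [div_le_iff₀ hn']; exact k1
    have k5 : z - B / 2 ≤ (k : ℝ) / n := by
      calc z - B / 2 ≤ z - 1 / n := by linarith
        _ = (z * n - 1) / n := by field_simp
        _ ≤ _ := by gcongr
    have e1 : N (k / n) / π' ≤ N z / π' := by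
      have := hNmono k4
      gcongr
    have e2 := (abs_le.1 (hgrid' k k3)).1
    have e3 : stdCdf (z - B / 2) ≤ stdCdf (k / n) := monotone_cdf _ k5
    have hB0 : 0 < B := by
      have : 0 < 1 / (n : ℝ) := by positivity
      linarith
    have e4 := stdCdf_sub_ge (x := z - B) (y := z - B / 2) (R := M + 1) (by linarith)
      (by linarith) (by linarith)
    have e5 : (z - B / 2 - (z - B)) * stdPdf (M + 1) = B / 2 * stdPdf (M + 1) := by ring
    linarith

end Transformation

/-! ### Gaussian small ball bounds and the margin of the Bayes rule -/

/-- Bounded density: useful when τ is small against the standard deviation, whatever the mean. -/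
lemma gaussianReal_abs_le_le_of_density (c : ℝ) {v : ℝ} (hv : 0 < v) {τ : ℝ} (hτ : 0 ≤ τ) :
    (gaussianReal c v.toNNReal).real {u | |u| ≤ τ} ≤ 2 * τ / √v := by
  have hv' : v.toNNReal ≠ 0 := by simpa using hv
  have hset : {u : ℝ | |u| ≤ τ} = Set.Icc (-τ) τ := by ext u; simp [abs_le]
  have hpdf : ∀ u, gaussianPDFReal c v.toNNReal u ≤ 1 / √v := by
    intro u
    rw [gaussianPDFReal, Real.coe_toNNReal _ hv.le]
    have h1 : Real.exp (-(u - c) ^ 2 / (2 * v)) ≤ 1 :=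
      Real.exp_le_one_iff.2 (div_nonpos_of_nonpos_of_nonneg (by nlinarith [sq_nonneg (u - c)])
        (by positivity))
    have h2 : (√(2 * Real.pi * v))⁻¹ ≤ 1 / √v := by
      rw [one_div]
      gcongr
      nlinarith [Real.pi_gt_three]
    calc _ ≤ (√(2 * Real.pi * v))⁻¹ * 1 := by gcongr
      _ ≤ _ := by linarith
  rw [hset, measureReal_def, gaussianReal_apply_eq_integral _ hv', ENNReal.toReal_ofReal
    (integral_nonneg fun t => gaussianPDFReal_nonneg _ _ _)]
  calc ∫ u in Set.Icc (-τ) τ, gaussianPDFReal c v.toNNReal u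
      ≤ ∫ _ in Set.Icc (-τ) τ, 1 / √v :=
        setIntegral_mono_on (integrable_gaussianPDFReal _ _).integrableOn (by simp)
          measurableSet_Icc fun u _ => hpdf u
    _ = 2 * τ / √v := by
        simp only [integral_const, MeasurableSet.univ, measureReal_restrict_apply, Set.univ_inter,
          Real.volume_real_Icc_of_le (by linarith : -τ ≤ τ), smul_eq_mul]
        ring

/-- Chebyshev's inequality: the complementary case, in which the mean dominates the standard
deviation. -/
lemma gaussianReal_abs_le_le_of_mean {c v τ d : ℝ} (hv : 0 ≤ v) (hd : 0 < d)
    (hc : d ≤ |c| - τ) : (gaussianReal c v.toNNReal).real {u | |u| ≤ τ} ≤ v / d ^ 2 := by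
  have h1 := meas_ge_le_variance_div_sq (μ := gaussianReal c v.toNNReal) (X := id)
    (memLp_id_gaussianReal 2) hd
  rw [variance_id_gaussianReal] at h1
  have h2 : (gaussianReal c v.toNNReal).real {ω | d ≤ |id ω - ∫ x, id x ∂(gaussianReal c v.toNNReal)|}
      ≤ v / d ^ 2 := by
    rw [measureReal_def]
    refine ENNReal.toReal_le_of_le_ofReal (by positivity) ?_
    simpa [Real.coe_toNNReal _ hv] using h1
  refine (measureReal_mono fun u hu => ?_).trans h2
  simp only [Set.mem_ofPred_eq, id] at hu ⊢
  rw [integral_id_gaussianReal]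
  have := abs_sub_abs_le_abs_sub c u
  rw [abs_sub_comm u c]
  linarith

set_option maxHeartbeats 400000 in
/-- The linear discriminant of the Bayes rule is small with small probability only. -/
lemma exists_margin {π₀ ε : ℝ} (hπ₀ : 0 < π₀) (hε : 0 < ε) :
    ∃ ξ : ℝ, 0 < ξ ∧ ∀ π₁ π₂ m q ς : ℝ, π₀ ≤ π₁ → π₀ ≤ π₂ → π₁ + π₂ = 1 → 0 < m → 0 < q →
      q = m - π₁ * π₂ * m ^ 2 → |ς| = 1 →
      (gaussianReal (ς * m / 2 + Real.log (π₁ / π₂) * q / m) q.toNNReal).real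
        {u | |u| ≤ ξ * (√m + |Real.log (π₁ / π₂)|)} ≤ ε := by
  -- This allows a surplus factor `ε` to be dropped in the last of the three regimes below.
  wlog hε1 : ε ≤ 1 generalizing ε
  · obtain ⟨ξ, h1, h2⟩ := this one_pos le_rfl
    exact ⟨ξ, h1, fun π₁ π₂ m q ς a1 a2 a3 a4 a5 a6 a7 =>
      (h2 π₁ π₂ m q ς a1 a2 a3 a4 a5 a6 a7).trans (not_le.1 hε1).le⟩
  set Λ := 1 / π₀ with hΛ
  have hΛ0 : 0 < Λ := by positivity
  set ζ := min (ε / 16) (1 / (8 * (1 + Λ))) with hζ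
  have hζ0 : 0 < ζ := by positivity
  have hζ1 : ζ ≤ ε / 16 := min_le_left _ _
  have hζ2 : ζ * (8 * (1 + Λ)) ≤ 1 := by
    have := min_le_right (ε / 16) (1 / (8 * (1 + Λ)))
    rwa [← hζ, le_div_iff₀ (by positivity)] at this
  set K := 2 / (π₀ * ζ) + 2 / (ζ * ε) + 1 with hK
  have hK0 : 0 < K := by positivity
  have hK1 : 1 ≤ K := by rw [hK]; linarith [show 0 < 2 / (π₀ * ζ) + 2 / (ζ * ε) by positivity]
  have hK2 : 2 ≤ K * (π₀ * ζ) := by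
    rw [← div_le_iff₀ (by positivity), hK]; linarith [show 0 < 2 / (ζ * ε) by positivity]
  have hK3 : 2 ≤ K * (ζ * ε) := by
    rw [← div_le_iff₀ (by positivity), hK]; linarith [show 0 < 2 / (π₀ * ζ) by positivity]
  set ξ := min (ζ / 8) (min (1 / (8 * (1 + Λ))) (ε * √ζ / (2 * (1 + K)))) with hξ
  have hξ0 : 0 < ξ := by
    have := Real.sqrt_pos.2 hζ0
    positivity
  have hξ1 : ξ ≤ ζ / 8 := min_le_left _ _
  have hξ2 : ξ * (8 * (1 + Λ)) ≤ 1 := by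
    have := (min_le_right (ζ / 8) (min (1 / (8 * (1 + Λ))) (ε * √ζ / (2 * (1 + K))))).trans
      (min_le_left _ _)
    rwa [← hξ, le_div_iff₀ (by positivity)] at this
  have hξ3 : ξ * (2 * (1 + K)) ≤ ε * √ζ := by
    have := (min_le_right (ζ / 8) (min (1 / (8 * (1 + Λ))) (ε * √ζ / (2 * (1 + K))))).trans
      (min_le_right _ _)
    rwa [← hξ, le_div_iff₀ (by positivity)] at this
  refine ⟨ξ, hξ0, fun π₁ π₂ m q ς h1 h2 h12 hm hq hqm hς => ?_⟩
  set a := Real.log (π₁ / π₂) with ha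
  have hπ₁ : 0 < π₁ := hπ₀.trans_le h1
  have hπ₂ : 0 < π₂ := hπ₀.trans_le h2
  have haΛ : |a| ≤ Λ := by
    have key : ∀ x y : ℝ, π₀ ≤ x → π₀ ≤ y → x + y = 1 → Real.log (x / y) ≤ Λ := by
      intro x y hx hy hxy
      have hy0 : 0 < y := hπ₀.trans_le hy
      have hx0 : 0 < x := hπ₀.trans_le hx
      calc Real.log (x / y) ≤ x / y := (Real.log_le_sub_one_of_pos (by positivity)).trans (by linarith)
        _ ≤ 1 / π₀ := by gcongr; linarith
    rw [abs_le]
    refine ⟨?_, key _ _ h1 h2 h12⟩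
    have := key _ _ h2 h1 (by linarith)
    rw [← inv_div, Real.log_inv] at this
    linarith
  have hπ12 : π₁ * π₂ ≤ 1 / 4 := by nlinarith [sq_nonneg (π₁ - π₂)]
  have hπ12' : 0 < π₁ * π₂ := by positivity
  have hqm' : q / m = 1 - π₁ * π₂ * m := by rw [hqm]; field_simp
  have hqle : q ≤ m := by rw [hqm]; linarith [mul_nonneg hπ12'.le (sq_nonneg m)]
  have hq1 : q / m ≤ 1 := by rw [div_le_one hm]; exact hqle
  have hq0 : 0 < q / m := by positivity
  have hR0 : 0 < √m := Real.sqrt_pos.2 hm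
  have hRR : √m * √m = m := Real.mul_self_sqrt hm.le
  have hmean : ς * m / 2 + a * q / m = ς * (m / 2) + a * (q / m) := by ring
  have hςm : |ς * (m / 2)| = m / 2 := by rw [abs_mul, hς, one_mul, abs_of_pos (by positivity)]
  have haq : |a * (q / m)| = |a| * (q / m) := by rw [abs_mul, abs_of_pos hq0]
  have t1 := abs_sub_abs_le_abs_add (ς * (m / 2)) (a * (q / m))
  have t2 := abs_sub_abs_le_abs_add (a * (q / m)) (ς * (m / 2))
  rw [add_comm] at t2
  rw [hςm, haq] at t1 t2
  rw [hmean]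
  -- Three regimes. If q < ζm, then q/m = 1 - π₁π₂m is nearly 0, so m ≥ 7/2 and the mean, of size at
  -- least 3m/8, dominates. If q ≥ ζm and |a| ≤ K√m, the standard deviation is comparable with the
  -- threshold and the density bound applies. If |a| > K√m, the mean is dominated by a·q/m, of size
  -- at least ζ|a|, and Chebyshev's inequality applies again.
  by_cases hcase : q < ζ * m
  · have hqζ : q / m < ζ := by rwa [div_lt_iff₀ hm]
    have hζΛ : 0 < ζ * Λ := by positivity
    have hζ8 : ζ ≤ 1 / 8 := by linarith
    have hm3 : 7 / 2 ≤ m := by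
      have := mul_le_mul_of_nonneg_right hπ12 hm.le
      linarith
    have hRm : √m ≤ m := by
      rw [Real.sqrt_le_left hm.le]; exact le_self_pow₀ (by linarith) two_ne_zero
    have hb1 : |a| * (q / m) ≤ m / 8 := by
      calc |a| * (q / m) ≤ Λ * ζ := by gcongr
        _ ≤ 1 / 8 := by linarith
        _ ≤ m / 8 := by linarith
    have hb2 : ξ * (√m + |a|) ≤ m / 8 := by
      calc ξ * (√m + |a|) ≤ ξ * (m + Λ * m) := by
            have : Λ ≤ Λ * m := le_mul_of_one_le_right hΛ0.le (by linarith)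
            gcongr
            linarith
        _ = ξ * (8 * (1 + Λ)) * (m / 8) := by ring
        _ ≤ 1 * (m / 8) := by gcongr
        _ = _ := one_mul _
    refine (gaussianReal_abs_le_le_of_mean (d := m / 4) hq.le (by positivity) (by linarith)).trans ?_
    rw [div_le_iff₀ (by positivity)]
    have e1 : 16 * ζ ≤ ε := by linarith
    have e2 : ζ * m ≤ ε * (m / 4) ^ 2 := by
      have : ε * (m / 4) ^ 2 = ε / 16 * (m * m) := by ring
      rw [this]
      have : m ≤ m * m := le_mul_of_one_le_left hm.le (by linarith)
      gcongr
    linarith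
  · have hζq : ζ ≤ q / m := by rw [le_div_iff₀ hm]; exact not_lt.1 hcase
    by_cases hcase2 : |a| ≤ K * √m
    · refine (gaussianReal_abs_le_le_of_density _ hq (by positivity)).trans ?_
      have hsq : √ζ * √m ≤ √q := by
        rw [← Real.sqrt_mul hζ0.le]
        exact Real.sqrt_le_sqrt (not_lt.1 hcase)
      rw [div_le_iff₀ (Real.sqrt_pos.2 hq)]
      calc 2 * (ξ * (√m + |a|)) ≤ 2 * (ξ * (√m + K * √m)) := by gcongr
        _ = ξ * (2 * (1 + K)) * √m := by ring
        _ ≤ ε * √ζ * √m := by gcongr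
        _ = ε * (√ζ * √m) := by ring
        _ ≤ _ := by gcongr
    · have haK := not_le.1 hcase2
      have ha0 : 0 < |a| := lt_trans (by positivity) haK
      have hmle : m ≤ 1 / π₀ ^ 2 := by
        have h3 : π₁ * π₂ * m < 1 := by linarith
        have h4 : π₀ ^ 2 ≤ π₁ * π₂ := by rw [sq]; gcongr
        rw [le_div_iff₀ (by positivity), mul_comm]
        exact (mul_le_mul_of_nonneg_right h4 hm.le).trans h3.le
      have hRle : √m ≤ 1 / π₀ := by
        rw [Real.sqrt_le_left (by positivity)]
        calc m ≤ 1 / π₀ ^ 2 := hmle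
          _ = _ := by ring
      have hRπ : √m * π₀ ≤ 1 := by rwa [le_div_iff₀ hπ₀] at hRle
      have hb1 : m / 2 ≤ |a| * ζ / 4 := by
        have e1 : √m * 2 ≤ |a| * (π₀ * ζ) := by
          calc √m * 2 ≤ √m * (K * (π₀ * ζ)) := by gcongr
            _ = K * √m * (π₀ * ζ) := by ring
            _ ≤ _ := by gcongr
        have e2 : √m * √m * 2 ≤ |a| * ζ := by
          calc √m * √m * 2 = √m * (√m * 2) := by ring
            _ ≤ √m * (|a| * (π₀ * ζ)) := by gcongr
            _ = (√m * π₀) * (|a| * ζ) := by ring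
            _ ≤ 1 * (|a| * ζ) := by gcongr
            _ = _ := one_mul _
        rw [hRR] at e2
        linarith
      have hb2 : ξ * (√m + |a|) ≤ |a| * ζ / 4 := by
        have : √m ≤ |a| := (le_mul_of_one_le_left hR0.le hK1).trans haK.le
        calc ξ * (√m + |a|) ≤ ζ / 8 * (|a| + |a|) := by gcongr
          _ = _ := by ring
      have hb3 : |a| * ζ ≤ |a| * (q / m) := by gcongr
      refine (gaussianReal_abs_le_le_of_mean (d := |a| * ζ / 2) hq.le (by positivity)
        (by linarith)).trans ?_
      rw [div_le_iff₀ (by positivity)]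
      have e1 : √m * 2 ≤ |a| * (ζ * ε) := by
        calc √m * 2 ≤ √m * (K * (ζ * ε)) := by gcongr
          _ = K * √m * (ζ * ε) := by ring
          _ ≤ _ := by gcongr
      have e2 : 4 * m ≤ (|a| * ζ * ε) ^ 2 := by
        calc 4 * m = (√m * 2) ^ 2 := by rw [mul_pow, sq (√m), hRR]; ring
          _ ≤ (|a| * (ζ * ε)) ^ 2 := by gcongr
          _ = _ := by ring
      calc q ≤ m := hqle
        _ ≤ (|a| * ζ * ε) ^ 2 / 4 := by linarith
        _ = ε * (ε * (|a| * ζ / 2) ^ 2) := by ring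
        _ ≤ 1 * (ε * (|a| * ζ / 2) ^ 2) := by gcongr
        _ = _ := one_mul _

/-! ### Comparison of two linear classifiers -/

lemma sign_eq_of_abs_sub_le {u v τ : ℝ} (h1 : τ < |u|) (h2 : |v - u| ≤ τ) :
    Real.sign v = Real.sign u := by
  obtain ⟨h3, h4⟩ := abs_le.1 h2
  rcases lt_abs.1 h1 with h | h
  · rw [Real.sign_of_pos (by linarith), Real.sign_of_pos (by linarith)]
  · rw [Real.sign_of_neg (by linarith), Real.sign_of_neg (by linarith)]

lemma sign_mul_of_pos {c : ℝ} (hc : 0 < c) (x : ℝ) : Real.sign (c * x) = Real.sign x := by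
  rcases lt_trichotomy x 0 with h | rfl | h
  · rw [Real.sign_of_neg h, Real.sign_of_neg (mul_neg_of_pos_of_neg hc h)]
  · simp
  · rw [Real.sign_of_pos h, Real.sign_of_pos (mul_pos hc h)]

/-- The error probabilities of two classifiers are close if their discriminants are close with
high probability and one of them has a margin with high probability. -/
lemma abs_error_sub_le {α : Type*} [MeasurableSpace α] (P : Measure α) [IsProbabilityMeasure P]
    (Y U V : α → ℝ) (τ : ℝ) :
    |P.real {z | Y z ≠ Real.sign (V z)} - P.real {z | Y z ≠ Real.sign (U z)}| ≤
      P.real {z | |U z| ≤ τ} + P.real {z | τ < |V z - U z|} := by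
  have key : ∀ z, ¬ (|U z| ≤ τ ∨ τ < |V z - U z|) → Real.sign (V z) = Real.sign (U z) := by
    intro z hz
    push Not at hz
    exact sign_eq_of_abs_sub_le hz.1 hz.2
  have hu : ∀ s t : Set α, (∀ z, z ∈ s → z ∈ t ∨ (|U z| ≤ τ ∨ τ < |V z - U z|)) →
      P.real s ≤ P.real t + (P.real {z | |U z| ≤ τ} + P.real {z | τ < |V z - U z|}) := by
    intro s t h
    calc P.real s ≤ P.real (t ∪ ({z | |U z| ≤ τ} ∪ {z | τ < |V z - U z|})) := measureReal_mono h
      _ ≤ P.real t + P.real ({z | |U z| ≤ τ} ∪ {z | τ < |V z - U z|}) := measureReal_union_le _ _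
      _ ≤ _ := by gcongr; exact measureReal_union_le _ _
  rw [abs_sub_le_iff]
  constructor
  · have := hu {z | Y z ≠ Real.sign (V z)} {z | Y z ≠ Real.sign (U z)} fun z hz => by
      by_cases hc : |U z| ≤ τ ∨ τ < |V z - U z|
      · exact Or.inr hc
      · left; simp only [Set.mem_ofPred_eq] at hz ⊢; rwa [← key z hc]
    linarith
  · have := hu {z | Y z ≠ Real.sign (U z)} {z | Y z ≠ Real.sign (V z)} fun z hz => by
      by_cases hc : |U z| ≤ τ ∨ τ < |V z - U z|
      · exact Or.inr hc
      · left; simp only [Set.mem_ofPred_eq] at hz ⊢; rwa [key z hc]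
    linarith

/-- Stability of the intercept of the discriminant rule. -/
lemma abs_intercept_sub_le {m q m' q' l l' a a' x K R : ℝ} (hm : 0 < m) (hR : 0 ≤ R)
    (hmR : m ≤ K * R) (hq0 : 0 ≤ q) (hqm : q ≤ m) (hm' : |m' - m| ≤ 3 * x * m)
    (hq' : |q' - q| ≤ 4 * x * m) (hl : |l' - l| ≤ 3 * x * m) (ha : |a' - a| ≤ x * R)
    (hx0 : 0 ≤ x) (hx : x ≤ 1 / 6) (hK : 1 ≤ K) :
    |(-l' / 2 + a' * q' / m') - (-l / 2 + a * q / m)| ≤ 16 * K * x * (R + |a|) := by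
  -- The bound x ≤ 1/6 is chosen to keep the relative error 3x of the denominator below 1/2.
  have hm'2 : m / 2 ≤ m' := by
    have := (abs_le.1 hm').1
    nlinarith
  have hm'0 : 0 < m' := by linarith
  have hratio : |q' / m' - q / m| ≤ 14 * x := by
    have e1 : q' / m' - q / m = ((q' - q) - (q / m) * (m' - m)) / m' := by field_simp; ring
    have hqm1 : q / m ≤ 1 := (div_le_one hm).2 hqm
    have hqm0 : 0 ≤ q / m := by positivity
    rw [e1, abs_div, abs_of_pos hm'0, div_le_iff₀ hm'0]
    calc |(q' - q) - (q / m) * (m' - m)| ≤ |q' - q| + |(q / m) * (m' - m)| := abs_sub _ _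
      _ ≤ 4 * x * m + 1 * (3 * x * m) := by
        rw [abs_mul, abs_of_nonneg hqm0]; gcongr
      _ = 14 * x * (m / 2) := by ring
      _ ≤ _ := by gcongr
  have hq4 : |q' / m'| ≤ 4 := by
    have h1 : |q / m| ≤ 1 := by
      rw [abs_of_nonneg (by positivity)]; exact (div_le_one hm).2 hqm
    have h2 := abs_sub_abs_le_abs_sub (q' / m') (q / m)
    linarith
  have e : (-l' / 2 + a' * q' / m') - (-l / 2 + a * q / m)
      = -((l' - l) / 2) + ((a' - a) * (q' / m') + a * (q' / m' - q / m)) := by ring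
  rw [e]
  have s1 : |-((l' - l) / 2)| ≤ 3 / 2 * x * (K * R) := by
    rw [abs_neg, abs_div, abs_two]
    have : 3 * x * m ≤ 3 * x * (K * R) := by gcongr
    linarith
  have s2 : |(a' - a) * (q' / m')| ≤ x * R * 4 := by
    rw [abs_mul]; gcongr
  have s3 : |a * (q' / m' - q / m)| ≤ |a| * (14 * x) := by
    rw [abs_mul]; gcongr
  have s4 := abs_add_le (-((l' - l) / 2)) ((a' - a) * (q' / m') + a * (q' / m' - q / m))
  have s5 := abs_add_le ((a' - a) * (q' / m')) (a * (q' / m' - q / m))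
  have hxR : 0 ≤ x * R := by positivity
  have hxa : 0 ≤ x * |a| := by positivity
  have f1 : x * R ≤ K * (x * R) := le_mul_of_one_le_left hxR hK
  have f2 : x * |a| ≤ K * (x * |a|) := le_mul_of_one_le_left hxa hK
  nlinarith

/-! ### Sample moments of pseudo data -/

/-- The mean of the rows of `H` within the class with label `y`. -/
def classMean {n p : ℕ} (Y : Fin n → ℝ) (H : Fin n → Fin p → ℝ) (y : ℝ) : Fin p → ℝ :=
  fun j => (∑ i, if Y i = y then H i j else 0) / ∑ i, if Y i = y then (1 : ℝ) else 0

/-- The pooled within-class covariance matrix of the rows of `H`. -/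
def pooledCov {n p : ℕ} (Y : Fin n → ℝ) (H : Fin n → Fin p → ℝ) : Matrix (Fin p) (Fin p) ℝ :=
  Matrix.of fun j k => (∑ i, (H i j - classMean Y H (Y i) j) * (H i k - classMean Y H (Y i) k)) /
    ((n : ℝ) - 2)

/-- The relative frequency of the label `y`. -/
def classFreq {n : ℕ} (Y : Fin n → ℝ) (y : ℝ) : ℝ :=
  sampleMean fun i => if Y i = y then (1 : ℝ) else 0

/-- The first and second sample moments of labels `Y` and pseudo data `H` are within `e` of those
of a mixture of `N(0, S)` and `N(μ, S)` with weights `π₁` and `π₂`. -/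
structure MomentsClose {n p : ℕ} (Y : Fin n → ℝ) (H : Fin n → Fin p → ℝ) (π₁ π₂ : ℝ)
    (μ : Fin p → ℝ) (S : Matrix (Fin p) (Fin p) ℝ) (e : ℝ) : Prop where
  label : ∀ i, Y i = 1 ∨ Y i = -1
  four_le : 4 ≤ n
  inv_le : 4 / (n : ℝ) ≤ e
  mean_label : |sampleMean Y - (π₁ - π₂)| ≤ e
  mean : ∀ j, |sampleMean (fun i => H i j) - π₂ * μ j| ≤ e
  mean_label_mul : ∀ j, |sampleMean (fun i => Y i * H i j) - -(π₂ * μ j)| ≤ e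
  mean_mul : ∀ j k, |sampleMean (fun i => H i j * H i k) - (S j k + π₂ * (μ j * μ k))| ≤ e

/-- The statistics which determine the fitted classifier are within `e` of their population
counterparts. -/
structure StatisticsClose {n p : ℕ} (Y : Fin n → ℝ) (H : Fin n → Fin p → ℝ) (π₁ π₂ : ℝ)
    (μ : Fin p → ℝ) (S : Matrix (Fin p) (Fin p) ℝ) (e : ℝ) : Prop where
  freq_pos : |classFreq Y 1 - π₁| ≤ e
  freq_neg : |classFreq Y (-1) - π₂| ≤ e
  mean_pos : ∀ j, |classMean Y H 1 j| ≤ e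
  mean_neg : ∀ j, |classMean Y H (-1) j - μ j| ≤ e
  pooled : ∀ j k, |pooledCov Y H j k - S j k| ≤ e
  cov : ∀ j k, |sampleCovMatrix H j k - (S j k + π₁ * π₂ * (μ j * μ k))| ≤ e
  cov_label : ∀ j, |sampleCov Y (fun i => H i j) - -(2 * π₁ * π₂ * μ j)| ≤ e

lemma abs_mul_sub_mul_le {x y a b ε δ A B : ℝ} (hx : |x - a| ≤ ε) (hy : |y - b| ≤ δ)
    (ha : |a| ≤ A) (hb : |y| ≤ B) : |x * y - a * b| ≤ ε * B + A * δ := by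
  have : x * y - a * b = (x - a) * y + a * (y - b) := by ring
  rw [this]
  refine (abs_add_le _ _).trans ?_
  rw [abs_mul, abs_mul]
  have h1 := (abs_nonneg _).trans hx
  have h2 := (abs_nonneg _).trans ha
  gcongr

namespace MomentsClose

variable {n p : ℕ} {Y : Fin n → ℝ} {H : Fin n → Fin p → ℝ} {π₁ π₂ : ℝ}
    {μ : Fin p → ℝ} {S : Matrix (Fin p) (Fin p) ℝ} {e : ℝ}

/-- The indicator of `Y = y` is (1 + yY)/2. Hence all class statistics are functions of the moments
in `MomentsClose`. -/
lemma sampleMean_ite (hY : ∀ i, Y i = 1 ∨ Y i = -1) {y : ℝ} (hy : y = 1 ∨ y = -1)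
    (f : Fin n → ℝ) : sampleMean (fun i => if Y i = y then f i else 0) =
      (sampleMean f + y * sampleMean fun i => Y i * f i) / 2 := by
  have h1 : (fun i => if Y i = y then f i else 0) =
      fun i => (1 / 2) * (f i + y * (Y i * f i)) := by
    ext i
    rcases hY i with h | h <;> rcases hy with rfl | rfl <;> rw [h] <;> norm_num <;> ring
  rw [h1, sampleMean_const_mul, sampleMean_add, sampleMean_const_mul]
  ring

lemma classFreq_eq (hn : n ≠ 0) (hY : ∀ i, Y i = 1 ∨ Y i = -1) {y : ℝ} (hy : y = 1 ∨ y = -1) :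
    classFreq Y y = (1 + y * sampleMean Y) / 2 := by
  rw [classFreq, sampleMean_ite hY hy, sampleMean_const hn]
  simp

lemma classMean_eq (hn : n ≠ 0) (hY : ∀ i, Y i = 1 ∨ Y i = -1) {y : ℝ} (hy : y = 1 ∨ y = -1)
    (j : Fin p) : classMean Y H y j =
      (sampleMean (fun i => H i j) + y * sampleMean fun i => Y i * H i j) /
        (1 + y * sampleMean Y) := by
  have h1 := sampleMean_ite hY hy fun i => H i j
  have h2 := classFreq_eq hn hY hy
  have hn' : (n : ℝ)⁻¹ ≠ 0 := inv_ne_zero (by exact_mod_cast hn)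
  rw [classMean, ← mul_div_mul_left _ _ hn']
  change sampleMean _ / classFreq Y y = _
  rw [h1, h2]
  rw [div_div_div_cancel_right₀ (by norm_num)]

/-- The pooled covariance matrix in terms of sample moments. -/
lemma pooledCov_eq (hn : n ≠ 0) (hn2 : (n : ℝ) - 2 ≠ 0) (hY : ∀ i, Y i = 1 ∨ Y i = -1)
    (hp : 1 + sampleMean Y ≠ 0) (hm : 1 - sampleMean Y ≠ 0) (j k : Fin p) :
    pooledCov Y H j k * ((n - 2) / n) = sampleMean (fun i => H i j * H i k) -
      (sampleMean (fun i => H i j) + sampleMean fun i => Y i * H i j) / 2 * classMean Y H 1 k -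
      (sampleMean (fun i => H i j) - sampleMean fun i => Y i * H i j) / 2 *
        classMean Y H (-1) k := by
  set a := classMean Y H 1 with ha
  set b := classMean Y H (-1) with hb
  set M := sampleMean Y with hM
  have eq1 : ∀ l, a l * (1 + M) =
      sampleMean (fun i => H i l) + sampleMean fun i => Y i * H i l := by
    intro l
    rw [ha, classMean_eq hn hY (Or.inl rfl), one_mul, one_mul, div_mul_cancel₀ _ hp]
  have eq2 : ∀ l, b l * (1 - M) =
      sampleMean (fun i => H i l) - sampleMean fun i => Y i * H i l := by
    intro l
    rw [hb, classMean_eq hn hY (Or.inr rfl), neg_one_mul, neg_one_mul, ← sub_eq_add_neg,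
      ← sub_eq_add_neg, div_mul_cancel₀ _ hm]
  have hn' : (n : ℝ) ≠ 0 := by exact_mod_cast hn
  have h1 : pooledCov Y H j k * ((n - 2) / n) =
      sampleMean fun i => (H i j - classMean Y H (Y i) j) * (H i k - classMean Y H (Y i) k) := by
    simp only [pooledCov, Matrix.of_apply, sampleMean]
    field_simp
  set u : Fin p → ℝ := fun l => (a l + b l) / 2 with hu
  set w : Fin p → ℝ := fun l => (a l - b l) / 2 with hw
  -- The class mean is affine in the label. With Y² = 1 the centred products expand into plain
  -- moments.
  have h2 : ∀ i l, classMean Y H (Y i) l = u l + Y i * w l := by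
    intro i l
    rcases hY i with h | h <;> rw [h]
    · simp only [hu, hw]; rw [← ha]; ring
    · simp only [hu, hw]; rw [← hb]; ring
  have hYY : ∀ i, Y i * Y i = 1 := fun i => by rcases hY i with h | h <;> rw [h] <;> norm_num
  have h3 : (fun i => (H i j - classMean Y H (Y i) j) * (H i k - classMean Y H (Y i) k)) =
      fun i => (H i j * H i k - (u k * H i j + w k * (Y i * H i j)))
        - (u j * H i k + w j * (Y i * H i k)) +
        ((u j * u k + w j * w k) + (u j * w k + w j * u k) * Y i) := by
    ext i
    rw [h2, h2]
    linear_combination (w j * w k) * hYY i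
  rw [h1, h3, sampleMean_add, sampleMean_sub, sampleMean_sub, sampleMean_add, sampleMean_add,
    sampleMean_add, sampleMean_const hn, sampleMean_const_mul, sampleMean_const_mul,
    sampleMean_const_mul, sampleMean_const_mul, sampleMean_const_mul, ← hM]
  have j1 := eq1 j
  have j2 := eq2 j
  have k1 := eq1 k
  have k2 := eq2 k
  simp only [hu, hw]
  linear_combination (a j / 2) * k1 + (b j / 2) * k2

variable (h : MomentsClose Y H π₁ π₂ μ S e) {π₀ D : ℝ}
include h

/-- The statistics are rational in the moments. The denominators from the class sizes are 1 ±
mean(Y), at least π₀ since e ≤ π₀/4, so errors are amplified by at most a multiple of D²/π₀. -/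
lemma statisticsClose (hπ₀ : 0 < π₀) (h1 : π₀ ≤ π₁) (h2 : π₀ ≤ π₂) (h12 : π₁ + π₂ = 1)
    (hD : 1 ≤ D) (hμ : ∀ j, |μ j| ≤ D) (hS : ∀ j k, |S j k| ≤ 1) (he : e ≤ π₀ / 4) :
    StatisticsClose Y H π₁ π₂ μ S (15 * D ^ 2 / π₀ * e) := by
  have hn : n ≠ 0 := by have := h.four_le; omega
  have hn4 : (4 : ℝ) ≤ n := by exact_mod_cast h.four_le
  have he0 : 0 < e := lt_of_lt_of_le (by positivity) h.inv_le
  have hπh : π₀ ≤ 1 / 2 := by linarith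
  set M := sampleMean Y with hM
  obtain ⟨hM1, hM2⟩ := abs_le.1 h.mean_label
  have hp : π₀ ≤ 1 + M := by linarith
  have hm : π₀ ≤ 1 - M := by linarith
  have f1 := classFreq_eq hn h.label (Or.inl rfl)
  have f2 := classFreq_eq hn h.label (Or.inr rfl)
  rw [← hM] at f1 f2
  set c := D ^ 2 / π₀ with hc
  have hD2 : D ≤ D ^ 2 := le_self_pow₀ hD two_ne_zero
  have hc1 : D ^ 2 * 2 ≤ c := by
    rw [hc, le_div_iff₀ hπ₀]
    have : D ^ 2 * (2 * π₀) ≤ D ^ 2 * 1 := by gcongr; linarith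
    linarith
  have hCe : 15 * D ^ 2 / π₀ * e = 15 * (c * e) := by rw [hc]; ring
  have hce2 : D ^ 2 * e * 2 ≤ c * e := by
    calc D ^ 2 * e * 2 = D ^ 2 * 2 * e := by ring
      _ ≤ _ := by gcongr
  have hDe : D * e ≤ D ^ 2 * e := by gcongr
  have hee : e ≤ D * e := le_mul_of_one_le_left he0.le hD
  have he1 : e ≤ 1 / 8 := by linarith
  have hesq : e * e ≤ e / 8 := by
    calc e * e ≤ e * (1 / 8) := by gcongr
      _ = _ := by ring
  -- class means
  have A1 : ∀ j, |classMean Y H 1 j| ≤ 2 * e / π₀ := by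
    intro j
    rw [classMean_eq hn h.label (Or.inl rfl), one_mul, one_mul, ← hM, abs_div,
      abs_of_pos (by linarith : 0 < 1 + M)]
    have e1 := h.mean j
    have e2 := h.mean_label_mul j
    have : |sampleMean (fun i => H i j) + sampleMean fun i => Y i * H i j| ≤ 2 * e := by
      rw [abs_le] at e1 e2 ⊢
      constructor <;> linarith [e1.1, e1.2, e2.1, e2.2]
    gcongr
  have A2 : ∀ j, |classMean Y H (-1) j - μ j| ≤ 3 * D * e / π₀ := by
    intro j
    rw [classMean_eq hn h.label (Or.inr rfl), neg_one_mul, neg_one_mul, ← sub_eq_add_neg,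
      ← sub_eq_add_neg, ← hM]
    have e1 := h.mean j
    have e2 := h.mean_label_mul j
    have hid : (sampleMean (fun i => H i j) - sampleMean fun i => Y i * H i j) / (1 - M) - μ j
        = ((sampleMean (fun i => H i j) - π₂ * μ j) -
          ((sampleMean fun i => Y i * H i j) - -(π₂ * μ j)) + μ j * (M - (π₁ - π₂))) /
          (1 - M) := by
      have : 1 - M ≠ 0 := by linarith
      field_simp
      linear_combination (μ j) * h12
    rw [hid, abs_div, abs_of_pos (by linarith : 0 < 1 - M)]
    have e3 : |μ j * (M - (π₁ - π₂))| ≤ D * e := by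
      rw [abs_mul]; gcongr; exacts [hμ j, h.mean_label]
    have e4 := abs_add_le ((sampleMean (fun i => H i j) - π₂ * μ j) -
          ((sampleMean fun i => Y i * H i j) - -(π₂ * μ j))) (μ j * (M - (π₁ - π₂)))
    have e5 := abs_sub (sampleMean (fun i => H i j) - π₂ * μ j)
          ((sampleMean fun i => Y i * H i j) - -(π₂ * μ j))
    gcongr
    linarith
  have hde : 3 * D * e / π₀ ≤ D := by
    rw [div_le_iff₀ hπ₀]
    have : D * e ≤ D * (π₀ / 4) := by gcongr
    linarith [mul_pos (by linarith : 0 < D) hπ₀]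
  have hde2 : 3 * D * e / π₀ ≤ 3 * (c * e) := by
    calc 3 * D * e / π₀ = 3 * (D / π₀ * e) := by ring
      _ ≤ 3 * (D ^ 2 / π₀ * e) := by gcongr
      _ = _ := by rw [hc]
  have hμH : ∀ j, |π₂ * μ j| ≤ D := by
    intro j
    rw [abs_mul, abs_of_pos (by linarith : 0 < π₂)]
    calc π₂ * |μ j| ≤ 1 * D := by gcongr; linarith; exact hμ j
      _ = D := one_mul D
  have hH : ∀ j, |sampleMean fun i => H i j| ≤ D + e := by
    intro j
    have e1 := h.mean j
    have := abs_sub_abs_le_abs_sub (sampleMean fun i => H i j) (π₂ * μ j)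
    linarith [hμH j]
  have hcov : ∀ j k, |sampleCovMatrix H j k - (S j k + π₁ * π₂ * (μ j * μ k))| ≤ 4 * (D * e) := by
    intro j k
    have e1 := h.mean_mul j k
    have e2 := abs_mul_sub_mul_le (h.mean j) (h.mean k) (hμH j) (hH k)
    have hid : sampleCovMatrix H j k - (S j k + π₁ * π₂ * (μ j * μ k)) =
        (sampleMean (fun i => H i j * H i k) - (S j k + π₂ * (μ j * μ k))) -
        ((sampleMean fun i => H i j) * (sampleMean fun i => H i k) -
          (π₂ * μ j) * (π₂ * μ k)) := by
      simp only [sampleCovMatrix, Matrix.of_apply, sampleCov]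
      linear_combination (- π₂ * μ j * μ k) * h12
    rw [hid]
    refine (abs_sub _ _).trans ?_
    linarith
  have hcovl : ∀ j, |sampleCov Y (fun i => H i j) - -(2 * π₁ * π₂ * μ j)| ≤ 4 * (D * e) := by
    intro j
    have e1 := h.mean_label_mul j
    have e2 := abs_mul_sub_mul_le h.mean_label (h.mean j) (A := 1)
      (by rw [abs_le]; constructor <;> linarith) (hH j)
    have hid : sampleCov Y (fun i => H i j) - -(2 * π₁ * π₂ * μ j) =
        ((sampleMean fun i => Y i * H i j) - -(π₂ * μ j)) -
        (sampleMean Y * (sampleMean fun i => H i j) - (π₁ - π₂) * (π₂ * μ j)) := by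
      simp only [sampleCov]
      linear_combination (π₂ * μ j) * h12
    rw [hid]
    refine (abs_sub _ _).trans ?_
    linarith
  have hpool : ∀ j k, |pooledCov Y H j k - S j k| ≤ 15 * (c * e) := by
    intro j k
    have hn2 : (n : ℝ) - 2 ≠ 0 := by linarith
    have hX := pooledCov_eq (H := H) hn hn2 h.label (by rw [← hM]; linarith) (by rw [← hM]; linarith) j k
    set X := pooledCov Y H j k * ((n - 2) / n) with hXdef
    have e1 := abs_le.1 (h.mean j)
    have e2 := abs_le.1 (h.mean_label_mul j)
    have p1 : |(sampleMean (fun i => H i j) + sampleMean fun i => Y i * H i j) / 2 - 0| ≤ e := by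
      rw [abs_le]; constructor <;> linarith [e1.1, e1.2, e2.1, e2.2]
    have p2 : |(sampleMean (fun i => H i j) - sampleMean fun i => Y i * H i j) / 2 - π₂ * μ j|
        ≤ e := by
      rw [abs_le]; constructor <;> linarith [e1.1, e1.2, e2.1, e2.2]
    have q1 := abs_mul_sub_mul_le (b := 0) (δ := 2 * e / π₀) p1 (by simpa using A1 k)
      (A := 0) (by simp) (A1 k)
    have hb2 : |classMean Y H (-1) k| ≤ 2 * D := by
      have := abs_sub_abs_le_abs_sub (classMean Y H (-1) k) (μ k)
      linarith [A2 k, hμ k]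
    have q2 := abs_mul_sub_mul_le p2 (A2 k) (hμH j) hb2
    have hee2 : e * (2 * e / π₀) ≤ e := by
      have : 2 * e / π₀ ≤ 1 := by rw [div_le_one hπ₀]; linarith
      calc e * (2 * e / π₀) ≤ e * 1 := by gcongr
        _ = e := mul_one e
    have hDD : D * (3 * D * e / π₀) = 3 * (c * e) := by rw [hc]; ring
    have hXS : |X - S j k| ≤ 6 * (c * e) := by
      have hid : X - S j k = (sampleMean (fun i => H i j * H i k) - (S j k + π₂ * (μ j * μ k))) -
          ((sampleMean (fun i => H i j) + sampleMean fun i => Y i * H i j) / 2 *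
            classMean Y H 1 k - 0 * 0) -
          ((sampleMean (fun i => H i j) - sampleMean fun i => Y i * H i j) / 2 *
            classMean Y H (-1) k - π₂ * μ j * μ k) := by
        rw [hX]; ring
      rw [hid]
      refine (abs_sub _ _).trans ?_
      have := abs_sub (sampleMean (fun i => H i j * H i k) - (S j k + π₂ * (μ j * μ k)))
        ((sampleMean (fun i => H i j) + sampleMean fun i => Y i * H i j) / 2 *
            classMean Y H 1 k - 0 * 0)
      linarith [h.mean_mul j k]
    have hpX : pooledCov Y H j k = X + (2 / (n - 2)) * X := by
      rw [hXdef]; field_simp; ring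
    -- The change of denominator from n to n - 2 is also an error of size e, since n ≥ 4 and 4/n ≤
    -- e.
    have hfac : 2 / ((n : ℝ) - 2) ≤ e := by
      refine le_trans ?_ h.inv_le
      rw [div_le_div_iff₀ (by linarith) (by linarith)]
      linarith
    have hfac0 : 0 ≤ 2 / ((n : ℝ) - 2) := div_nonneg (by norm_num) (by linarith)
    have hXabs : |X| ≤ 6 * (c * e) + 1 := by
      have := abs_sub_abs_le_abs_sub X (S j k)
      linarith [hS j k]
    have hid : pooledCov Y H j k - S j k = (X - S j k) + (2 / (n - 2)) * X := by rw [hpX]; ring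
    rw [hid]
    refine (abs_add_le _ _).trans ?_
    have : |2 / ((n : ℝ) - 2) * X| ≤ e * (6 * (c * e) + 1) := by
      rw [abs_mul, abs_of_nonneg hfac0]
      gcongr
    have hce0 : 0 ≤ c * e := by positivity
    have : e * (6 * (c * e) + 1) ≤ 1 / 8 * (6 * (c * e)) + e := by
      have : e * (6 * (c * e)) ≤ 1 / 8 * (6 * (c * e)) := by gcongr
      linarith
    linarith
  have hpc : 0 < c * e := by positivity
  rw [hCe]
  refine ⟨?_, ?_, fun j => ?_, fun j => ?_, hpool, fun j k => ?_, fun j => ?_⟩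
  · rw [f1, abs_le]; constructor <;> linarith
  · rw [f2, abs_le]; constructor <;> linarith
  · refine (A1 j).trans ?_
    calc 2 * e / π₀ ≤ 2 * (D ^ 2 * e) / π₀ := by gcongr; linarith
      _ = 2 * (c * e) := by rw [hc]; ring
      _ ≤ _ := by linarith
  · linarith [A2 j]
  · linarith [hcov j k]
  · linarith [hcovl j]

end MomentsClose

/-! ### Error analysis of the fitted classifier -/

/-- Cauchy–Schwarz, from the discriminant of the nonnegative quadratic polynomial t ↦ (x + ty)ᵀW(x +
ty). -/
lemma sq_dotProduct_mulVec_le {p : ℕ} {W : Matrix (Fin p) (Fin p) ℝ} (hW : W.PosSemidef)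
    (x y : Fin p → ℝ) :
    (x ⬝ᵥ (W *ᵥ y)) ^ 2 ≤ (x ⬝ᵥ (W *ᵥ x)) * (y ⬝ᵥ (W *ᵥ y)) := by
  have hT : Wᵀ = W := by
    simpa [Matrix.IsHermitian, conjTranspose_eq_transpose_of_trivial] using hW.1
  have hsymm : y ⬝ᵥ (W *ᵥ x) = x ⬝ᵥ (W *ᵥ y) := by
    rw [dotProduct_mulVec, ← mulVec_transpose, hT, dotProduct_comm]
  have h : ∀ t : ℝ, 0 ≤ (y ⬝ᵥ (W *ᵥ y)) * (t * t) + (2 * (x ⬝ᵥ (W *ᵥ y))) * t +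
      x ⬝ᵥ (W *ᵥ x) := by
    intro t
    have h1 := hW.dotProduct_mulVec_nonneg (x + t • y)
    rw [star_trivial, mulVec_add, mulVec_smul, add_dotProduct, dotProduct_add, dotProduct_add,
      smul_dotProduct, smul_dotProduct, dotProduct_smul, dotProduct_smul, hsymm] at h1
    simp only [smul_eq_mul] at h1
    linarith
  have := discrim_le_zero h
  rw [discrim] at this
  linarith

/-- A semiparametric LDA model with controlled class probabilities and `κ`, `φ`, `Δ`. -/
structure IsRegular {p : ℕ} (P : Measure (ℝ × (Fin p → ℝ))) (θ : Params p)
    (π₀ g φ D₀ : ℝ) : Prop where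
  model : IsSeLDA P θ
  prior_bound_pos : 0 < π₀
  le_priorPos : π₀ ≤ θ.priorPos
  le_priorNeg : π₀ ≤ θ.priorNeg
  gap_pos : 0 < g
  kappa_le : kappa P θ ≤ 1 - g
  phi_le : phi P θ ≤ φ
  one_le : 1 ≤ φ
  Delta_le : Delta P θ ≤ D₀
  one_le' : 1 ≤ D₀
  card_pos : 0 < (active P θ).card

lemma IsSeLDA.abs_Sigma_le {p : ℕ} {P : Measure (ℝ × (Fin p → ℝ))} {θ : Params p}
    (h : IsSeLDA P θ) (j k : Fin p) : |θ.Sigma j k| ≤ 1 := by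
  have hjk := sq_dotProduct_mulVec_le h.posSemidef (Pi.single j 1) (Pi.single k 1)
  have e : ∀ a b : Fin p, (Pi.single a 1 : Fin p → ℝ) ⬝ᵥ (θ.Sigma *ᵥ Pi.single b 1) =
      θ.Sigma a b := by
    intro a b; simp
  rw [e, e, e, h.diag_eq_one, h.diag_eq_one, mul_one] at hjk
  exact (sq_le_one_iff_abs_le_one _).1 hjk

lemma Params.two_mul_prior_mul_le_one {p : ℕ} (θ : Params p) : 2 * θ.priorPos * θ.priorNeg ≤ 1 := by
  have h3 := θ.priorPos_add_priorNeg
  nlinarith [sq_nonneg (θ.priorPos - θ.priorNeg)]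

namespace IsRegular

variable {p : ℕ} {P : Measure (ℝ × (Fin p → ℝ))} {θ : Params p} {π₀ g φ D₀ : ℝ}
  (hr : IsRegular P θ π₀ g φ D₀)

/-- The squared Mahalanobis-type norm `δᵀ Ω⁻¹ δ = δᵀ β⋆`. -/
abbrev _root_.SSDA.signal (P : Measure (ℝ × (Fin p → ℝ))) (θ : Params p) : ℝ :=
  θ.delta ⬝ᵥ betaStar P θ

include hr

lemma abs_delta_active_le (j : Fin p) (hj : j ∈ active P θ) : |θ.delta j| ≤ D₀ :=
  (le_ciSup (f := fun j : {j // j ∈ active P θ} => |θ.delta j.1|)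
    (Set.finite_range _).bddAbove ⟨j, hj⟩).trans hr.Delta_le

/-- Δ only sees the coordinates in `A`. Since Ωβ⋆ = δ and β⋆ is supported by `A`, the bound κ ≤ 1
extends it to all of them. -/
lemma abs_delta_le (j : Fin p) : |θ.delta j| ≤ D₀ := by
  have h := abs_mulVec_le_of_blocks (A := active P θ) (β := betaStar P θ) hr.model.Omega_posDef
    (hr.kappa_le.trans (by linarith [hr.gap_pos]))
    (fun j hj => betaStar_eq_zero_of_notMem hj) (D := D₀) (by linarith [hr.one_le'])
  rw [hr.model.Omega_mulVec_betaStar] at h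
  exact h hr.abs_delta_active_le j

lemma sum_active_abs_le (x : Fin p → ℝ) (u : ℝ)
    (hu : ∀ j ∈ active P θ, |(Omega P θ *ᵥ x) j| ≤ u) :
    ∑ j ∈ active P θ, |x j| ≤ (active P θ).card * φ * u + (1 - g) * ∑ j ∈ (active P θ)ᶜ, |x j| :=
  sum_abs_le_of_blocks hr.model.Omega_posDef hr.phi_le hr.kappa_le x u hu

lemma sum_abs_betaStar_le : ∑ j, |betaStar P θ j| ≤ (active P θ).card * φ * D₀ := by
  have h := hr.sum_active_abs_le (betaStar P θ) D₀ (by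
    rw [hr.model.Omega_mulVec_betaStar]; exact hr.abs_delta_active_le)
  have h0 : ∑ j ∈ (active P θ)ᶜ, |betaStar P θ j| = 0 :=
    Finset.sum_eq_zero fun j hj => by
      rw [betaStar_eq_zero_of_notMem (by simpa using hj), abs_zero]
  rw [← Finset.sum_add_sum_compl (active P θ), h0, add_zero]
  rw [h0, mul_zero, add_zero] at h
  exact h

lemma signal_eq : betaStar P θ ⬝ᵥ (Omega P θ *ᵥ betaStar P θ) = signal P θ := by
  rw [hr.model.Omega_mulVec_betaStar, dotProduct_comm]

lemma sum_sq_betaStar_le : ∑ j, betaStar P θ j ^ 2 ≤ φ * signal P θ := by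
  rw [← hr.signal_eq]
  exact sum_sq_le_of_blocks hr.model.Omega_posDef hr.phi_le (by linarith [hr.one_le])
    fun j hj => betaStar_eq_zero_of_notMem hj

lemma minSignal_pos_and_le : 0 < minSignal P θ ∧
    ∀ j ∈ active P θ, minSignal P θ ≤ |betaStar P θ j| := by
  classical
  obtain ⟨j₀, hj₀⟩ := Finset.card_pos.1 hr.card_pos
  have : Nonempty {j // j ∈ active P θ} := ⟨⟨j₀, hj₀⟩⟩
  constructor
  · obtain ⟨i, hi⟩ := exists_eq_ciInf_of_finite (f := fun j : {j // j ∈ active P θ} =>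
      |betaStar P θ j.1|)
    rw [minSignal, ← hi]
    have := i.2
    simp only [active, Finset.mem_filter] at this
    exact abs_pos.2 this.2
  · intro j hj
    exact ciInf_le (f := fun j : {j // j ∈ active P θ} => |betaStar P θ j.1|)
      (Set.finite_range _).bddBelow ⟨j, hj⟩

/-- The bridge from the minimal signal to m: a penalty λ ≤ η·min|β⋆_j| satisfies sλ² ≤ η²φm. -/
lemma card_mul_minSignal_sq_le :
    (active P θ).card * minSignal P θ ^ 2 ≤ φ * signal P θ := by
  refine le_trans ?_ hr.sum_sq_betaStar_le
  obtain ⟨h0, h1⟩ := hr.minSignal_pos_and_le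
  calc (active P θ).card * minSignal P θ ^ 2 = ∑ j ∈ active P θ, minSignal P θ ^ 2 := by simp
    _ ≤ ∑ j ∈ active P θ, betaStar P θ j ^ 2 := by
      refine Finset.sum_le_sum fun j hj => ?_
      rw [← sq_abs (betaStar P θ j)]
      have := h1 j hj
      gcongr
    _ ≤ _ := Finset.sum_le_univ_sum_of_nonneg fun j => sq_nonneg _

lemma sq_sum_abs_betaStar_le :
    (∑ j, |betaStar P θ j|) ^ 2 ≤ (active P θ).card * (φ * signal P θ) := by
  have h0 : ∑ j ∈ (active P θ)ᶜ, |betaStar P θ j| = 0 :=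
    Finset.sum_eq_zero fun j hj => by
      rw [betaStar_eq_zero_of_notMem (by simpa using hj), abs_zero]
  rw [← Finset.sum_add_sum_compl (active P θ), h0, add_zero]
  calc (∑ j ∈ active P θ, |betaStar P θ j|) ^ 2
      ≤ (active P θ).card * ∑ j ∈ active P θ, |betaStar P θ j| ^ 2 := sq_sum_le_card_mul_sum_sq
    _ ≤ (active P θ).card * ∑ j, betaStar P θ j ^ 2 := by
      gcongr
      simp only [sq_abs]
      exact Finset.sum_le_univ_sum_of_nonneg fun j => sq_nonneg _
    _ ≤ _ := by gcongr; exact hr.sum_sq_betaStar_le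

lemma betaStar_ne_zero : betaStar P θ ≠ 0 := by
  classical
  obtain ⟨j₀, hj₀⟩ := Finset.card_pos.1 hr.card_pos
  intro h
  simp [active, h] at hj₀

lemma signal_pos : 0 < signal P θ := by
  rw [← hr.signal_eq]
  simpa using hr.model.Omega_posDef.dotProduct_mulVec_pos hr.betaStar_ne_zero

lemma variance_pos : 0 < betaStar P θ ⬝ᵥ (θ.Sigma *ᵥ betaStar P θ) := by
  simpa using hr.model.posDef.dotProduct_mulVec_pos hr.betaStar_ne_zero

lemma variance_eq : betaStar P θ ⬝ᵥ (θ.Sigma *ᵥ betaStar P θ) =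
    signal P θ - θ.priorPos * θ.priorNeg * signal P θ ^ 2 := by
  have := hr.model.Omega_quadForm (betaStar P θ)
  rw [hr.signal_eq] at this
  linarith

/-- Positivity of the within-class variance m - π₊π₋m² forces m < 1/(π₊π₋). -/
lemma sqrt_signal_le : √(signal P θ) ≤ 1 / π₀ := by
  have h0 := hr.prior_bound_pos
  have hm := hr.signal_pos
  have h1 := hr.variance_pos
  rw [hr.variance_eq] at h1
  have h2 : π₀ ^ 2 ≤ θ.priorPos * θ.priorNeg := by
    rw [sq]
    exact mul_le_mul hr.le_priorPos hr.le_priorNeg h0.le (h0.le.trans hr.le_priorPos)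
  rw [Real.sqrt_le_left (by positivity), div_pow, one_pow, le_div_iff₀ (by positivity)]
  have h3 : θ.priorPos * θ.priorNeg * signal P θ < 1 := by
    by_contra hc
    have : signal P θ * 1 ≤ signal P θ * (θ.priorPos * θ.priorNeg * signal P θ) :=
      mul_le_mul_of_nonneg_left (not_lt.1 hc) hm.le
    linarith
  calc signal P θ * π₀ ^ 2 ≤ signal P θ * (θ.priorPos * θ.priorNeg) := by gcongr
    _ ≤ 1 := by linarith

lemma gap_le_one : g ≤ 1 := by
  have := rowSumNorm_nonneg (OmegaAcA P θ * (OmegaAA P θ)⁻¹)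
  have h2 := hr.kappa_le
  unfold kappa at h2
  linarith

lemma bound_le_half : π₀ ≤ 1 / 2 := by
  have := hr.le_priorPos
  have := hr.le_priorNeg
  have := θ.priorPos_add_priorNeg
  linarith

lemma le_scale : π₀ ≤ 2 * θ.priorPos * θ.priorNeg := by
  have h1 := hr.le_priorPos
  have h2 := hr.le_priorNeg
  have h3 := θ.priorPos_add_priorNeg
  have h0 := hr.prior_bound_pos
  rcases le_total θ.priorPos θ.priorNeg with h | h
  · have : θ.priorPos * 1 ≤ θ.priorPos * (2 * θ.priorNeg) :=
      mul_le_mul_of_nonneg_left (by linarith) (by linarith)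
    linarith
  · have : θ.priorNeg * 1 ≤ θ.priorNeg * (2 * θ.priorPos) :=
      mul_le_mul_of_nonneg_left (by linarith) (by linarith)
    linarith

/-- The rescaled lasso slope is close to the discriminant direction. -/
lemma slope_error_le {V : Matrix (Fin p) (Fin p) ℝ} {γ' b : Fin p → ℝ} {e lam η : ℝ}
    (he0 : 0 ≤ e) (hlam : 0 < lam) (hη0 : 0 < η)
    (hV : ∀ x, 0 ≤ x ⬝ᵥ (V *ᵥ x)) (hVW : ∀ j k, |V j k - Omega P θ j k| ≤ e)
    (hγ : ∀ j, |γ' j - (2 * θ.priorPos * θ.priorNeg) * θ.delta j| ≤ e)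
    (hvar : ∀ v, (γ' - V *ᵥ b) ⬝ᵥ v ≤ lam / 2 * (∑ j, |b j + v j| - ∑ j, |b j|))
    (hse : (active P θ).card * e ≤ η * lam) (hlamη : lam ≤ η * minSignal P θ)
    (hsη : (active P θ).card * e ≤ η) (hη : η * (24 * φ * D₀) ≤ g * π₀) :
    ((2 * θ.priorPos * θ.priorNeg)⁻¹ • b - betaStar P θ) ⬝ᵥ (Omega P θ *ᵥ
      ((2 * θ.priorPos * θ.priorNeg)⁻¹ • b - betaStar P θ)) ≤
        12 * φ ^ 2 / (g * π₀ ^ 2) * η ^ 2 * signal P θ ∧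
    (∑ j, |((2 * θ.priorPos * θ.priorNeg)⁻¹ • b) j|) ^ 2 ≤
      4 * φ * (active P θ).card * signal P θ ∧
    e * ∑ j, |((2 * θ.priorPos * θ.priorNeg)⁻¹ • b) j| ≤ 2 * φ * η ^ 2 * signal P θ ∧
    e ≤ φ * η * √(signal P θ) := by
  have hφ1 := hr.one_le
  have hD1 := hr.one_le'
  have hg := hr.gap_pos
  have hg1 := hr.gap_le_one
  have hπ₀ := hr.prior_bound_pos
  have hπh := hr.bound_le_half
  have hm := hr.signal_pos
  set m := signal P θ with hmdef
  set c := 2 * θ.priorPos * θ.priorNeg with hc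
  have hcπ : π₀ ≤ c := hr.le_scale
  have hc0 : 0 < c := hπ₀.trans_le hcπ
  have hc1 : c ≤ 1 := θ.two_mul_prior_mul_le_one
  set s : ℝ := ((active P θ).card : ℝ) with hs
  have hs1 : 1 ≤ s := by
    rw [hs]; exact_mod_cast hr.card_pos
  set β := betaStar P θ with hβ
  have hφD : φ ≤ φ * D₀ := le_mul_of_one_le_right (by linarith) hD1
  have hη1 : η ≤ 1 := by
    have : η * 24 ≤ η * (24 * φ * D₀) := by
      gcongr
      nlinarith
    have : g * π₀ ≤ 1 * (1 / 2) := by gcongr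
    linarith
  have hηφ : η * (24 * φ) ≤ g * π₀ := by
    refine le_trans ?_ hη
    rw [mul_assoc 24]
    gcongr
  have hgπ : g * π₀ ≤ g / 2 := by
    calc g * π₀ ≤ g * (1 / 2) := by gcongr
      _ = _ := by ring
  have hcβ : ∑ j, |(c • β) j| ≤ ∑ j, |β j| := by
    refine Finset.sum_le_sum fun j _ => ?_
    rw [Pi.smul_apply, smul_eq_mul, abs_mul, abs_of_pos hc0]
    exact mul_le_of_le_one_left (abs_nonneg _) hc1
  have hτ : e * (∑ j, |(c • β) j| + 1) ≤ g / 4 * (lam / 2) := by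
    have h1 := hr.sum_abs_betaStar_le
    have h2 : ∑ j, |(c • β) j| + 1 ≤ s * (2 * φ * D₀) := by
      have : 1 ≤ s * (φ * D₀) := by nlinarith
      calc _ ≤ s * φ * D₀ + s * (φ * D₀) := add_le_add (hcβ.trans h1) this
        _ = _ := by ring
    calc _ ≤ e * (s * (2 * φ * D₀)) := by gcongr
      _ = s * e * (2 * φ * D₀) := by ring
      _ ≤ η * lam * (2 * φ * D₀) := by gcongr
      _ = η * (24 * φ * D₀) * (lam / 12) := by ring
      _ ≤ g * π₀ * (lam / 12) := by gcongr
      _ ≤ g / 2 * (lam / 12) := by gcongr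
      _ ≤ _ := by nlinarith
  have hsφe : s * φ * e ≤ g / 16 := by
    calc s * φ * e = s * e * φ := by ring
      _ ≤ η * φ := by gcongr
      _ ≤ g / 16 := by linarith
  -- The lasso targets c·β⋆, the solution of the population normal equations Ωx = cδ.
  obtain ⟨L1, L2⟩ := lasso_error_le (W := Omega P θ) (V := V) (A := active P θ) (γ := c • θ.delta)
    (γ' := γ') (β := c • β) (b := b) (e := e) (φ := φ) (κ := 1 - g) (lam := lam) (s := s) (g := g)
    (fun j hj => by rw [Pi.smul_apply, hβ, betaStar_eq_zero_of_notMem hj, smul_zero])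
    (by rw [mulVec_smul, hβ, hr.model.Omega_mulVec_betaStar]) hV hVW hγ
    hr.sum_active_abs_le hvar he0 hlam (by linarith) (by linarith) (by linarith) hg le_rfl hτ hsφe
  have hmin := hr.minSignal_pos_and_le.1
  have hsmin : s * minSignal P θ ^ 2 ≤ φ * m := hr.card_mul_minSignal_sq_le
  have hslam : s * lam ^ 2 ≤ η ^ 2 * (φ * m) := by
    calc s * lam ^ 2 ≤ s * (η * minSignal P θ) ^ 2 := by gcongr
      _ = η ^ 2 * (s * minSignal P θ ^ 2) := by ring
      _ ≤ _ := by gcongr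
  have hΔ : c⁻¹ • b - β = c⁻¹ • (b - c • β) := by
    rw [smul_sub, smul_smul, inv_mul_cancel₀ hc0.ne', one_smul]
  have hcinv : c⁻¹ ≤ π₀⁻¹ := by gcongr
  have hcinv0 : 0 < c⁻¹ := by positivity
  set b' := c⁻¹ • b with hb'
  -- From se ≤ ηλ ≤ η²·min|β⋆_j|: the sampling error itself is small against the signal, which the
  -- last two claims need.
  have hse3 : e ^ 2 * s ≤ η ^ 4 * (φ * m) := by
    have h1 : s * e ≤ η * (η * minSignal P θ) := hse.trans (by gcongr)
    have h2 : (s * e) ^ 2 * s ≤ (η * (η * minSignal P θ)) ^ 2 * s := by gcongr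
    calc e ^ 2 * s ≤ s ^ 2 * (e ^ 2 * s) := le_mul_of_one_le_left (by positivity) (one_le_pow₀ hs1)
      _ = (s * e) ^ 2 * s := by ring
      _ ≤ _ := h2
      _ = η ^ 4 * (s * minSignal P θ ^ 2) := by ring
      _ ≤ _ := by gcongr
  have S2 : (∑ j, |b' j|) ^ 2 ≤ 4 * φ * s * m := by
    have h1 : ∑ j, |b' j| ≤ ∑ j, |β j| + 12 * φ / (g * π₀) * (s * lam) := by
      have h2 : ∑ j, |b' j - β j| ≤ 12 * φ / (g * π₀) * (s * lam) := by
        calc ∑ j, |b' j - β j| = ∑ j, c⁻¹ * |b j - (c • β) j| := by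
              refine Finset.sum_congr rfl fun j _ => ?_
              have := congrFun hΔ j
              simp only [Pi.sub_apply, Pi.smul_apply, smul_eq_mul] at this
              rw [this, abs_mul, abs_of_pos hcinv0]; rfl
          _ = c⁻¹ * ∑ j, |b j - (c • β) j| := by rw [Finset.mul_sum]
          _ ≤ π₀⁻¹ * (12 * s * φ * lam / g) := by gcongr
          _ = _ := by field_simp
      have h3 : ∑ j, |b' j| ≤ ∑ j, (|β j| + |b' j - β j|) := by
        refine Finset.sum_le_sum fun j _ => ?_
        have := abs_add_le (β j) (b' j - β j)
        rwa [add_sub_cancel] at this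
      rw [Finset.sum_add_distrib] at h3
      linarith
    set A0 := ∑ j, |β j| with hA0
    set X := 12 * φ / (g * π₀) * (s * lam) with hX
    have hA2 : A0 ^ 2 ≤ s * (φ * m) := hr.sq_sum_abs_betaStar_le
    have hX2 : X ^ 2 ≤ s * (φ * m) := by
      have h4 : 12 * φ / (g * π₀) * η ≤ 1 := by
        rw [div_mul_eq_mul_div, div_le_one (by positivity)]
        linarith [mul_pos hη0 (by linarith : 0 < φ)]
      calc X ^ 2 = (12 * φ / (g * π₀)) ^ 2 * s * (s * lam ^ 2) := by rw [hX]; ring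
        _ ≤ (12 * φ / (g * π₀)) ^ 2 * s * (η ^ 2 * (φ * m)) := by gcongr
        _ = (12 * φ / (g * π₀) * η) ^ 2 * (s * (φ * m)) := by ring
        _ ≤ 1 ^ 2 * (s * (φ * m)) := by gcongr
        _ = _ := by ring
    calc (∑ j, |b' j|) ^ 2 ≤ (A0 + X) ^ 2 := by
          gcongr
      _ ≤ 2 * A0 ^ 2 + 2 * X ^ 2 := by linarith [sq_nonneg (A0 - X)]
      _ ≤ _ := by linarith
  refine ⟨?_, S2, ?_, ?_⟩
  · rw [hΔ, mulVec_smul, smul_dotProduct, dotProduct_smul, smul_eq_mul, smul_eq_mul]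
    calc _ = c⁻¹ ^ 2 * ((b - c • β) ⬝ᵥ (Omega P θ *ᵥ (b - c • β))) := by ring
      _ ≤ c⁻¹ ^ 2 * (12 * s * φ * lam ^ 2 / g) := by gcongr
      _ ≤ π₀⁻¹ ^ 2 * (12 * s * φ * lam ^ 2 / g) := by
        have : 0 ≤ 12 * s * φ * lam ^ 2 / g := by positivity
        gcongr
      _ = π₀⁻¹ ^ 2 * (12 * φ / g) * (s * lam ^ 2) := by ring
      _ ≤ π₀⁻¹ ^ 2 * (12 * φ / g) * (η ^ 2 * (φ * m)) := by gcongr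
      _ = _ := by field_simp
  · refine abs_le_of_sq_le_sq' ?_ (by positivity) |>.2
    calc (e * ∑ j, |b' j|) ^ 2 = e ^ 2 * (∑ j, |b' j|) ^ 2 := by ring
      _ ≤ e ^ 2 * (4 * φ * s * m) := by gcongr
      _ = (e ^ 2 * s) * (4 * φ * m) := by ring
      _ ≤ (η ^ 4 * (φ * m)) * (4 * φ * m) := by gcongr
      _ = _ := by ring
  · refine abs_le_of_sq_le_sq' ?_ (by positivity) |>.2
    calc e ^ 2 ≤ e ^ 2 * s := le_mul_of_one_le_right (by positivity) hs1
      _ ≤ η ^ 4 * (φ * m) := hse3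
      _ ≤ η ^ 2 * (φ ^ 2 * m) := by
        have h1 : η ^ 4 ≤ η ^ 2 := pow_le_pow_of_le_one hη0.le hη1 (by norm_num)
        have h2 : φ ≤ φ ^ 2 := le_self_pow₀ hφ1 two_ne_zero
        gcongr
      _ = (φ * η * √m) ^ 2 := by rw [mul_pow, mul_pow, Real.sq_sqrt hm.le]; ring

end IsRegular

/-! ### Invariance of the lasso and of the classifier under changes of sign -/

section SignChange

variable {n p : ℕ} (D : Fin n → ℝ × (Fin p → ℝ)) (σ : Fin p → ℝ)

/-- The pseudo data, with the signs of the coordinates changed by `σ`. -/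
def signedData (i : Fin n) (j : Fin p) : ℝ := σ j * transformHat D (D i).2 j

/-- The labels of a sample. -/
def labels (i : Fin n) : ℝ := (D i).1

variable {σ}

lemma mul_dotProduct_mul (hσ : ∀ j, σ j * σ j = 1) (u v : Fin p → ℝ) :
    (σ * u) ⬝ᵥ (σ * v) = u ⬝ᵥ v := by
  simp only [dotProduct, Pi.mul_apply]
  refine Finset.sum_congr rfl fun j _ => ?_
  linear_combination (u j * v j) * hσ j

lemma abs_mul_of_sign (hσ : ∀ j, σ j * σ j = 1) (j : Fin p) (x : ℝ) : |σ j * x| = |x| := by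
  rw [abs_mul, show |σ j| = 1 from ?_, one_mul]
  have : |σ j| * |σ j| = 1 := by rw [← abs_mul, hσ, abs_one]
  nlinarith [abs_nonneg (σ j)]

/-- A change of signs preserves both inner products and the ℓ¹ norm. So one may pretend that every
estimated transformation targets `h_j` itself, also where `h_j` is decreasing. -/
lemma lassoObjective_eq (hσ : ∀ j, σ j * σ j = 1) (lam b₀ : ℝ) (b : Fin p → ℝ) :
    lassoObjective D lam b₀ b = (n : ℝ)⁻¹ * ∑ i, (labels D i - b₀ - signedData D σ i ⬝ᵥ (σ * b)) ^ 2 +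
      ∑ j, lam * |(σ * b) j| := by
  unfold lassoObjective
  congr 1
  · congr 1
    refine Finset.sum_congr rfl fun i _ => ?_
    have : signedData D σ i = σ * transformHat D (D i).2 := rfl
    rw [this, mul_dotProduct_mul hσ]
    rfl
  · refine Finset.sum_congr rfl fun j _ => ?_
    rw [Pi.mul_apply, abs_mul_of_sign hσ]

lemma IsLassoSlope.variational (hσ : ∀ j, σ j * σ j = 1) (hn : n ≠ 0) {lam : ℝ} (hlam : 0 ≤ lam)
    {b : Fin p → ℝ} (hb : IsLassoSlope D lam b) (v : Fin p → ℝ) :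
    ((fun j => sampleCov (labels D) (fun i => signedData D σ i j)) -
      sampleCovMatrix (signedData D σ) *ᵥ (σ * b)) ⬝ᵥ v ≤
      lam / 2 * (∑ j, |(σ * b) j + v j| - ∑ j, |(σ * b) j|) := by
  obtain ⟨b₀, hmin⟩ := hb
  refine lasso_variational hn (labels D) (signedData D σ) (b₀ := b₀) hlam (fun c₀ c => ?_) v
  have h := hmin c₀ (σ * c)
  rw [lassoObjective_eq D hσ, lassoObjective_eq D hσ] at h
  have hc : σ * (σ * c) = c := by
    ext j; simp only [Pi.mul_apply]; linear_combination c j * hσ j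
  rwa [hc] at h

lemma classMean_signedData (y : ℝ) :
    classMean (labels D) (signedData D σ) y = σ * muHat D y := by
  ext j
  simp only [classMean, muHat, classSize_eq, Pi.mul_apply, classIdx, Finset.sum_filter]
  rw [mul_div_assoc', Finset.mul_sum]
  have hnum : ∀ i, (if labels D i = y then signedData D σ i j else 0) =
      σ j * if (D i).1 = y then transformHat D (D i).2 j else 0 := by
    intro i
    by_cases h : (D i).1 = y
    · rw [if_pos (show labels D i = y from h), if_pos h]; rfl
    · rw [if_neg (show ¬ labels D i = y from h), if_neg h, mul_zero]
  simp only [hnum]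
  rfl

lemma pooledCov_quadForm (hσ : ∀ j, σ j * σ j = 1) (b : Fin p → ℝ) :
    (σ * b) ⬝ᵥ (pooledCov (labels D) (signedData D σ) *ᵥ (σ * b)) = b ⬝ᵥ (SigmaHat D *ᵥ b) := by
  have h : pooledCov (labels D) (signedData D σ) *ᵥ (σ * b) = σ * (SigmaHat D *ᵥ b) := by
    ext j
    simp only [mulVec, dotProduct, Pi.mul_apply, Finset.mul_sum]
    refine Finset.sum_congr rfl fun k _ => ?_
    have : pooledCov (labels D) (signedData D σ) j k = σ j * σ k * SigmaHat D j k := by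
      simp only [pooledCov, SigmaHat, Matrix.of_apply, classMean_signedData, Pi.mul_apply,
        signedData, labels]
      rw [mul_div_assoc', Finset.mul_sum]
      congr 1
      refine Finset.sum_congr rfl fun i _ => by ring
    rw [this]
    linear_combination (σ j * SigmaHat D j k * b k) * hσ k
  rw [h, mul_dotProduct_mul hσ]

lemma classFreq_labels (y : ℝ) : classFreq (labels D) y = classProp D y := by
  rw [classFreq, classProp, classSize_eq, sampleMean, div_eq_inv_mul]
  rfl

/-- The intercept of the discriminant rule with slope `b`, in terms of pseudo data. -/
def fittedIntercept (Y : Fin n → ℝ) (H : Fin n → Fin p → ℝ) (b : Fin p → ℝ) : ℝ :=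
  -((classMean Y H 1 + classMean Y H (-1)) ⬝ᵥ b) / 2 +
    Real.log (classFreq Y 1 / classFreq Y (-1)) * (b ⬝ᵥ (pooledCov Y H *ᵥ b)) /
      ((classMean Y H 1 - classMean Y H (-1)) ⬝ᵥ b)

/-- Homogeneity of degree one, which allows the lasso slope to be divided by 2π₊π₋. -/
lemma fittedIntercept_smul (Y : Fin n → ℝ) (H : Fin n → Fin p → ℝ) (b : Fin p → ℝ) {c : ℝ}
    (hc : c ≠ 0) : fittedIntercept Y H (c • b) = c * fittedIntercept Y H b := by
  unfold fittedIntercept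
  rw [mulVec_smul, dotProduct_smul, dotProduct_smul, dotProduct_smul, smul_dotProduct]
  simp only [smul_eq_mul]
  rw [mul_left_comm, mul_div_mul_left _ _ hc]
  ring

lemma betaHatZero_eq (hσ : ∀ j, σ j * σ j = 1) (b : Fin p → ℝ) :
    betaHatZero D b = fittedIntercept (labels D) (signedData D σ) (σ * b) := by
  rw [betaHatZero, fittedIntercept, pooledCov_quadForm D hσ, classMean_signedData,
    classMean_signedData, classFreq_labels, classFreq_labels, ← mul_add, ← mul_sub,
    mul_dotProduct_mul hσ, mul_dotProduct_mul hσ]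

lemma ssdaError_eq (hσ : ∀ j, σ j * σ j = 1) (P : Measure (ℝ × (Fin p → ℝ))) (b : Fin p → ℝ)
    {c : ℝ} (hc : 0 < c) :
    ssdaError D P b = P.real {z | z.1 ≠ Real.sign ((σ * transformHat D z.2) ⬝ᵥ (c⁻¹ • (σ * b)) +
      fittedIntercept (labels D) (signedData D σ) (c⁻¹ • (σ * b)))} := by
  have h : ∀ z : ℝ × (Fin p → ℝ), Real.sign (transformHat D z.2 ⬝ᵥ b + betaHatZero D b) =
      Real.sign ((σ * transformHat D z.2) ⬝ᵥ (c⁻¹ • (σ * b)) +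
      fittedIntercept (labels D) (signedData D σ) (c⁻¹ • (σ * b))) := by
    intro z
    rw [fittedIntercept_smul _ _ _ (inv_ne_zero hc.ne'), dotProduct_smul, mul_dotProduct_mul hσ,
      smul_eq_mul, ← mul_add, sign_mul_of_pos (inv_pos.2 hc), betaHatZero_eq D hσ]
  unfold ssdaError
  simp only [h]

end SignChange

/-! ### Comparison of the fitted discriminant with the Bayes discriminant -/

namespace IsRegular

variable {p : ℕ} {P : Measure (ℝ × (Fin p → ℝ))} {θ : Params p} {π₀ g φ D₀ : ℝ}
  (hr : IsRegular P θ π₀ g φ D₀)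
include hr

lemma abs_muNeg_le (j : Fin p) : |θ.muNeg j| ≤ D₀ := by
  have := hr.abs_delta_le j
  rwa [hr.model.delta_eq, Pi.neg_apply, abs_neg] at this

lemma muNeg_dot (x : Fin p → ℝ) : θ.muNeg ⬝ᵥ x = -(θ.delta ⬝ᵥ x) := by
  rw [hr.model.delta_eq, neg_dotProduct, neg_neg]

lemma sq_delta_dot_le (x : Fin p → ℝ) :
    (θ.delta ⬝ᵥ x) ^ 2 ≤ signal P θ * (x ⬝ᵥ (Omega P θ *ᵥ x)) := by
  have h := sq_dotProduct_mulVec_le hr.model.Omega_posDef.posSemidef x (betaStar P θ)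
  rw [hr.model.Omega_mulVec_betaStar, dotProduct_comm, dotProduct_comm (betaStar P θ)] at h
  linarith

lemma Sigma_quadForm_le (x : Fin p → ℝ) :
    x ⬝ᵥ (θ.Sigma *ᵥ x) ≤ x ⬝ᵥ (Omega P θ *ᵥ x) := by
  rw [hr.model.Omega_quadForm]
  have h1 := hr.model.prior_pos
  have h2 := hr.model.priorNeg_pos
  linarith [mul_nonneg (mul_nonneg h1.le h2.le) (sq_nonneg (θ.delta ⬝ᵥ x))]

/-- The probability that the discriminant of the Bayes rule is small, in terms of normal laws. -/
lemma measureReal_discriminant_le {ε τ : ℝ}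
    (hτ : ∀ ς : ℝ, |ς| = 1 → (gaussianReal (ς * signal P θ / 2 +
      Real.log (θ.priorPos / θ.priorNeg) * (betaStar P θ ⬝ᵥ (θ.Sigma *ᵥ betaStar P θ)) / signal P θ)
      (betaStar P θ ⬝ᵥ (θ.Sigma *ᵥ betaStar P θ)).toNNReal).real {u | |u| ≤ τ} ≤ ε) :
    P.real {z | |θ.transform z.2 ⬝ᵥ betaStar P θ + betaStarZero P θ| ≤ τ} ≤ ε := by
  have hmeas : MeasurableSet {u : ℝ | |u| ≤ τ} := measurableSet_le (by fun_prop) (by fun_prop)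
  have h1 := gaussianReal_add_const (hasLaw_dot hr.model.law_pos hr.model.posSemidef (betaStar P θ))
    (betaStarZero P θ)
  have h2 := gaussianReal_add_const (hasLaw_dot hr.model.law_neg hr.model.posSemidef (betaStar P θ))
    (betaStarZero P θ)
  have e1 := h1.measureReal_eq hmeas
  have e2 := h2.measureReal_eq hmeas
  have m1 : θ.muPos ⬝ᵥ betaStar P θ + betaStarZero P θ = 1 * signal P θ / 2 +
      Real.log (θ.priorPos / θ.priorNeg) * (betaStar P θ ⬝ᵥ (θ.Sigma *ᵥ betaStar P θ)) /
        signal P θ := by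
    rw [betaStarZero, hr.model.muPos_eq_zero, zero_add, hr.muNeg_dot, zero_dotProduct]
    ring
  have m2 : θ.muNeg ⬝ᵥ betaStar P θ + betaStarZero P θ = (-1) * signal P θ / 2 +
      Real.log (θ.priorPos / θ.priorNeg) * (betaStar P θ ⬝ᵥ (θ.Sigma *ᵥ betaStar P θ)) /
        signal P θ := by
    rw [betaStarZero, hr.model.muPos_eq_zero, zero_add, hr.muNeg_dot]
    ring
  rw [m1] at e1
  rw [m2] at e2
  have f1 := hτ 1 (by simp)
  have f2 := hτ (-1) (by simp)
  rw [hr.model.measureReal_eq]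
  rw [← e1] at f1
  rw [← e2] at f2
  have hp := hr.model.prior_pos
  have hn := hr.model.priorNeg_pos
  calc _ ≤ θ.priorPos * ε + θ.priorNeg * ε := by gcongr
    _ = (θ.priorPos + θ.priorNeg) * ε := by ring
    _ = ε := by rw [θ.priorPos_add_priorNeg, one_mul]

/-- Every ingredient of the intercept has an error of relative order x = Kη. Slope errors are tested
against δ or Σβ⋆ by Cauchy–Schwarz, where h1 gives order m. Errors of the class means cost e‖b‖₁,
and those of the pooled covariance e‖b‖₁²; h2, h3 and se ≤ η bring both to order m. -/
lemma abs_fittedIntercept_sub_le {n : ℕ} {Y : Fin n → ℝ} {H : Fin n → Fin p → ℝ} {b : Fin p → ℝ}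
    {e η K : ℝ} (hsc : StatisticsClose Y H θ.priorPos θ.priorNeg θ.muNeg θ.Sigma e)
    (hK : 12 * φ ^ 2 / (g * π₀ ^ 2) ≤ K) (hη0 : 0 < η) (hKη : K * η ≤ 1 / 6)
    (hse : (active P θ).card * e ≤ η) (he : e ≤ π₀ / 2)
    (h1 : (b - betaStar P θ) ⬝ᵥ (Omega P θ *ᵥ (b - betaStar P θ)) ≤ K * η ^ 2 * signal P θ)
    (h2 : (∑ j, |b j|) ^ 2 ≤ 4 * φ * (active P θ).card * signal P θ)
    (h3 : e * ∑ j, |b j| ≤ 2 * φ * η ^ 2 * signal P θ)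
    (h4 : e ≤ φ * η * √(signal P θ)) :
    |fittedIntercept Y H b - betaStarZero P θ| ≤
      16 * K * (K * η) * (√(signal P θ) + |Real.log (θ.priorPos / θ.priorNeg)|) := by
  have hφ1 := hr.one_le
  have hg := hr.gap_pos
  have hg1 := hr.gap_le_one
  have hπ₀ := hr.prior_bound_pos
  have hπh := hr.bound_le_half
  have hm := hr.signal_pos
  set m := signal P θ with hmdef
  set β := betaStar P θ with hβ
  have hφφ : φ ≤ φ ^ 2 := le_self_pow₀ hφ1 two_ne_zero
  have hKφ : 12 * φ / π₀ ≤ K := by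
    refine le_trans ?_ hK
    rw [div_le_div_iff₀ hπ₀ (by positivity)]
    calc 12 * φ * (g * π₀ ^ 2) = 12 * φ * (g * π₀) * π₀ := by ring
      _ ≤ 12 * φ ^ 2 * (1 * 1) * π₀ := by gcongr; linarith
      _ = _ := by ring
  have hφK : 12 * φ ≤ K := by
    refine le_trans ?_ hKφ
    rw [le_div_iff₀ hπ₀]
    calc 12 * φ * π₀ ≤ 12 * φ * 1 := by gcongr; linarith
      _ = _ := by ring
  have hπK : 1 / π₀ ≤ K := by
    refine le_trans ?_ hKφ
    gcongr
    linarith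
  have hK1 : 1 ≤ K := by linarith
  have hη1 : η ≤ 1 := by
    have : 1 * η ≤ K * η := by gcongr
    linarith
  set x := K * η with hx
  have hx0 : 0 < x := by positivity
  have he0 : 0 ≤ e := (abs_nonneg _).trans hsc.freq_pos
  have hdel : |θ.delta ⬝ᵥ (b - β)| ≤ x * m := by
    refine abs_le_of_sq_le_sq ?_ (by positivity)
    calc (θ.delta ⬝ᵥ (b - β)) ^ 2 ≤ m * (K * η ^ 2 * m) :=
          (hr.sq_delta_dot_le _).trans (by gcongr)
      _ = K * (η ^ 2 * m ^ 2) := by ring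
      _ ≤ K ^ 2 * (η ^ 2 * m ^ 2) := by
        have : K ≤ K ^ 2 := le_self_pow₀ hK1 two_ne_zero
        gcongr
      _ = (x * m) ^ 2 := by rw [hx]; ring
  have heb : e * ∑ j, |b j| ≤ x * m / 6 := by
    refine h3.trans ?_
    have h5 : η ^ 2 ≤ η := by rw [sq]; exact mul_le_of_le_one_left hη0.le hη1
    calc 2 * φ * η ^ 2 * m ≤ 2 * φ * η * m := by gcongr
      _ = 12 * φ * η * m / 6 := by ring
      _ ≤ K * η * m / 6 := by gcongr
  have hc1 : |classMean Y H 1 ⬝ᵥ b| ≤ x * m / 6 :=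
    (abs_dotProduct_le_of_abs_le hsc.mean_pos).trans heb
  have hc2 : |(classMean Y H (-1) - θ.muNeg) ⬝ᵥ b| ≤ x * m / 6 :=
    (abs_dotProduct_le_of_abs_le fun j => hsc.mean_neg j).trans heb
  have hδb : θ.delta ⬝ᵥ b = m + θ.delta ⬝ᵥ (b - β) := by
    rw [dotProduct_sub, hmdef, signal]; ring
  have hc2' : classMean Y H (-1) ⬝ᵥ b = (classMean Y H (-1) - θ.muNeg) ⬝ᵥ b -
      m - θ.delta ⬝ᵥ (b - β) := by
    rw [sub_dotProduct, hr.muNeg_dot, hδb]; ring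
  have hm' : |(classMean Y H 1 - classMean Y H (-1)) ⬝ᵥ b - m| ≤ 3 * x * m := by
    rw [sub_dotProduct, hc2', abs_le]
    rw [abs_le] at hc1 hc2 hdel
    have : 0 < x * m := by positivity
    constructor <;> linarith [hc1.1, hc1.2, hc2.1, hc2.2, hdel.1, hdel.2]
  have hl : |(classMean Y H 1 + classMean Y H (-1)) ⬝ᵥ b - (θ.muPos + θ.muNeg) ⬝ᵥ β| ≤
      3 * x * m := by
    rw [hr.model.muPos_eq_zero, zero_add, hr.muNeg_dot, add_dotProduct, hc2', abs_le]
    rw [abs_le] at hc1 hc2 hdel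
    have : 0 < x * m := by positivity
    have e : θ.delta ⬝ᵥ β = m := rfl
    rw [e]
    constructor <;> linarith [hc1.1, hc1.2, hc2.1, hc2.2, hdel.1, hdel.2]
  have hq0 := hr.variance_pos
  have hqm : β ⬝ᵥ (θ.Sigma *ᵥ β) ≤ m := by
    have := hr.Sigma_quadForm_le β
    rwa [hr.signal_eq] at this
  have hq' : |b ⬝ᵥ (pooledCov Y H *ᵥ b) - β ⬝ᵥ (θ.Sigma *ᵥ β)| ≤ 4 * x * m := by
    have g1 := abs_quadForm_sub_le hsc.pooled b
    have g2 : e * (∑ k, |b k|) ^ 2 ≤ x * m := by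
      calc e * (∑ k, |b k|) ^ 2 ≤ e * (4 * φ * (active P θ).card * m) := by gcongr
        _ = ((active P θ).card * e) * (4 * φ * m) := by ring
        _ ≤ η * (4 * φ * m) := by gcongr
        _ ≤ η * (K * m) := by gcongr; linarith
        _ = x * m := by rw [hx]; ring
    set Δ := b - β with hΔ
    have hb : b = β + Δ := by rw [hΔ]; abel
    have hT : θ.Sigmaᵀ = θ.Sigma := by
      simpa [Matrix.IsHermitian, conjTranspose_eq_transpose_of_trivial] using hr.model.posDef.1
    have g3 : b ⬝ᵥ (θ.Sigma *ᵥ b) - β ⬝ᵥ (θ.Sigma *ᵥ β) =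
        2 * (β ⬝ᵥ (θ.Sigma *ᵥ Δ)) + Δ ⬝ᵥ (θ.Sigma *ᵥ Δ) := by
      have hs : Δ ⬝ᵥ (θ.Sigma *ᵥ β) = β ⬝ᵥ (θ.Sigma *ᵥ Δ) := by
        rw [dotProduct_mulVec, ← mulVec_transpose, hT, dotProduct_comm]
      rw [hb, mulVec_add, add_dotProduct, dotProduct_add, dotProduct_add, hs]
      ring
    have g4 : Δ ⬝ᵥ (θ.Sigma *ᵥ Δ) ≤ K * η ^ 2 * m := (hr.Sigma_quadForm_le Δ).trans h1
    have g4' : 0 ≤ Δ ⬝ᵥ (θ.Sigma *ᵥ Δ) := by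
      simpa using hr.model.posSemidef.dotProduct_mulVec_nonneg Δ
    have g5 : |β ⬝ᵥ (θ.Sigma *ᵥ Δ)| ≤ x * m := by
      refine abs_le_of_sq_le_sq ?_ (by positivity)
      calc (β ⬝ᵥ (θ.Sigma *ᵥ Δ)) ^ 2 ≤ (β ⬝ᵥ (θ.Sigma *ᵥ β)) * (Δ ⬝ᵥ (θ.Sigma *ᵥ Δ)) :=
            sq_dotProduct_mulVec_le hr.model.posSemidef _ _
        _ ≤ m * (K * η ^ 2 * m) := by gcongr
        _ = K * (η ^ 2 * m ^ 2) := by ring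
        _ ≤ K ^ 2 * (η ^ 2 * m ^ 2) := by
          have : K ≤ K ^ 2 := le_self_pow₀ hK1 two_ne_zero
          gcongr
        _ = (x * m) ^ 2 := by rw [hx]; ring
    have g6 : K * η ^ 2 * m ≤ x * m := by
      have h5 : η ^ 2 ≤ η := by rw [sq]; exact mul_le_of_le_one_left hη0.le hη1
      rw [hx]
      gcongr
    rw [abs_le] at g1 g5 ⊢
    constructor <;> linarith [g1.1, g1.2, g5.1, g5.2]
  -- The log odds need an error small against √m and not just an absolute one; h4 supplies it.
  have hlog : |Real.log (classFreq Y 1 / classFreq Y (-1)) -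
      Real.log (θ.priorPos / θ.priorNeg)| ≤ x * √m := by
    have key : ∀ u v : ℝ, π₀ ≤ v → |u - v| ≤ e → 0 < u ∧ |Real.log u - Real.log v| ≤ 2 * e / π₀ := by
      intro u v hv huv
      obtain ⟨a1, a2⟩ := abs_le.1 huv
      have hu : π₀ / 2 ≤ u := by linarith
      have hu0 : 0 < u := by linarith
      have hv0 : 0 < v := by linarith
      have b1 : Real.log u - Real.log v ≤ 2 * e / π₀ := by
        rw [← Real.log_div hu0.ne' hv0.ne']
        refine (Real.log_le_sub_one_of_pos (by positivity)).trans ?_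
        calc u / v - 1 = (u - v) / v := by field_simp
          _ ≤ e / π₀ := by gcongr
          _ ≤ 2 * e / π₀ := by gcongr; linarith
      have b2 : Real.log v - Real.log u ≤ 2 * e / π₀ := by
        rw [← Real.log_div hv0.ne' hu0.ne']
        refine (Real.log_le_sub_one_of_pos (by positivity)).trans ?_
        calc v / u - 1 = (v - u) / u := by field_simp
          _ ≤ e / (π₀ / 2) := by gcongr; linarith
          _ = 2 * e / π₀ := by field_simp
      exact ⟨hu0, abs_le.2 ⟨by linarith, b1⟩⟩
    obtain ⟨u1, k1⟩ := key _ _ hr.le_priorPos hsc.freq_pos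
    obtain ⟨u2, k2⟩ := key _ _ hr.le_priorNeg hsc.freq_neg
    rw [Real.log_div u1.ne' u2.ne', Real.log_div hr.model.prior_pos.ne' hr.model.priorNeg_pos.ne']
    have h5 : 4 * e / π₀ ≤ x * √m := by
      calc 4 * e / π₀ ≤ 4 * (φ * η * √m) / π₀ := by gcongr
        _ = 12 * φ / π₀ * (η * √m) / 3 := by ring
        _ ≤ K * (η * √m) / 3 := by gcongr
        _ ≤ K * (η * √m) := by
          have : 0 ≤ K * (η * √m) := by positivity
          linarith
        _ = _ := by rw [hx]; ring
    have h6 : 4 * e / π₀ = 2 * e / π₀ + 2 * e / π₀ := by ring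
    rw [abs_le] at k1 k2 ⊢
    constructor <;> linarith [k1.1, k1.2, k2.1, k2.2]
  have hmR : m ≤ K * √m := by
    calc m = √m * √m := (Real.mul_self_sqrt hm.le).symm
      _ ≤ K * √m := by
        gcongr
        exact hr.sqrt_signal_le.trans hπK
  exact abs_intercept_sub_le hm (Real.sqrt_nonneg m) hmR hq0.le hqm hm' hq' hl hlog hx0.le hKη hK1

lemma integral_sq_dot (x : Fin p → ℝ) :
    Integrable (fun z => (θ.transform z.2 ⬝ᵥ x) ^ 2) P ∧
    ∫ z, (θ.transform z.2 ⬝ᵥ x) ^ 2 ∂P =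
      x ⬝ᵥ (θ.Sigma *ᵥ x) + θ.priorNeg * (θ.delta ⬝ᵥ x) ^ 2 := by
  have h1 : (fun z : ℝ × (Fin p → ℝ) => (θ.transform z.2 ⬝ᵥ x) ^ 2) = fun z => ∑ j, ∑ k,
      x j * x k * (θ.transform z.2 j * θ.transform z.2 k) := by
    ext z
    rw [sq, dotProduct, Finset.sum_mul_sum]
    exact Finset.sum_congr rfl fun j _ => Finset.sum_congr rfl fun k _ => by ring
  have hi : ∀ j k, Integrable (fun z : ℝ × (Fin p → ℝ) =>
      x j * x k * (θ.transform z.2 j * θ.transform z.2 k)) P :=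
    fun j k => (hr.model.integrable_coord_mul j k).const_mul _
  rw [h1]
  refine ⟨integrable_finsetSum _ fun j _ => integrable_finsetSum _ fun k _ => hi j k, ?_⟩
  rw [integral_finsetSum _ fun j _ => integrable_finsetSum _ fun k _ => hi j k]
  simp_rw [integral_finsetSum _ fun k _ => hi _ k, integral_const_mul, hr.model.integral_coord_mul]
  have h2 : (θ.delta ⬝ᵥ x) ^ 2 = ∑ j, ∑ k, x j * x k * (θ.muNeg j * θ.muNeg k) := by
    have : (θ.delta ⬝ᵥ x) ^ 2 = (θ.muNeg ⬝ᵥ x) ^ 2 := by rw [hr.muNeg_dot]; ring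
    rw [this, sq, dotProduct, Finset.sum_mul_sum]
    exact Finset.sum_congr rfl fun j _ => Finset.sum_congr rfl fun k _ => by ring
  have h3 : x ⬝ᵥ (θ.Sigma *ᵥ x) = ∑ j, ∑ k, x j * x k * θ.Sigma j k := by
    simp only [dotProduct, mulVec, Finset.mul_sum]
    exact Finset.sum_congr rfl fun j _ => Finset.sum_congr rfl fun k _ => by ring
  rw [h2, h3, Finset.mul_sum, ← Finset.sum_add_distrib]
  refine Finset.sum_congr rfl fun j _ => ?_
  rw [Finset.mul_sum, ← Finset.sum_add_distrib]
  exact Finset.sum_congr rfl fun k _ => by ring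

/-- The difference of the slope parts of the two discriminants is small with high probability. -/
lemma measureReal_slope_diff_le {G : ℝ × (Fin p → ℝ) → Fin p → ℝ} {d : Fin p → ℝ × (Fin p → ℝ) → ℝ}
    {b : Fin p → ℝ} {e η K t : ℝ} (hK : 12 * φ ^ 2 / (g * π₀ ^ 2) ≤ K) (hη0 : 0 < η)
    (hη1 : η ≤ 1)
    (hdi : ∀ j, Integrable (d j) P) (hde : ∀ j, ∫ z, d j z ∂P ≤ e)
    (hd : ∀ᵐ z ∂P, ∀ j, (G z j - θ.transform z.2 j) ^ 2 ≤ d j z)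
    (hse : (active P θ).card * e ≤ η)
    (h1 : (b - betaStar P θ) ⬝ᵥ (Omega P θ *ᵥ (b - betaStar P θ)) ≤ K * η ^ 2 * signal P θ)
    (h2 : (∑ j, |b j|) ^ 2 ≤ 4 * φ * (active P θ).card * signal P θ) (ht : 0 < t) :
    P.real {z | t * √(signal P θ) ≤ |G z ⬝ᵥ b - θ.transform z.2 ⬝ᵥ betaStar P θ|} ≤
      6 * K ^ 3 * η / t ^ 2 := by
  have hφ1 := hr.one_le
  have hg := hr.gap_pos
  have hg1 := hr.gap_le_one
  have hπ₀ := hr.prior_bound_pos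
  have hπh := hr.bound_le_half
  have hm := hr.signal_pos
  set m := signal P θ with hmdef
  set β := betaStar P θ with hβ
  have hφφ : φ ≤ φ ^ 2 := le_self_pow₀ hφ1 two_ne_zero
  have hgπ1 : g * π₀ ^ 2 ≤ 1 := by
    have : π₀ ^ 2 ≤ 1 := pow_le_one₀ hπ₀.le (by linarith)
    calc g * π₀ ^ 2 ≤ 1 * 1 := by gcongr
      _ = 1 := one_mul 1
  have hKφ : 12 * φ ^ 2 ≤ K := by
    refine le_trans ?_ hK
    rw [le_div_iff₀ (by positivity)]
    exact mul_le_of_le_one_right (by positivity) hgπ1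
  have hK1 : 1 ≤ K := by nlinarith
  have hmK : m ≤ K := by
    have h5 := hr.sqrt_signal_le
    have h6 : m ≤ (1 / π₀) ^ 2 := by
      calc m = √m ^ 2 := (Real.sq_sqrt hm.le).symm
        _ ≤ _ := by gcongr
    refine h6.trans (le_trans ?_ hK)
    rw [div_pow, one_pow, div_le_div_iff₀ (by positivity) (by positivity), one_mul]
    calc g * π₀ ^ 2 ≤ 1 * π₀ ^ 2 := by gcongr
      _ ≤ 12 * φ ^ 2 * π₀ ^ 2 := by gcongr; nlinarith
  have hη2 : η ^ 2 ≤ η := by rw [sq]; exact mul_le_of_le_one_left hη0.le hη1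
  set Δ := b - β with hΔ
  set N := ∑ j, |b j| with hN
  have hN0 : 0 ≤ N := Finset.sum_nonneg fun _ _ => abs_nonneg _
  -- A majorant of the squared difference. Cauchy–Schwarz with weights |b_j| reduces the part due to
  -- the estimated transformations to the coordinatewise bounds `d j`; its integral is at most of
  -- order e‖b‖₁², hence of order ηm. Markov's inequality at level t²m concludes.
  set W : ℝ × (Fin p → ℝ) → ℝ := fun z =>
    2 * N * ∑ j, |b j| * d j z + 2 * (θ.transform z.2 ⬝ᵥ Δ) ^ 2 with hW
  obtain ⟨i1, i2⟩ := hr.integral_sq_dot Δ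
  have i3 : Integrable (fun z => ∑ j, |b j| * d j z) P :=
    integrable_finsetSum _ fun j _ => (hdi j).const_mul _
  have hWi : Integrable W P := (i3.const_mul _).add (i1.const_mul _)
  have hWint : ∫ z, W z ∂P ≤ 6 * K ^ 3 * η * m := by
    have e1 : ∫ z, W z ∂P = 2 * N * ∑ j, |b j| * ∫ z, d j z ∂P +
        2 * (Δ ⬝ᵥ (θ.Sigma *ᵥ Δ) + θ.priorNeg * (θ.delta ⬝ᵥ Δ) ^ 2) := by
      rw [hW, integral_add (i3.const_mul _) (i1.const_mul _), integral_const_mul,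
        integral_const_mul, i2, integral_finsetSum _ fun j _ => (hdi j).const_mul _]
      simp_rw [integral_const_mul]
    have e2 : ∑ j, |b j| * ∫ z, d j z ∂P ≤ N * e := by
      rw [hN, Finset.sum_mul]
      exact Finset.sum_le_sum fun j _ => mul_le_mul_of_nonneg_left (hde j) (abs_nonneg _)
    have he0 : 0 ≤ e ∨ N = 0 := by
      rcases Nat.eq_zero_or_pos p with rfl | hp
      · right; simp [hN]
      · left
        refine le_trans (integral_nonneg_of_ae ?_) (hde ⟨0, hp⟩)
        filter_upwards [hd] with z hz using (sq_nonneg _).trans (hz _)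
    have e3 : 2 * N * (N * e) ≤ K * η * m := by
      have e4 : 2 * N * (N * e) ≤ 2 * (4 * φ * (active P θ).card * m) * e := by
        rcases he0 with he0 | hN00
        · calc 2 * N * (N * e) = 2 * N ^ 2 * e := by ring
            _ ≤ _ := by gcongr
        · have : 0 ≤ e := by
            by_contra hc
            have hp : 0 < p := by
              rcases Nat.eq_zero_or_pos p with rfl | hp
              · exact absurd (hr.betaStar_ne_zero) (by
                  intro h; exact h (Subsingleton.elim _ _))
              · exact hp
            refine hc (le_trans (integral_nonneg_of_ae ?_) (hde ⟨0, hp⟩))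
            filter_upwards [hd] with z hz using (sq_nonneg _).trans (hz _)
          rw [hN00]
          simp only [mul_zero, zero_mul]
          positivity
      calc _ ≤ _ := e4
        _ = 8 * φ * m * ((active P θ).card * e) := by ring
        _ ≤ 8 * φ * m * η := by gcongr
        _ ≤ 12 * φ ^ 2 * η * m := by nlinarith [mul_pos hm hη0]
        _ ≤ _ := by gcongr
    have e5 : Δ ⬝ᵥ (θ.Sigma *ᵥ Δ) ≤ K * η * m :=
      (hr.Sigma_quadForm_le Δ).trans (h1.trans (by gcongr))
    have e6 : θ.priorNeg * (θ.delta ⬝ᵥ Δ) ^ 2 ≤ K ^ 2 * η * m := by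
      have hn1 : θ.priorNeg ≤ 1 := by
        have := θ.priorPos_add_priorNeg
        linarith [hr.model.prior_pos]
      calc θ.priorNeg * (θ.delta ⬝ᵥ Δ) ^ 2 ≤ 1 * (m * (K * η ^ 2 * m)) := by
            gcongr
            exact (hr.sq_delta_dot_le Δ).trans (by gcongr)
        _ ≤ 1 * (K * (K * η * m)) := by gcongr
        _ = _ := by ring
    have e7 : K * η * m ≤ K ^ 3 * η * m := by
      have : K ≤ K ^ 3 := le_self_pow₀ hK1 (by norm_num)
      gcongr
    have e8 : K ^ 2 * η * m ≤ K ^ 3 * η * m := by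
      have : K ^ 2 ≤ K ^ 3 := pow_le_pow_right₀ hK1 (by norm_num)
      gcongr
    have e9 : 2 * N * ∑ j, |b j| * ∫ z, d j z ∂P ≤ 2 * N * (N * e) := by gcongr
    rw [e1]
    have e10 : 6 * K ^ 3 * η * m = 6 * (K ^ 3 * η * m) := by ring
    rw [e10]
    have : 0 ≤ K ^ 3 * η * m := by positivity
    linarith
  have hdom : ∀ᵐ z ∂P, (G z ⬝ᵥ b - θ.transform z.2 ⬝ᵥ β) ^ 2 ≤ W z := by
    filter_upwards [hd] with z hz
    have e1 : G z ⬝ᵥ b - θ.transform z.2 ⬝ᵥ β =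
        (fun j => G z j - θ.transform z.2 j) ⬝ᵥ b + θ.transform z.2 ⬝ᵥ Δ := by
      have : (fun j => G z j - θ.transform z.2 j) = G z - θ.transform z.2 := rfl
      rw [this, sub_dotProduct, hΔ, dotProduct_sub]; ring
    have e2 : ((fun j => G z j - θ.transform z.2 j) ⬝ᵥ b) ^ 2 ≤ N * ∑ j, |b j| * d j z := by
      have cs := Finset.sum_mul_sq_le_sq_mul_sq Finset.univ (fun j => √|b j|)
        (fun j => √|b j| * |G z j - θ.transform z.2 j|)
      have f1 : |(fun j => G z j - θ.transform z.2 j) ⬝ᵥ b| ≤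
          ∑ j, √|b j| * (√|b j| * |G z j - θ.transform z.2 j|) := by
        refine (Finset.abs_sum_le_sum_abs _ _).trans (Finset.sum_le_sum fun j _ => ?_)
        rw [← mul_assoc, Real.mul_self_sqrt (abs_nonneg _), abs_mul, mul_comm]
      have f2 : ∑ j, √|b j| ^ 2 = N :=
        Finset.sum_congr rfl fun j _ => Real.sq_sqrt (abs_nonneg _)
      have f3 : ∑ j, (√|b j| * |G z j - θ.transform z.2 j|) ^ 2 ≤ ∑ j, |b j| * d j z := by
        refine Finset.sum_le_sum fun j _ => ?_
        rw [mul_pow, Real.sq_sqrt (abs_nonneg _), sq_abs]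
        exact mul_le_mul_of_nonneg_left (hz j) (abs_nonneg _)
      rw [f2] at cs
      rw [← sq_abs]
      calc _ ≤ (∑ j, √|b j| * (√|b j| * |G z j - θ.transform z.2 j|)) ^ 2 := by gcongr
        _ ≤ _ := cs
        _ ≤ _ := by gcongr
    rw [e1, hW]
    have : ((fun j => G z j - θ.transform z.2 j) ⬝ᵥ b + θ.transform z.2 ⬝ᵥ Δ) ^ 2 ≤
        2 * ((fun j => G z j - θ.transform z.2 j) ⬝ᵥ b) ^ 2 + 2 * (θ.transform z.2 ⬝ᵥ Δ) ^ 2 := by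
      linarith [sq_nonneg ((fun j => G z j - θ.transform z.2 j) ⬝ᵥ b - θ.transform z.2 ⬝ᵥ Δ)]
    simp only
    linarith
  have hprob := hr.model.isProbabilityMeasure
  have hmarkov := mul_meas_ge_le_integral_of_nonneg (μ := P) (f := W)
    (by filter_upwards [hdom] with z hz using (sq_nonneg _).trans hz) hWi (t ^ 2 * m)
  have hsub : P.real {z | t * √m ≤ |G z ⬝ᵥ b - θ.transform z.2 ⬝ᵥ β|} ≤
      P.real {z | t ^ 2 * m ≤ W z} := by
    refine ENNReal.toReal_mono (measure_ne_top _ _) (measure_mono_ae ?_)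
    filter_upwards [hdom] with z hz (hz2 : t * √m ≤ |G z ⬝ᵥ b - θ.transform z.2 ⬝ᵥ β|)
    have h5 : (t * √m) ^ 2 ≤ |G z ⬝ᵥ b - θ.transform z.2 ⬝ᵥ β| ^ 2 := by gcongr
    rw [sq_abs, mul_pow, Real.sq_sqrt hm.le] at h5
    exact h5.trans hz
  refine hsub.trans ?_
  rw [le_div_iff₀ (by positivity)]
  have h7 : t ^ 2 * m * P.real {z | t ^ 2 * m ≤ W z} ≤ 6 * K ^ 3 * η * m := hmarkov.trans hWint
  have h8 : (P.real {z | t ^ 2 * m ≤ W z} * t ^ 2) * m ≤ (6 * K ^ 3 * η) * m := by linarith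
  exact le_of_mul_le_mul_right h8 hm

end IsRegular

/-- The margin ξ(√m + |log(π₊/π₋)|) is shared equally: the intercept error stays below one half
deterministically, the slope part below the other except with probability ε/2. The remaining ε/2 is
the probability of a small Bayes discriminant. -/
lemma IsRegular.abs_ssdaError_sub_le {p : ℕ} {P : Measure (ℝ × (Fin p → ℝ))} {θ : Params p}
    {π₀ g φ D₀ : ℝ} (hr : IsRegular P θ π₀ g φ D₀) {n : ℕ} (D : Fin n → ℝ × (Fin p → ℝ))
    {σ : Fin p → ℝ} (hσ : ∀ j, σ j * σ j = 1) {lam e K η ξ ε : ℝ} (hlam : 0 < lam) {b : Fin p → ℝ}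
    (hb : IsLassoSlope D lam b) {d : Fin p → ℝ × (Fin p → ℝ) → ℝ}
    (hsc : StatisticsClose (labels D) (signedData D σ) θ.priorPos θ.priorNeg θ.muNeg θ.Sigma e)
    (hn : n ≠ 0)
    (hdi : ∀ j, Integrable (d j) P) (hde : ∀ j, ∫ z, d j z ∂P ≤ e)
    (hd : ∀ᵐ z ∂P, ∀ j, (σ j * hHat D j (z.2 j) - θ.transform z.2 j) ^ 2 ≤ d j z)
    (hse : (active P θ).card * e ≤ η * lam) (hlamη : lam ≤ η * minSignal P θ)
    (hsη : (active P θ).card * e ≤ η)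
    (hξ : 0 < ξ) (hmargin : ∀ ς : ℝ, |ς| = 1 → (gaussianReal (ς * signal P θ / 2 +
      Real.log (θ.priorPos / θ.priorNeg) * (betaStar P θ ⬝ᵥ (θ.Sigma *ᵥ betaStar P θ)) / signal P θ)
      (betaStar P θ ⬝ᵥ (θ.Sigma *ᵥ betaStar P θ)).toNNReal).real
        {u | |u| ≤ ξ * (√(signal P θ) + |Real.log (θ.priorPos / θ.priorNeg)|)} ≤ ε / 2)
    (hK : K = 12 * φ ^ 2 / (g * π₀ ^ 2)) (hη0 : 0 < η) (hη1 : η ≤ 1) (hη2 : K * η ≤ 1 / 6)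
    (hη3 : 16 * K * (K * η) ≤ ξ / 2) (hη4 : 6 * K ^ 3 * η / (ξ / 2) ^ 2 ≤ ε / 2)
    (hη5 : η * (24 * φ * D₀) ≤ g * π₀) :
    |ssdaError D P b - bayesError P θ| ≤ ε := by
  have hprob := hr.model.isProbabilityMeasure
  have he0 : 0 ≤ e := (abs_nonneg _).trans hsc.freq_pos
  have hπ₀ := hr.prior_bound_pos
  have hφ1 := hr.one_le
  have hD1 := hr.one_le'
  have hg1 := hr.gap_le_one
  have hm := hr.signal_pos
  set m := signal P θ with hmdef
  set a := Real.log (θ.priorPos / θ.priorNeg) with ha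
  have heη : e ≤ η := by
    have h1 : (1 : ℝ) ≤ (active P θ).card := by exact_mod_cast hr.card_pos
    exact (le_mul_of_one_le_left he0 h1).trans hsη
  have heπ : e ≤ π₀ / 2 := by
    have h1 : η * (24 * φ * D₀) ≤ 1 * π₀ := hη5.trans (by gcongr)
    have h2 : 1 ≤ φ * D₀ := one_le_mul_of_one_le_of_one_le hφ1 hD1
    have h3 : η * 24 ≤ η * (24 * φ * D₀) := by
      gcongr
      linarith
    linarith
  set c := 2 * θ.priorPos * θ.priorNeg with hc
  have hc0 : 0 < c := hπ₀.trans_le hr.le_scale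
  set b' := c⁻¹ • (σ * b) with hb'
  have hdelta : ∀ j, θ.delta j = -θ.muNeg j := fun j => by rw [hr.model.delta_eq]; rfl
  obtain ⟨h1, h2, h3, h4⟩ := hr.slope_error_le (V := sampleCovMatrix (signedData D σ))
    (γ' := fun j => sampleCov (labels D) (fun i => signedData D σ i j)) (b := σ * b) he0 hlam hη0
    (sampleCovMatrix_quadForm_nonneg _)
    (fun j k => by
      rw [hr.model.Omega_apply, hdelta, hdelta, neg_mul_neg]
      exact hsc.cov j k)
    (fun j => by
      have := hsc.cov_label j
      rwa [hdelta, mul_neg])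
    (fun v => hb.variational D hσ hn hlam.le v) hse hlamη hsη hη5
  rw [← hK] at h1
  have hint := hr.abs_fittedIntercept_sub_le hsc hK.ge hη0 hη2 hsη heπ h1 h2 h3 h4
  have hslope := hr.measureReal_slope_diff_le (G := fun z => σ * transformHat D z.2) hK.ge hη0 hη1
    hdi hde hd hsη h1 h2 (t := ξ / 2) (by positivity)
  have hdisc := hr.measureReal_discriminant_le hmargin
  set τ := ξ * (√m + |a|) with hτ
  rw [ssdaError_eq D hσ P b hc0]
  refine (abs_error_sub_le P (fun z => z.1)
    (fun z => θ.transform z.2 ⬝ᵥ betaStar P θ + betaStarZero P θ)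
    (fun z => (σ * transformHat D z.2) ⬝ᵥ b' + fittedIntercept (labels D) (signedData D σ) b')
    τ).trans ?_
  have hsub : P.real {z | τ < |((σ * transformHat D z.2) ⬝ᵥ b' +
      fittedIntercept (labels D) (signedData D σ) b') -
      (θ.transform z.2 ⬝ᵥ betaStar P θ + betaStarZero P θ)|} ≤
      P.real {z | ξ / 2 * √m ≤ |(σ * transformHat D z.2) ⬝ᵥ b' -
        θ.transform z.2 ⬝ᵥ betaStar P θ|} := by
    refine measureReal_mono fun z (hz : τ < _) => ?_
    have h5 : |fittedIntercept (labels D) (signedData D σ) b' - betaStarZero P θ| ≤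
        ξ / 2 * (√m + |a|) := hint.trans (by gcongr)
    have h6 : ∀ x y u v : ℝ, |(x + u) - (y + v)| ≤ |x - y| + |u - v| := fun x y u v => by
      rw [add_sub_add_comm]; exact abs_add_le _ _
    have h7 := h6 ((σ * transformHat D z.2) ⬝ᵥ b') (θ.transform z.2 ⬝ᵥ betaStar P θ)
      (fittedIntercept (labels D) (signedData D σ) b') (betaStarZero P θ)
    have h8 : 0 ≤ ξ / 2 * |a| := by positivity
    change ξ / 2 * √m ≤ _
    rw [hτ] at hz
    linarith
  linarith

/-- The error of the fitted classifier is close to the Bayes error as soon as the sample moments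
and the transformations are close to their population counterparts, on the scale set by the
penalty parameter and the signal strength. -/
theorem exists_closeness {π₀ g φ D₀ ε : ℝ} (hπ₀ : 0 < π₀) (hg : 0 < g) (hφ : 1 ≤ φ) (hD : 1 ≤ D₀)
    (hε : 0 < ε) :
    ∃ η : ℝ, 0 < η ∧ ∀ {n p : ℕ} {P : Measure (ℝ × (Fin p → ℝ))} {θ : Params p},
      IsRegular P θ π₀ g φ D₀ → ∀ (D : Fin n → ℝ × (Fin p → ℝ)) (σ : Fin p → ℝ),
      (∀ j, σ j * σ j = 1) → ∀ (lam e : ℝ) (b : Fin p → ℝ) (d : Fin p → ℝ × (Fin p → ℝ) → ℝ),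
      0 < lam → IsLassoSlope D lam b →
      MomentsClose (labels D) (signedData D σ) θ.priorPos θ.priorNeg θ.muNeg θ.Sigma e →
      (∀ j, Integrable (d j) P) → (∀ j, ∫ z, d j z ∂P ≤ e) →
      (∀ᵐ z ∂P, ∀ j, (σ j * hHat D j (z.2 j) - θ.transform z.2 j) ^ 2 ≤ d j z) →
      (active P θ).card * e ≤ η * lam → lam ≤ η * minSignal P θ → (active P θ).card * e ≤ η →
      |ssdaError D P b - bayesError P θ| ≤ ε := by
  obtain ⟨ξ, hξ, hmargin⟩ := exists_margin hπ₀ (half_pos hε)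
  set K := 12 * φ ^ 2 / (g * π₀ ^ 2) with hK
  have hK0 : 0 < K := by positivity
  set η := min 1 (min (1 / (6 * K)) (min (ξ / (32 * K ^ 2))
    (min (ε / 2 * (ξ / 2) ^ 2 / (6 * K ^ 3)) (g * π₀ / (24 * φ * D₀))))) with hη
  have hη0 : 0 < η := by positivity
  have a1 : η ≤ 1 := min_le_left _ _
  have a2 : η ≤ 1 / (6 * K) := (min_le_right _ _).trans (min_le_left _ _)
  have a3 : η ≤ ξ / (32 * K ^ 2) :=
    (min_le_right _ _).trans ((min_le_right _ _).trans (min_le_left _ _))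
  have a4 : η ≤ ε / 2 * (ξ / 2) ^ 2 / (6 * K ^ 3) := (min_le_right _ _).trans
    ((min_le_right _ _).trans ((min_le_right _ _).trans (min_le_left _ _)))
  have a5 : η ≤ g * π₀ / (24 * φ * D₀) := (min_le_right _ _).trans
    ((min_le_right _ _).trans ((min_le_right _ _).trans (min_le_right _ _)))
  rw [le_div_iff₀ (by positivity)] at a2 a3 a4 a5
  -- The factor undoes the amplification 15D₀²/π₀ in the passage from moments to statistics.
  refine ⟨η * (π₀ / (15 * D₀ ^ 2)), by positivity, ?_⟩
  intro n p P θ hr D σ hσ lam e b d hlam hb hmc hdi hde hd hse hlamη hsη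
  have hπh := hr.bound_le_half
  have he0 : 0 < e := lt_of_lt_of_le
    (by have := hmc.four_le; have : 0 < n := by omega
        positivity) hmc.inv_le
  have hs1 : (1 : ℝ) ≤ (active P θ).card := by exact_mod_cast hr.card_pos
  have hD2 : 1 ≤ D₀ ^ 2 := one_le_pow₀ hD
  have hq1 : π₀ / (15 * D₀ ^ 2) ≤ 1 := by
    rw [div_le_one (by positivity)]; linarith
  have heπ : e ≤ π₀ / 4 := by
    calc e ≤ (active P θ).card * e := le_mul_of_one_le_left he0.le hs1
      _ ≤ η * (π₀ / (15 * D₀ ^ 2)) := hsη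
      _ ≤ 1 * (π₀ / (15 * 1)) := by gcongr
      _ ≤ π₀ / 4 := by linarith
  have hsc := hmc.statisticsClose hπ₀ hr.le_priorPos hr.le_priorNeg θ.priorPos_add_priorNeg hD
    hr.abs_muNeg_le hr.model.abs_Sigma_le heπ
  have hfac : 1 ≤ 15 * D₀ ^ 2 / π₀ := by
    rw [one_le_div hπ₀]; linarith
  have hscale : ∀ x : ℝ, (active P θ).card * e ≤ η * (π₀ / (15 * D₀ ^ 2)) * x →
      (active P θ).card * (15 * D₀ ^ 2 / π₀ * e) ≤ η * x := by
    intro x hx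
    calc (active P θ).card * (15 * D₀ ^ 2 / π₀ * e)
        = 15 * D₀ ^ 2 / π₀ * ((active P θ).card * e) := by ring
      _ ≤ 15 * D₀ ^ 2 / π₀ * (η * (π₀ / (15 * D₀ ^ 2)) * x) := by gcongr
      _ = η * x := by field_simp
  refine hr.abs_ssdaError_sub_le D hσ hlam hb hsc (by have := hmc.four_le; omega) hdi
    (fun j => (hde j).trans (le_mul_of_one_le_left he0.le hfac)) hd (hscale _ hse)
    (hlamη.trans ?_) ?_ hξ (fun ς hς => hmargin _ _ _ _ ς hr.le_priorPos hr.le_priorNeg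
      θ.priorPos_add_priorNeg hr.signal_pos hr.variance_pos hr.variance_eq hς) hK hη0 a1
    (by linarith) ?_ ?_ a5
  · have := hr.minSignal_pos_and_le.1
    gcongr
    exact mul_le_of_le_one_right hη0.le hq1
  · have := hscale 1 (by rwa [mul_one])
    rwa [mul_one] at this
  · linarith
  · rw [div_le_iff₀ (by positivity)]
    linarith

/-! ### Concentration of sample means -/

section Concentration

variable {E Ω : Type*} [MeasurableSpace E] [MeasurableSpace Ω] {P : Measure E} {Pr : Measure Ω}
  [IsProbabilityMeasure Pr] {n : ℕ} {Z : Fin n → Ω → E}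

/-- Hoeffding's inequality: a centred variable with values in an interval of length 2 is
sub-Gaussian with variance proxy 1. -/
lemma measureReal_sampleMean_ge_le (hn : 0 < n) (hlaw : ∀ i, HasLaw (Z i) P Pr)
    (hindep : iIndepFun Z Pr) {f : E → ℝ} (hf : AEMeasurable f P) (hf1 : ∀ᵐ z ∂P, |f z| ≤ 1)
    {τ : ℝ} (hτ : 0 ≤ τ) :
    Pr.real {ω | τ ≤ sampleMean (fun i => f (Z i ω)) - ∫ z, f z ∂P} ≤
      Real.exp (-(n * τ ^ 2 / 2)) := by
  have hn' : (0 : ℝ) < n := by exact_mod_cast hn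
  have hfi : ∀ i, AEMeasurable f (Pr.map (Z i)) := fun i => by rwa [(hlaw i).map_eq]
  have hm : ∀ i, AEMeasurable (fun ω => f (Z i ω)) Pr := fun i =>
    (hfi i).comp_aemeasurable (hlaw i).aemeasurable
  have hint : ∀ i, ∫ ω, f (Z i ω) ∂Pr = ∫ z, f z ∂P := fun i =>
    (hlaw i).integral_comp hf.aestronglyMeasurable
  have hind : iIndepFun (fun i ω => f (Z i ω) - ∫ z, f z ∂P) Pr := by
    refine hindep.comp₀ (fun _ x => f x - ∫ z, f z ∂P) (fun i => (hlaw i).aemeasurable)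
      fun i => (hfi i).sub_const _
  have hsub : ∀ i ∈ Finset.univ, HasSubgaussianMGF (fun ω => f (Z i ω) - ∫ z, f z ∂P)
      1 Pr := by
    intro i _
    have hb : ∀ᵐ ω ∂Pr, f (Z i ω) ∈ Set.Icc (-1 : ℝ) 1 := by
      have : ∀ᵐ z ∂(Pr.map (Z i)), |f z| ≤ 1 := by rwa [(hlaw i).map_eq]
      filter_upwards [ae_of_ae_map (hlaw i).aemeasurable this] with ω hω
      exact abs_le.1 hω
    have h := hasSubgaussianMGF_of_mem_Icc (hm i) hb
    rw [hint i] at h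
    convert h
    rw [← NNReal.coe_inj]
    norm_num
  have h := HasSubgaussianMGF.measure_sum_ge_le_of_iIndepFun hind hsub
    (ε := n * τ) (by positivity)
  have e1 : -(n * τ) ^ 2 / (2 * ((∑ _i : Fin n, (1 : NNReal) : NNReal) : ℝ)) = -(n * τ ^ 2 / 2) := by
    simp
    field_simp
  rw [e1] at h
  refine le_trans (measureReal_mono fun ω (hω : τ ≤ _) => ?_) h
  change n * τ ≤ ∑ i, (f (Z i ω) - ∫ z, f z ∂P)
  rw [Finset.sum_sub_distrib, Finset.sum_const, Finset.card_univ, Fintype.card_fin, nsmul_eq_mul]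
  calc n * τ ≤ n * (sampleMean (fun i => f (Z i ω)) - ∫ z, f z ∂P) := by gcongr
    _ = _ := by rw [sampleMean]; field_simp

lemma measureReal_abs_sampleMean_sub_gt_le (hn : 0 < n) (hlaw : ∀ i, HasLaw (Z i) P Pr)
    (hindep : iIndepFun Z Pr) {f : E → ℝ} (hf : AEMeasurable f P) (hf1 : ∀ᵐ z ∂P, |f z| ≤ 1)
    {τ : ℝ} (hτ : 0 ≤ τ) :
    Pr.real {ω | τ < |sampleMean (fun i => f (Z i ω)) - ∫ z, f z ∂P|} ≤
      2 * Real.exp (-(n * τ ^ 2 / 2)) := by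
  have h1 := measureReal_sampleMean_ge_le hn hlaw hindep hf hf1 hτ
  have h2 := measureReal_sampleMean_ge_le hn hlaw hindep (f := fun z => -f z) hf.neg
    (by simpa using hf1) hτ
  rw [two_mul]
  refine le_trans ?_ (add_le_add h1 h2)
  refine le_trans (measureReal_mono fun ω (hω : τ < _) => ?_) (measureReal_union_le _ _)
  rcases lt_abs.1 hω with h | h
  · exact Or.inl h.le
  · right
    change τ ≤ sampleMean (fun i => -f (Z i ω)) - ∫ z, -f z ∂P
    have e : sampleMean (fun i => -f (Z i ω)) = -sampleMean fun i => f (Z i ω) := by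
      simp [sampleMean]
    rw [integral_neg, e]
    linarith

lemma measureReal_exists_abs_sampleMean_sub_gt_le {ι : Type*} [Fintype ι] (hn : 0 < n)
    (hlaw : ∀ i, HasLaw (Z i) P Pr) (hindep : iIndepFun Z Pr) {f : ι → E → ℝ}
    (hf : ∀ a, AEMeasurable (f a) P) (hf1 : ∀ a, ∀ᵐ z ∂P, |f a z| ≤ 1) {τ : ℝ} (hτ : 0 ≤ τ) :
    Pr.real {ω | ∃ a, τ < |sampleMean (fun i => f a (Z i ω)) - ∫ z, f a z ∂P|} ≤
      Fintype.card ι * (2 * Real.exp (-(n * τ ^ 2 / 2))) := by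
  rw [Set.ofPred_exists]
  refine (measureReal_iUnion_fintype_le _).trans ?_
  refine (Finset.sum_le_sum fun a _ =>
    measureReal_abs_sampleMean_sub_gt_le hn hlaw hindep (hf a) (hf1 a) hτ).trans ?_
  simp

end Concentration

/-! ### Truncated moments of the population -/

/-- A label `y` and a vector `x` of predictors, extended by the constant `1`. -/
def extend {p : ℕ} (y : ℝ) (x : Fin p → ℝ) : Bool ⊕ Fin p → ℝ :=
  Sum.elim (fun c => if c then y else 1) x

/-- The coordinates of `x` which exceed `M` in absolute value are replaced by `0`. -/
def truncate {p : ℕ} (M : ℝ) (x : Fin p → ℝ) : Fin p → ℝ :=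
  fun j => if M < |x j| then 0 else x j

lemma abs_truncate_le {p : ℕ} {M : ℝ} (hM : 0 ≤ M) (x : Fin p → ℝ) (j : Fin p) :
    |truncate M x j| ≤ M := by
  unfold truncate
  split_ifs with h
  · simpa using hM
  · exact not_lt.1 h

lemma abs_truncate_le_abs {p : ℕ} (M : ℝ) (x : Fin p → ℝ) (j : Fin p) :
    |truncate M x j| ≤ |x j| := by
  unfold truncate
  split_ifs with h
  · simp
  · exact le_rfl

lemma abs_extend_truncate_le {p : ℕ} {M y : ℝ} (hM : 1 ≤ M) (hy : y = 1 ∨ y = -1)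
    (x : Fin p → ℝ) (a : Bool ⊕ Fin p) : |extend y (truncate M x) a| ≤ M := by
  rcases a with (_ | _) | j
  · simpa [extend] using hM
  · rcases hy with rfl | rfl <;> simpa [extend] using hM
  · exact abs_truncate_le (by linarith) x j

lemma abs_extend_truncate_le_abs {p : ℕ} (M y : ℝ) (x : Fin p → ℝ) (a : Bool ⊕ Fin p) :
    |extend y (truncate M x) a| ≤ |extend y x a| := by
  rcases a with c | j
  · exact le_rfl
  · exact abs_truncate_le_abs M x j

lemma sq_extend_sub_truncate {p : ℕ} (M y : ℝ) (x : Fin p → ℝ) (a : Bool ⊕ Fin p) :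
    (extend y x a - extend y (truncate M x) a) ^ 2 =
      Sum.elim (fun _ => 0) (fun j => if M < |x j| then x j ^ 2 else 0) a := by
  rcases a with c | j
  · simp [extend]
  · simp only [extend, Sum.elim_inr, truncate]
    split_ifs <;> ring

/-- Weighted arithmetic–geometric mean inequality. The weight e⁻¹ is chosen so that mean square
differences of order e² and bounded second moments give an error of order e for products. -/
lemma abs_mul_sub_mul_le_of_sq {u v u' v' e : ℝ} (he : 0 < e) (he1 : e ≤ 1) :
    |u * v - u' * v'| ≤ e⁻¹ * ((u - u') ^ 2 + (v - v') ^ 2) + e / 2 * (u' ^ 2 + v' ^ 2) := by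
  have key : ∀ a b : ℝ, |a * b| ≤ e⁻¹ / 2 * a ^ 2 + e / 2 * b ^ 2 := by
    intro a b
    have h1 : (0 : ℝ) ≤ e⁻¹ / 2 * (|a| - e * |b|) ^ 2 := by positivity
    have h2 : e⁻¹ / 2 * (|a| - e * |b|) ^ 2 =
        e⁻¹ / 2 * a ^ 2 + e / 2 * b ^ 2 - |a| * |b| := by
      rw [← sq_abs a, ← sq_abs b]
      field_simp
      ring
    rw [abs_mul]
    linarith
  have k1 := key (u - u') v'
  have k2 := key (v - v') u'
  have k3 : |(u - u') * (v - v')| ≤ e⁻¹ / 2 * ((u - u') ^ 2 + (v - v') ^ 2) := by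
    have h1 : 1 ≤ e⁻¹ := (one_le_inv₀ he).2 he1
    have h2 : |(u - u') * (v - v')| ≤ 1 / 2 * ((u - u') ^ 2 + (v - v') ^ 2) := by
      rw [abs_mul, ← sq_abs (u - u'), ← sq_abs (v - v')]
      linarith [sq_nonneg (|u - u'| - |v - v'|)]
    refine h2.trans ?_
    gcongr
  have e1 : u * v - u' * v' = (u - u') * (v - v') + (u - u') * v' + (v - v') * u' := by ring
  rw [e1]
  have := abs_add_three ((u - u') * (v - v')) ((u - u') * v') ((v - v') * u')
  linarith

namespace IsSeLDA

variable {p : ℕ} {P : Measure (ℝ × (Fin p → ℝ))} {θ : Params p} (h : IsSeLDA P θ)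
include h

lemma hasLaw_pos (j : Fin p) :
    HasLaw (fun z => θ.transform z.2 j) (gaussianReal 0 1) (cond P {z | z.1 = 1}) := by
  have := hasLaw_coord h.law_pos h.posSemidef j
  simpa [h.muPos_eq_zero, h.diag_eq_one] using this

lemma hasLaw_neg (j : Fin p) :
    HasLaw (fun z => θ.transform z.2 j) (gaussianReal (θ.muNeg j) 1) (cond P {z | z.1 = -1}) := by
  have := hasLaw_coord h.law_neg h.posSemidef j
  simpa [h.diag_eq_one] using this

lemma integral_label_eq_one : ∫ z, (if z.1 = 1 then (1 : ℝ) else 0) ∂P = θ.priorPos := by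
  have e : (fun z : ℝ × (Fin p → ℝ) => if z.1 = 1 then (1 : ℝ) else 0) =
      {z : ℝ × (Fin p → ℝ) | z.1 = 1}.indicator 1 := by
    ext z; simp [Set.indicator]
  rw [e, integral_indicator_one (measurableSet_label 1), h.prior_eq]

/-- In the class `Y = 1` the variable h_j(X_j) is standard normal, a symmetric law, so the sign `ς`
does not matter. -/
lemma integral_label_and_le {ς : ℝ} (hς : ς * ς = 1) (j : Fin p) (x : ℝ) :
    ∫ z, (if z.1 = 1 ∧ ς * θ.transform z.2 j ≤ x then (1 : ℝ) else 0) ∂P =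
      θ.priorPos * stdCdf x := by
  have := h.law_pos.isProbabilityMeasure
  have := h.law_neg.isProbabilityMeasure
  have hlaw : HasLaw (fun z => ς * θ.transform z.2 j) (gaussianReal 0 1)
      (cond P {z | z.1 = 1}) := by
    have := gaussianReal_const_mul (h.hasLaw_pos j) ς
    have hv : NNReal.mk (ς ^ 2) (sq_nonneg ς) = 1 := by
      rw [← NNReal.coe_inj]; simp [sq, hς]
    rwa [mul_zero, mul_one, hv] at this
  set f : ℝ → ℝ := (Set.Iic x).indicator 1 with hf
  have hfm : Measurable f := measurable_one.indicator measurableSet_Iic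
  have e1 : (fun z : ℝ × (Fin p → ℝ) => if z.1 = 1 ∧ ς * θ.transform z.2 j ≤ x then (1 : ℝ) else 0)
      =ᵐ[cond P {z | z.1 = 1}] fun z => f (ς * θ.transform z.2 j) := by
    filter_upwards [ae_cond_label 1] with z hz
    simp [hz, hf, Set.indicator]
  have e2 : (fun z : ℝ × (Fin p → ℝ) => if z.1 = 1 ∧ ς * θ.transform z.2 j ≤ x then (1 : ℝ) else 0)
      =ᵐ[cond P {z | z.1 = -1}] fun _ => 0 := by
    filter_upwards [ae_cond_label (-1)] with z hz
    rw [if_neg]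
    rw [hz]
    norm_num
  have i1 : Integrable (fun z : ℝ × (Fin p → ℝ) => f (ς * θ.transform z.2 j))
      (cond P {z | z.1 = 1}) := by
    refine Integrable.of_bound (hfm.comp_aemeasurable hlaw.aemeasurable).aestronglyMeasurable 1
      (ae_of_all _ fun z => ?_)
    simp only [hf, Set.indicator]
    split_ifs <;> simp
  rw [h.integral_eq (i1.congr e1.symm) ((integrable_zero _ _ _).congr e2.symm),
    integral_congr_ae e1, integral_congr_ae e2, integral_zero, mul_zero, add_zero]
  congr 1
  have e3 : ∫ z, f (ς * θ.transform z.2 j) ∂(cond P {z | z.1 = 1}) = ∫ t, f t ∂(gaussianReal 0 1) :=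
    hlaw.integral_comp hfm.aestronglyMeasurable
  rw [e3, hf, integral_indicator_one measurableSet_Iic, ← cdf_eq_real]

lemma integrable_tail_sq (M : ℝ) (j : Fin p) :
    Integrable (fun z => if M < |θ.transform z.2 j| then θ.transform z.2 j ^ 2 else 0) P := by
  refine (h.memLp_coord j).integrable_sq.mono ?_ (ae_of_all _ fun z => ?_)
  · have hm : Measurable fun t : ℝ => if M < |t| then t ^ 2 else 0 :=
      Measurable.ite (measurableSet_lt (by fun_prop) (by fun_prop)) (by fun_prop) (by fun_prop)
    exact (hm.comp_aemeasurable (h.aemeasurable_coord j)).aestronglyMeasurable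
  · split_ifs
    · exact le_rfl
    · simp [sq_nonneg]

lemma integral_tail_sq_le {M D : ℝ} (hM : 0 ≤ M) (hD : 0 ≤ D) (j : Fin p) (hμ : |θ.muNeg j| ≤ D) :
    ∫ z, (if M < |θ.transform z.2 j| then θ.transform z.2 j ^ 2 else 0) ∂P ≤
      4 * Real.exp (-M ^ 2 / 2 + (M + 1) * (D + 1)) := by
  have hm : Measurable fun t : ℝ => if M < |t| then t ^ 2 else 0 :=
    Measurable.ite (measurableSet_lt (by fun_prop) (by fun_prop)) (by fun_prop) (by fun_prop)
  have key : ∀ {Q : Measure (ℝ × (Fin p → ℝ))} {ν : ℝ}, |ν| ≤ D →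
      HasLaw (fun z => θ.transform z.2 j) (gaussianReal ν 1) Q →
      Integrable (fun z => if M < |θ.transform z.2 j| then θ.transform z.2 j ^ 2 else 0) Q ∧
      ∫ z, (if M < |θ.transform z.2 j| then θ.transform z.2 j ^ 2 else 0) ∂Q ≤
      4 * Real.exp (-M ^ 2 / 2 + (M + 1) * (D + 1)) := by
    intro Q ν hν hl
    have h2 : MemLp id 2 (Q.map fun z => θ.transform z.2 j) := by
      rw [hl.map_eq]; exact memLp_id_gaussianReal' 2 (by simp)
    have h3 : MemLp (fun z => θ.transform z.2 j) 2 Q :=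
      (memLp_map_measure_iff h2.1 hl.aemeasurable).1 h2
    constructor
    · refine h3.integrable_sq.mono
        (hm.comp_aemeasurable hl.aemeasurable).aestronglyMeasurable (ae_of_all _ fun z => ?_)
      split_ifs
      · exact le_rfl
      · simp [sq_nonneg]
    · have := hl.integral_comp (f := fun t : ℝ => if M < |t| then t ^ 2 else 0)
        hm.aestronglyMeasurable
      refine le_trans (le_of_eq this) (SSDA.integral_tail_sq_le hM hν)
  obtain ⟨i1, b1⟩ := key (by simpa using hD) (h.hasLaw_pos j)
  obtain ⟨i2, b2⟩ := key hμ (h.hasLaw_neg j)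
  have hp := h.prior_pos
  have hn := h.priorNeg_pos
  rw [h.integral_eq i1 i2]
  set B := 4 * Real.exp (-M ^ 2 / 2 + (M + 1) * (D + 1)) with hB
  calc _ ≤ θ.priorPos * B + θ.priorNeg * B := by gcongr
    _ = (θ.priorPos + θ.priorNeg) * B := by ring
    _ = B := by rw [θ.priorPos_add_priorNeg, one_mul]

lemma integrable_tail (M : ℝ) (j : Fin p) :
    Integrable (fun z => if M < |θ.transform z.2 j| then (1 : ℝ) else 0) P := by
  have := h.isProbabilityMeasure
  have hm : Measurable fun t : ℝ => if M < |t| then (1 : ℝ) else 0 :=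
    Measurable.ite (measurableSet_lt (by fun_prop) (by fun_prop)) (by fun_prop) (by fun_prop)
  refine Integrable.of_bound
    (hm.comp_aemeasurable (h.aemeasurable_coord j)).aestronglyMeasurable 1 (ae_of_all _ fun z => ?_)
  split_ifs <;> simp

lemma integral_tail_le {M D : ℝ} (hM : 1 ≤ M) (hD : 0 ≤ D) (j : Fin p) (hμ : |θ.muNeg j| ≤ D) :
    ∫ z, (if M < |θ.transform z.2 j| then (1 : ℝ) else 0) ∂P ≤
      4 * Real.exp (-M ^ 2 / 2 + (M + 1) * (D + 1)) := by
  refine le_trans (integral_mono (h.integrable_tail M j) (h.integrable_tail_sq M j) fun z => ?_)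
    (h.integral_tail_sq_le (by linarith) hD j hμ)
  simp only
  split_ifs with hc
  · rw [← sq_abs]
    exact one_le_pow₀ (hM.trans hc.le)
  · exact le_rfl

lemma aemeasurable_extend (a : Bool ⊕ Fin p) :
    AEMeasurable (fun z => extend z.1 (θ.transform z.2) a) P := by
  rcases a with (_ | _) | j
  · exact aemeasurable_const
  · exact measurable_fst.aemeasurable
  · exact h.aemeasurable_coord j

lemma aemeasurable_extend_truncate (M : ℝ) (a : Bool ⊕ Fin p) :
    AEMeasurable (fun z => extend z.1 (truncate M (θ.transform z.2)) a) P := by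
  rcases a with (_ | _) | j
  · exact aemeasurable_const
  · exact measurable_fst.aemeasurable
  · have hm : Measurable fun t : ℝ => if M < |t| then 0 else t :=
      Measurable.ite (measurableSet_lt (by fun_prop) (by fun_prop)) (by fun_prop) (by fun_prop)
    exact hm.comp_aemeasurable (h.aemeasurable_coord j)

lemma memLp_extend (a : Bool ⊕ Fin p) :
    MemLp (fun z => extend z.1 (θ.transform z.2) a) 2 P := by
  have := h.isProbabilityMeasure
  rcases a with (_ | _) | j
  · exact memLp_const 1
  · refine MemLp.of_bound (h.aemeasurable_extend _).aestronglyMeasurable 1 ?_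
    filter_upwards [h.label] with z hz
    rcases hz with hz | hz <;> simp [extend, hz]
  · exact h.memLp_coord j

lemma memLp_extend_truncate (M : ℝ) (a : Bool ⊕ Fin p) :
    MemLp (fun z => extend z.1 (truncate M (θ.transform z.2)) a) 2 P :=
  (h.memLp_extend a).mono (h.aemeasurable_extend_truncate M a).aestronglyMeasurable
    (ae_of_all _ fun _ => abs_extend_truncate_le_abs _ _ _ _)

lemma integral_sq_extend_le {D : ℝ} (hD : 1 ≤ D) (hμ : ∀ j, |θ.muNeg j| ≤ D) (a : Bool ⊕ Fin p) :
    ∫ z, extend z.1 (θ.transform z.2) a ^ 2 ∂P ≤ 2 * D ^ 2 := by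
  have := h.isProbabilityMeasure
  have hD2 : 1 ≤ D ^ 2 := one_le_pow₀ hD
  rcases a with c | j
  · have : ∫ z, extend z.1 (θ.transform z.2) (Sum.inl c) ^ 2 ∂P = ∫ _, (1 : ℝ) ∂P := by
      refine integral_congr_ae ?_
      filter_upwards [h.label] with z hz
      cases c
      · simp [extend]
      · rcases hz with hz | hz <;> simp [extend, hz]
    rw [this]
    simp
    linarith
  · have h1 := h.integral_coord_mul j j
    have e : ∫ z, extend z.1 (θ.transform z.2) (Sum.inr j) ^ 2 ∂P =
        ∫ z, θ.transform z.2 j * θ.transform z.2 j ∂P := by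
      simp only [extend, Sum.elim_inr, sq]
    rw [e, h1, h.diag_eq_one]
    have h2 : θ.muNeg j * θ.muNeg j ≤ D ^ 2 := by
      rw [← sq, ← sq_abs]
      have := hμ j
      gcongr
    have h3 : θ.priorNeg ≤ 1 := by
      have := θ.priorPos_add_priorNeg
      linarith [h.prior_pos]
    have h4 : θ.priorNeg * (θ.muNeg j * θ.muNeg j) ≤ 1 * D ^ 2 := by
      have := mul_self_nonneg (θ.muNeg j)
      gcongr
    linarith

lemma integral_sq_extend_truncate_le {D : ℝ} (M : ℝ) (hD : 1 ≤ D) (hμ : ∀ j, |θ.muNeg j| ≤ D)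
    (a : Bool ⊕ Fin p) :
    ∫ z, extend z.1 (truncate M (θ.transform z.2)) a ^ 2 ∂P ≤ 2 * D ^ 2 := by
  refine le_trans (integral_mono (h.memLp_extend_truncate M a).integrable_sq
    (h.memLp_extend a).integrable_sq fun z => ?_) (h.integral_sq_extend_le hD hμ a)
  exact sq_le_sq.2 (abs_extend_truncate_le_abs M z.1 _ a)

/-- The truncation bias: only the tails of the coordinates are removed, and their second moments are
at most e². -/
lemma abs_integral_extend_mul_sub_le {M D e : ℝ} (hM : 0 ≤ M) (hD : 1 ≤ D)
    (hμ : ∀ j, |θ.muNeg j| ≤ D) (he : 0 < e) (he1 : e ≤ 1)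
    (hMe : 4 * Real.exp (-M ^ 2 / 2 + (M + 1) * (D + 1)) ≤ e ^ 2) (a b : Bool ⊕ Fin p) :
    |∫ z, extend z.1 (θ.transform z.2) a * extend z.1 (θ.transform z.2) b ∂P -
      ∫ z, extend z.1 (truncate M (θ.transform z.2)) a *
        extend z.1 (truncate M (θ.transform z.2)) b ∂P| ≤ 4 * D ^ 2 * e := by
  have hD2 : 1 ≤ D ^ 2 := one_le_pow₀ hD
  have hU := h.memLp_extend
  have hW := h.memLp_extend_truncate M
  have hd : ∀ a, ∫ z, (extend z.1 (θ.transform z.2) a -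
      extend z.1 (truncate M (θ.transform z.2)) a) ^ 2 ∂P ≤ e ^ 2 := by
    intro a
    simp only [sq_extend_sub_truncate]
    rcases a with c | j
    · simpa using sq_nonneg e
    · exact (h.integral_tail_sq_le hM (by linarith) j (hμ j)).trans hMe
  have hdi : ∀ a, Integrable (fun z => (extend z.1 (θ.transform z.2) a -
      extend z.1 (truncate M (θ.transform z.2)) a) ^ 2) P := fun a =>
    ((hU a).sub (hW a)).integrable_sq
  have iU : Integrable (fun z => extend z.1 (θ.transform z.2) a *
      extend z.1 (θ.transform z.2) b) P := (hU a).integrable_mul (hU b)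
  have iW : Integrable (fun z => extend z.1 (truncate M (θ.transform z.2)) a *
      extend z.1 (truncate M (θ.transform z.2)) b) P := (hW a).integrable_mul (hW b)
  rw [← integral_sub iU iW]
  refine abs_integral_le_integral_abs.trans ?_
  have key : ∀ {f₁ f₂ g₁ g₂ : ℝ × (Fin p → ℝ) → ℝ} (c k : ℝ), Integrable f₁ P → Integrable f₂ P →
      Integrable g₁ P → Integrable g₂ P →
      Integrable (fun z => c * (f₁ z + f₂ z) + k * (g₁ z + g₂ z)) P ∧
      ∫ z, (c * (f₁ z + f₂ z) + k * (g₁ z + g₂ z)) ∂P =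
        c * (∫ z, f₁ z ∂P + ∫ z, f₂ z ∂P) + k * (∫ z, g₁ z ∂P + ∫ z, g₂ z ∂P) := by
    intro f₁ f₂ g₁ g₂ c k i1 i2 i3 i4
    have j1 : Integrable (fun z => c * (f₁ z + f₂ z)) P := (i1.add i2).const_mul c
    have j2 : Integrable (fun z => k * (g₁ z + g₂ z)) P := (i3.add i4).const_mul k
    refine ⟨j1.add j2, ?_⟩
    rw [integral_add j1 j2, integral_const_mul, integral_const_mul, integral_add i1 i2,
      integral_add i3 i4]
  obtain ⟨k1, k2⟩ := key e⁻¹ (e / 2) (hdi a) (hdi b) (hW a).integrable_sq (hW b).integrable_sq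
  refine (integral_mono (iU.sub iW).abs k1 fun z => abs_mul_sub_mul_le_of_sq he he1).trans ?_
  rw [k2]
  have t1 := h.integral_sq_extend_truncate_le M hD hμ a
  have t2 := h.integral_sq_extend_truncate_le M hD hμ b
  have t3 := hd a
  have t4 := hd b
  calc _ ≤ e⁻¹ * (e ^ 2 + e ^ 2) + e / 2 * (2 * D ^ 2 + 2 * D ^ 2) := by gcongr
    _ = 2 * e + 2 * (D ^ 2 * e) := by field_simp; ring
    _ ≤ 4 * D ^ 2 * e := by nlinarith

end IsSeLDA

/-! ### Typical samples -/

/-- A sample whose empirical frequencies and truncated moments are within a multiple of `τ` of the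
population values. -/
structure IsTypical {n p : ℕ} (P : Measure (ℝ × (Fin p → ℝ))) (θ : Params p) (σ : Fin p → ℝ)
    (S : Fin p → Set ℝ) (M τ : ℝ) (D : Fin n → ℝ × (Fin p → ℝ)) : Prop where
  label : ∀ i, (D i).1 = 1 ∨ (D i).1 = -1
  mem : ∀ i j, (D i).2 j ∈ S j
  freq : |sampleMean (fun i => if (D i).1 = 1 then (1 : ℝ) else 0) - θ.priorPos| ≤ τ
  grid : ∀ j, ∀ k : ℤ, |k| ≤ (n : ℤ) ^ 2 →
    |sampleMean (fun i => if (D i).1 = 1 ∧ σ j * θ.h j ((D i).2 j) ≤ k / n then (1 : ℝ) else 0) -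
      θ.priorPos * stdCdf (k / n)| ≤ τ
  tail : ∀ j, |sampleMean (fun i => if M < |θ.transform (D i).2 j| then (1 : ℝ) else 0) -
    ∫ z, (if M < |θ.transform z.2 j| then (1 : ℝ) else 0) ∂P| ≤ τ
  mul : ∀ a b, |sampleMean (fun i => extend (D i).1 (truncate M (θ.transform (D i).2)) a *
      extend (D i).1 (truncate M (θ.transform (D i).2)) b) -
    ∫ z, extend z.1 (truncate M (θ.transform z.2)) a *
      extend z.1 (truncate M (θ.transform z.2)) b ∂P| ≤ M ^ 2 * τ

/-- Relations between the sample size `n`, the truncation level `M`, the bound `K` for the pseudo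
data, the precision `τ` of empirical means and the resulting precision `e`. -/
structure Scale (n : ℕ) (π₀ D₀ M K τ e : ℝ) : Prop where
  four_le : 4 ≤ π₀ * n
  inv_le : 1 / (n : ℝ) ≤ e / 2
  pos : 0 < e
  le_one : e ≤ 1
  one_le_level : 1 ≤ M
  one_le_bound : 1 ≤ K
  level_le : M + 1 ≤ n
  pdf_ge : 4 / (π₀ * n) ^ 2 ≤ stdPdf (M + 1)
  exp_le : Real.exp (1 / 2 - K) ≤ 1 / (n : ℝ) ^ 2
  precision_le : τ ≤ π₀ / 2
  grid_le : 4 * τ / π₀ ≤ e / 2 * stdPdf (M + 1)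
  tail_le : K ^ 2 * τ ≤ e ^ 2
  mul_le : M ^ 2 * τ ≤ e
  gauss_le : K ^ 2 * (4 * Real.exp (-M ^ 2 / 2 + (M + 1) * (D₀ + 1))) ≤ e ^ 2

lemma Scale.ne_zero {n : ℕ} {π₀ D₀ M K τ e : ℝ} (hs : Scale n π₀ D₀ M K τ e) : n ≠ 0 := by
  rintro rfl
  have := hs.four_le
  simp at this
  linarith

namespace IsTypical

variable {n p : ℕ} {P : Measure (ℝ × (Fin p → ℝ))} {θ : Params p} {σ : Fin p → ℝ}
  {S : Fin p → Set ℝ} {M τ : ℝ} {D : Fin n → ℝ × (Fin p → ℝ)} {π₀ g φ D₀ K e : ℝ}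
  (ht : IsTypical P θ σ S M τ D) (hr : IsRegular P θ π₀ g φ D₀) (hs : Scale n π₀ D₀ M K τ e)
include ht hr hs

lemma classSize_mem : π₀ * n / 2 ≤ classSize D 1 ∧ classSize D 1 ≤ n := by
  have hπ₀ := hr.prior_bound_pos
  have hn : (0 : ℝ) < n := by
    have := hs.four_le
    by_contra hc
    have : π₀ * (n : ℝ) ≤ 0 := mul_nonpos_of_nonneg_of_nonpos hπ₀.le (not_lt.1 hc)
    linarith
  have h1 : classSize D 1 = n * sampleMean (fun i => if (D i).1 = 1 then (1 : ℝ) else 0) := by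
    rw [classSize_eq, sampleMean]; field_simp
  have h2 := (abs_le.1 ht.freq).1
  have h3 := hr.le_priorPos
  have h4 := hs.precision_le
  constructor
  · rw [h1]
    calc π₀ * n / 2 = n * (π₀ / 2) := by ring
      _ ≤ _ := by gcongr; linarith
  · rw [classSize_eq]
    calc _ ≤ ∑ _i : Fin n, (1 : ℝ) := by
          refine Finset.sum_le_sum fun i _ => ?_
          split_ifs <;> norm_num
      _ = n := by simp

lemma abs_hHat_le_bound (j : Fin p) (x : ℝ) : |hHat D j x| ≤ K := by
  obtain ⟨h1, h2⟩ := ht.classSize_mem hr hs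
  have h3 := hs.four_le
  refine abs_hHat_le D (by linarith) (hs.exp_le.trans ?_)
  have : 0 < classSize D 1 := by linarith
  gcongr

lemma abs_sign_mul_hHat_sub_le (hσ : ∀ j, σ j * σ j = 1)
    (hmono : ∀ j, StrictMonoOn (fun x => σ j * θ.h j x) (S j)) {j : Fin p} {x : Fin p → ℝ}
    (hx : x j ∈ S j) (hM : |θ.transform x j| ≤ M) :
    |σ j * hHat D j (x j) - θ.transform x j| ≤ e := by
  obtain ⟨h1, h2⟩ := ht.classSize_mem hr hs
  have h3 := hs.four_le
  have hπ₀ := hr.prior_bound_pos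
  have hn : 0 < n := Nat.pos_of_ne_zero hs.ne_zero
  have e1 : σ j * hHat D j (x j) - θ.transform x j =
      σ j * (hHat D j (x j) - σ j * θ.h j (x j)) := by
    have : θ.transform x j = θ.h j (x j) := rfl
    rw [this]
    linear_combination θ.h j (x j) * hσ j
  rw [e1, abs_mul_of_sign hσ]
  refine abs_hHat_sub_le D (g := fun x => σ j * θ.h j x) (hmono j) (fun i => ht.mem i j) hx hπ₀
    hr.le_priorPos hn hs.level_le hs.inv_le hs.le_one hs.precision_le hs.grid_le ht.freq
    (ht.grid j) (by linarith) (le_trans ?_ hs.pdf_ge) ?_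
  · have : (0 : ℝ) < π₀ * n / 2 := by positivity
    calc 1 / classSize D 1 ^ 2 ≤ 1 / (π₀ * n / 2) ^ 2 := by gcongr
      _ = 4 / (π₀ * n) ^ 2 := by rw [div_pow]; field_simp; norm_num
  · rw [abs_mul_of_sign hσ]; exact hM

/-- Inside the level `M` the estimate is accurate to `e`. Outside, only the bound `K` is available,
and the rarity of such observations has to compensate for it. -/
lemma sq_signedData_sub_truncate_le (hσ : ∀ j, σ j * σ j = 1)
    (hmono : ∀ j, StrictMonoOn (fun x => σ j * θ.h j x) (S j)) (i : Fin n) (j : Fin p) :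
    (signedData D σ i j - truncate M (θ.transform (D i).2) j) ^ 2 ≤
      K ^ 2 * (if M < |θ.transform (D i).2 j| then 1 else 0) + e ^ 2 := by
  have he := hs.pos
  unfold truncate
  split_ifs with hc
  · rw [sub_zero, ← sq_abs]
    have : |signedData D σ i j| ≤ K := by
      rw [signedData, abs_mul_of_sign hσ]
      exact ht.abs_hHat_le_bound hr hs j _
    have : |signedData D σ i j| ^ 2 ≤ K ^ 2 := by gcongr
    linarith [sq_nonneg e]
  · have := ht.abs_sign_mul_hHat_sub_le hr hs hσ hmono (ht.mem i j) (not_lt.1 hc)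
    have h2 : (signedData D σ i j - θ.transform (D i).2 j) ^ 2 ≤ e ^ 2 :=
      sq_le_sq.2 (by rw [abs_of_pos he]; exact this)
    linarith

lemma sampleMean_tail_le (j : Fin p) :
    K ^ 2 * sampleMean (fun i => if M < |θ.transform (D i).2 j| then (1 : ℝ) else 0) ≤
      2 * e ^ 2 := by
  have h1 := (abs_le.1 (ht.tail j)).2
  have h2 := hr.model.integral_tail_le hs.one_le_level (by linarith [hr.one_le']) j
    (hr.abs_muNeg_le j)
  have h3 := hs.tail_le
  have h4 := hs.gauss_le
  set B := 4 * Real.exp (-M ^ 2 / 2 + (M + 1) * (D₀ + 1)) with hB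
  calc _ ≤ K ^ 2 * (B + τ) := by
        gcongr
        linarith
    _ ≤ _ := by linarith

/-- The sample moments of the pseudo data are close to the population moments. -/
lemma abs_sampleMean_extend_mul_sub_le (hσ : ∀ j, σ j * σ j = 1)
    (hmono : ∀ j, StrictMonoOn (fun x => σ j * θ.h j x) (S j)) (a b : Bool ⊕ Fin p) :
    |sampleMean (fun i => extend (D i).1 (signedData D σ i) a *
        extend (D i).1 (signedData D σ i) b) -
      ∫ z, extend z.1 (θ.transform z.2) a * extend z.1 (θ.transform z.2) b ∂P| ≤
      20 * D₀ ^ 2 * e := by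
  have hn := hs.ne_zero
  have he := hs.pos
  have he1 := hs.le_one
  have hD := hr.one_le'
  have hD2 : 1 ≤ D₀ ^ 2 := one_le_pow₀ hD
  set H : Fin n → Bool ⊕ Fin p → ℝ := fun i => extend (D i).1 (signedData D σ i) with hH
  set W : Fin n → Bool ⊕ Fin p → ℝ := fun i =>
    extend (D i).1 (truncate M (θ.transform (D i).2)) with hW
  have hK1 : 1 ≤ K ^ 2 := one_le_pow₀ hs.one_le_bound
  have hpop := hr.model.abs_integral_extend_mul_sub_le (M := M) (D := D₀) (e := e)
    (by linarith [hs.one_le_level]) hD hr.abs_muNeg_le he he1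
    (le_trans (le_mul_of_one_le_left (by positivity) hK1) hs.gauss_le) a b
  have hmul := (ht.mul a b).trans hs.mul_le
  have hdiff : ∀ a, sampleMean (fun i => (H i a - W i a) ^ 2) ≤ 3 * e ^ 2 := by
    intro a
    rcases a with c | j
    · have : (fun i => (H i (Sum.inl c) - W i (Sum.inl c)) ^ 2) = fun _ => (0 : ℝ) := by
        ext i
        simp [hH, hW, extend]
      rw [this, sampleMean_const hn]
      positivity
    · calc sampleMean (fun i => (H i (Sum.inr j) - W i (Sum.inr j)) ^ 2) ≤
          sampleMean (fun i => K ^ 2 * (if M < |θ.transform (D i).2 j| then 1 else 0) + e ^ 2) :=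
            sampleMean_mono fun i => ht.sq_signedData_sub_truncate_le hr hs hσ hmono i j
        _ = K ^ 2 * sampleMean (fun i => if M < |θ.transform (D i).2 j| then (1 : ℝ) else 0) +
            e ^ 2 := by rw [sampleMean_add, sampleMean_const_mul, sampleMean_const hn]
        _ ≤ 2 * e ^ 2 + e ^ 2 := by
          linarith [ht.sampleMean_tail_le hr hs j]
        _ = _ := by ring
  have hsq : ∀ a, sampleMean (fun i => W i a ^ 2) ≤ 3 * D₀ ^ 2 := by
    intro a
    have h1 := (abs_le.1 ((ht.mul a a).trans hs.mul_le)).2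
    have h2 := hr.model.integral_sq_extend_truncate_le M hD hr.abs_muNeg_le a
    simp only [sq] at h2 ⊢
    have h3 : sampleMean (fun i => W i a * W i a) ≤ e + 2 * (D₀ * D₀) := by
      simp only [hW]
      linarith
    rw [sq] at hD2
    linarith
  have hsample : |sampleMean (fun i => H i a * H i b) - sampleMean (fun i => W i a * W i b)| ≤
      9 * D₀ ^ 2 * e := by
    rw [← sampleMean_sub]
    refine (abs_sampleMean_le _).trans ?_
    refine (sampleMean_mono fun i => abs_mul_sub_mul_le_of_sq he he1).trans ?_
    rw [sampleMean_add, sampleMean_const_mul, sampleMean_const_mul, sampleMean_add, sampleMean_add]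
    have t1 := hdiff a
    have t2 := hdiff b
    have t3 := hsq a
    have t4 := hsq b
    calc _ ≤ e⁻¹ * (3 * e ^ 2 + 3 * e ^ 2) + e / 2 * (3 * D₀ ^ 2 + 3 * D₀ ^ 2) := by gcongr
      _ = 6 * (1 * e) + 3 * (D₀ ^ 2 * e) := by field_simp; ring
      _ ≤ 6 * (D₀ ^ 2 * e) + 3 * (D₀ ^ 2 * e) := by gcongr
      _ = _ := by ring
  have he2 : e ≤ D₀ ^ 2 * e := le_mul_of_one_le_left he.le hD2
  rw [abs_le] at hsample hmul hpop ⊢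
  constructor <;> linarith [hsample.1, hsample.2, hmul.1, hmul.2, hpop.1, hpop.2]

lemma momentsClose (hσ : ∀ j, σ j * σ j = 1)
    (hmono : ∀ j, StrictMonoOn (fun x => σ j * θ.h j x) (S j)) :
    MomentsClose (labels D) (signedData D σ) θ.priorPos θ.priorNeg θ.muNeg θ.Sigma
      (20 * D₀ ^ 2 * e) := by
  have hm := hr.model
  have key := ht.abs_sampleMean_extend_mul_sub_le hr hs hσ hmono
  have hD2 : 1 ≤ D₀ ^ 2 := one_le_pow₀ hr.one_le'
  have hD2e : e ≤ D₀ ^ 2 * e := le_mul_of_one_le_left hs.pos.le hD2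
  refine ⟨ht.label, ?_, ?_, ?_, fun j => ?_, fun j => ?_, fun j k => ?_⟩
  · have h1 := hs.four_le
    have h2 : π₀ * (n : ℝ) ≤ 1 * n := by
      gcongr
      linarith [hr.bound_le_half]
    have : (4 : ℝ) ≤ n := by linarith
    exact_mod_cast this
  · have h1 := hs.inv_le
    have h2 : 4 / (n : ℝ) = 4 * (1 / n) := by ring
    rw [h2]
    linarith [hs.pos]
  -- Products with the constant (index `false`) and with the label (index `true`) recover the first
  -- moments and the mixed moments from the same bound.
  · have := key (Sum.inl true) (Sum.inl false)
    simp only [extend, Sum.elim_inl, if_true, Bool.false_eq_true, if_false, mul_one] at this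
    rwa [hm.integral_label] at this
  · have := key (Sum.inr j) (Sum.inl false)
    simp only [extend, Sum.elim_inl, Sum.elim_inr, Bool.false_eq_true, if_false, mul_one] at this
    rwa [hm.integral_coord] at this
  · have := key (Sum.inl true) (Sum.inr j)
    simp only [extend, Sum.elim_inl, Sum.elim_inr, if_true] at this
    rwa [hm.integral_label_mul_coord] at this
  · have := key (Sum.inr j) (Sum.inr k)
    simp only [extend, Sum.elim_inr] at this
    rwa [hm.integral_coord_mul] at this

-- The same split at the level `M`, now for a new observation. Beyond `M` the true transformation is
-- not truncated, so its tail second moment enters as well.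
omit ht in
lemma integrable_majorant (j : Fin p) :
    Integrable (fun z => e ^ 2 + 2 * (K ^ 2 * (if M < |θ.transform z.2 j| then (1 : ℝ) else 0)) +
      2 * (if M < |θ.transform z.2 j| then θ.transform z.2 j ^ 2 else 0)) P ∧
    ∫ z, (e ^ 2 + 2 * (K ^ 2 * (if M < |θ.transform z.2 j| then (1 : ℝ) else 0)) +
      2 * (if M < |θ.transform z.2 j| then θ.transform z.2 j ^ 2 else 0)) ∂P ≤
      20 * D₀ ^ 2 * e := by
  have := hr.model.isProbabilityMeasure
  have hD : 0 ≤ D₀ := by linarith [hr.one_le']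
  have i1 := hr.model.integrable_tail M j
  have i2 := hr.model.integrable_tail_sq M j
  have i3 : Integrable (fun z => 2 * (K ^ 2 * (if M < |θ.transform z.2 j| then (1 : ℝ) else 0))) P :=
    (i1.const_mul _).const_mul _
  have i4 : Integrable (fun z => e ^ 2 +
      2 * (K ^ 2 * (if M < |θ.transform z.2 j| then (1 : ℝ) else 0))) P :=
    (integrable_const _).add i3
  refine ⟨i4.add (i2.const_mul 2), ?_⟩
  rw [integral_add i4 (i2.const_mul 2), integral_add (integrable_const _) i3, integral_const_mul,
    integral_const_mul, integral_const_mul]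
  have b1 := hr.model.integral_tail_le hs.one_le_level hD j (hr.abs_muNeg_le j)
  have b2 := hr.model.integral_tail_sq_le (zero_le_one.trans hs.one_le_level) hD j
    (hr.abs_muNeg_le j)
  have h4 := hs.gauss_le
  set B := 4 * Real.exp (-M ^ 2 / 2 + (M + 1) * (D₀ + 1)) with hB
  have b3 : K ^ 2 * ∫ z, (if M < |θ.transform z.2 j| then (1 : ℝ) else 0) ∂P ≤ K ^ 2 * B := by
    gcongr
  have b4 : B ≤ K ^ 2 * B :=
    le_mul_of_one_le_left (by positivity) (one_le_pow₀ hs.one_le_bound)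
  have b5 : e ^ 2 ≤ e := by
    rw [sq]; exact mul_le_of_le_one_left hs.pos.le hs.le_one
  have hD2e : e ≤ D₀ ^ 2 * e := le_mul_of_one_le_left hs.pos.le (one_le_pow₀ hr.one_le')
  simp only [integral_const, probReal_univ, one_smul]
  linarith [hs.pos]

lemma sq_sign_mul_hHat_sub_le (hσ : ∀ j, σ j * σ j = 1)
    (hmono : ∀ j, StrictMonoOn (fun x => σ j * θ.h j x) (S j)) {j : Fin p} {x : Fin p → ℝ}
    (hx : x j ∈ S j) :
    (σ j * hHat D j (x j) - θ.transform x j) ^ 2 ≤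
      e ^ 2 + 2 * (K ^ 2 * (if M < |θ.transform x j| then (1 : ℝ) else 0)) +
      2 * (if M < |θ.transform x j| then θ.transform x j ^ 2 else 0) := by
  have he := hs.pos
  split_ifs with hc
  · have h1 : |σ j * hHat D j (x j)| ≤ K := by
      rw [abs_mul_of_sign hσ]
      exact ht.abs_hHat_le_bound hr hs j _
    have h2 : (σ j * hHat D j (x j)) ^ 2 ≤ K ^ 2 := by
      rw [← sq_abs]; gcongr
    linarith [sq_nonneg (σ j * hHat D j (x j) + θ.transform x j), sq_nonneg e]
  · have := ht.abs_sign_mul_hHat_sub_le hr hs hσ hmono hx (not_lt.1 hc)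
    have h2 : (σ j * hHat D j (x j) - θ.transform x j) ^ 2 ≤ e ^ 2 :=
      sq_le_sq.2 (by rw [abs_of_pos he]; exact this)
    linarith

end IsTypical

/-! ### Samples are typical with high probability -/

section

variable {p : ℕ} {P : Measure (ℝ × (Fin p → ℝ))} {θ : Params p} {Ω : Type*} [MeasurableSpace Ω]
  {Pr : Measure Ω} [IsProbabilityMeasure Pr] {n : ℕ} {Z : Fin n → Ω → ℝ × (Fin p → ℝ)}

/-- The functions whose sample means have to be close to the population means. -/
def testFunction (θ : Params p) (σ : Fin p → ℝ) (M : ℝ) (n : ℕ) :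
    (Fin p × Finset.Icc (-(n : ℤ) ^ 2) ((n : ℤ) ^ 2)) ⊕ Option (Fin p) ⊕
      (Bool ⊕ Fin p) × (Bool ⊕ Fin p) → ℝ × (Fin p → ℝ) → ℝ
  | Sum.inl (j, k), z => if z.1 = 1 ∧ σ j * θ.transform z.2 j ≤ (k : ℤ) / n then 1 else 0
  | Sum.inr (Sum.inl none), z => if z.1 = 1 then 1 else 0
  | Sum.inr (Sum.inl (some j)), z => if M < |θ.transform z.2 j| then 1 else 0
  -- The normalization makes these products bounded by 1 like the indicators, so one Hoeffding bound
  -- serves the whole family.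
  | Sum.inr (Sum.inr (a, b)), z => (M ^ 2)⁻¹ *
      (extend z.1 (truncate M (θ.transform z.2)) a * extend z.1 (truncate M (θ.transform z.2)) b)

lemma aemeasurable_testFunction (h : IsSeLDA P θ) (σ : Fin p → ℝ) (M : ℝ) (n : ℕ) (a) :
    AEMeasurable (testFunction θ σ M n a) P := by
  rcases a with ⟨j, k⟩ | (_ | j) | ⟨a, b⟩
  · have hm : Measurable fun y : ℝ × ℝ =>
        if y.1 = 1 ∧ σ j * y.2 ≤ ((k : ℤ) : ℝ) / n then (1 : ℝ) else 0 :=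
      Measurable.ite ((measurableSet_eq_fun measurable_fst measurable_const).inter
        (measurableSet_le (measurable_snd.const_mul _) measurable_const)) (by fun_prop)
        (by fun_prop)
    exact hm.comp_aemeasurable (measurable_fst.aemeasurable.prodMk (h.aemeasurable_coord j))
  · exact (Measurable.ite (measurableSet_label 1) measurable_const measurable_const).aemeasurable
  · exact (h.integrable_tail M j).aemeasurable
  · exact ((h.aemeasurable_extend_truncate M a).mul
      (h.aemeasurable_extend_truncate M b)).const_mul _

lemma abs_testFunction_le (h : IsSeLDA P θ) (σ : Fin p → ℝ) {M : ℝ} (hM : 1 ≤ M) (n : ℕ) (a) :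
    ∀ᵐ z ∂P, |testFunction θ σ M n a z| ≤ 1 := by
  filter_upwards [h.label] with z hz
  rcases a with ⟨j, k⟩ | (_ | j) | ⟨a, b⟩
  · simp only [testFunction]; split_ifs <;> simp
  · simp only [testFunction]; split_ifs <;> simp
  · simp only [testFunction]; split_ifs <;> simp
  · simp only [testFunction]
    have h1 := abs_extend_truncate_le hM hz (θ.transform z.2) a
    have h2 := abs_extend_truncate_le hM hz (θ.transform z.2) b
    have hM0 : 0 < M ^ 2 := by positivity
    rw [abs_mul, abs_of_pos (inv_pos.2 hM0), inv_mul_le_iff₀ hM0, mul_one, abs_mul, sq]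
    gcongr

/-- The number of test functions is at most `14 p² n²`. -/
lemma card_testFunction_le (hp : 1 ≤ p) (hn : 1 ≤ n) :
    (Fintype.card ((Fin p × Finset.Icc (-(n : ℤ) ^ 2) ((n : ℤ) ^ 2)) ⊕ Option (Fin p) ⊕
      (Bool ⊕ Fin p) × (Bool ⊕ Fin p)) : ℝ) ≤ 14 * p ^ 2 * n ^ 2 := by
  have h1 : Fintype.card (Finset.Icc (-(n : ℤ) ^ 2) ((n : ℤ) ^ 2)) = 2 * n ^ 2 + 1 := by
    rw [Fintype.card_coe, Int.card_Icc]
    have : (n : ℤ) ^ 2 + 1 - -(n : ℤ) ^ 2 = ((2 * n ^ 2 + 1 : ℕ) : ℤ) := by push_cast; ring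
    rw [this, Int.toNat_natCast]
  simp only [Fintype.card_sum, Fintype.card_prod, Fintype.card_fin, Fintype.card_option, h1,
    Fintype.card_bool]
  have hp' : (1 : ℝ) ≤ p := by exact_mod_cast hp
  have hn' : (1 : ℝ) ≤ n := by exact_mod_cast hn
  push_cast
  have a1 : (1 : ℝ) ≤ (n : ℝ) ^ 2 := one_le_pow₀ hn'
  have a2 : (p : ℝ) ≤ (p : ℝ) ^ 2 := le_self_pow₀ hp' two_ne_zero
  have a3 : (p : ℝ) ^ 2 ≤ (p : ℝ) ^ 2 * n ^ 2 := le_mul_of_one_le_right (by positivity) a1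
  have a4 : (p : ℝ) * n ^ 2 ≤ (p : ℝ) ^ 2 * n ^ 2 := by gcongr
  nlinarith

/-- A sample is typical with high probability. -/
lemma measureReal_not_isTypical_le (h : IsSeLDA P θ) (hlaw : ∀ i, HasLaw (Z i) P Pr)
    (hindep : iIndepFun Z Pr) {σ : Fin p → ℝ} (hσ : ∀ j, σ j * σ j = 1) {S : Fin p → Set ℝ}
    (hS : ∀ j, ∀ᵐ z ∂P, z.2 j ∈ S j) {M τ : ℝ} (hM : 1 ≤ M) (hτ : 0 ≤ τ) (hp : 1 ≤ p)
    (hn : 1 ≤ n) :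
    Pr.real {ω | ¬ IsTypical P θ σ S M τ (fun i => Z i ω)} ≤
      28 * p ^ 2 * n ^ 2 * Real.exp (-(n * τ ^ 2 / 2)) := by
  have hbound := measureReal_exists_abs_sampleMean_sub_gt_le hn hlaw hindep
    (aemeasurable_testFunction h σ M n) (abs_testFunction_le h σ hM n) hτ
  have hcard := card_testFunction_le (n := n) hp hn
  refine le_trans (le_trans ?_ hbound) ?_
  · refine ENNReal.toReal_mono (measure_ne_top _ _) (measure_mono_ae ?_)
    have hlab : ∀ᵐ ω ∂Pr, ∀ i, (Z i ω).1 = 1 ∨ (Z i ω).1 = -1 := by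
      refine ae_all_iff.2 fun i =>
        ae_of_ae_map (p := fun z => z.1 = 1 ∨ z.1 = -1) (hlaw i).aemeasurable ?_
      rw [(hlaw i).map_eq]
      exact h.label
    have hmem : ∀ᵐ ω ∂Pr, ∀ i j, (Z i ω).2 j ∈ S j := by
      refine ae_all_iff.2 fun i => ae_all_iff.2 fun j =>
        ae_of_ae_map (p := fun z => z.2 j ∈ S j) (hlaw i).aemeasurable ?_
      rw [(hlaw i).map_eq]
      exact hS j
    filter_upwards [hlab, hmem] with ω h1 h2 h3
    by_contra hc
    have hc' : ∀ a, |sampleMean (fun i => testFunction θ σ M n a (Z i ω)) -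
        ∫ z, testFunction θ σ M n a z ∂P| ≤ τ := fun a => not_lt.1 fun hlt => hc ⟨a, hlt⟩
    refine h3 ⟨h1, h2, ?_, fun j k hk => ?_, fun j => hc' (Sum.inr (Sum.inl (some j))),
      fun a b => ?_⟩
    · have := hc' (Sum.inr (Sum.inl none))
      simp only [testFunction] at this
      rwa [h.integral_label_eq_one] at this
    · have := hc' (Sum.inl (j, ⟨k, Finset.mem_Icc.2 (abs_le.1 hk)⟩))
      simp only [testFunction] at this
      rwa [h.integral_label_and_le (hσ j)] at this
    · have := hc' (Sum.inr (Sum.inr (a, b)))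
      have hM0 : 0 < M ^ 2 := by positivity
      simp only [testFunction] at this
      rw [sampleMean_const_mul, integral_const_mul, ← mul_sub, abs_mul,
        abs_of_pos (inv_pos.2 hM0), inv_mul_le_iff₀ hM0] at this
      exact this
  · calc _ ≤ 14 * (p : ℝ) ^ 2 * n ^ 2 * (2 * Real.exp (-(n * τ ^ 2 / 2))) := by gcongr
      _ = _ := by ring

end

/-! ### Asymptotic relations -/

/-- The choice M² = (2/3) log n makes exp(-M²/2) = n^(-1/3), which is both the order of the density
at the edge and that of the tail. The spare factor n^(-ρ/4) in the precision τ absorbs the factors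
exp(O(M)) from shifting M by 1, and the powers of log n. -/
lemma Scale.of_log {n : ℕ} {π₀ D₀ ρ C x M e : ℝ} (hn : 0 < n) (hx : x = Real.log n)
    (hM : M = √(2 / 3 * x)) (hπ₀ : 0 < π₀) (hD : 1 ≤ D₀) (hρ : 0 < ρ)
    (hρ1 : ρ < 1 / 3) (hC1 : Real.log (8 * √(2 * Real.pi) / π₀) + 1 ≤ C)
    (hC2 : Real.log (4 / π₀ ^ 2 * √(2 * Real.pi)) + 1 ≤ C) (hC3 : Real.log 4 + (D₀ + 1) ≤ C)
    (hC4 : Real.log (4 / π₀) ≤ C) (hC5 : 1 ≤ C)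
    (hM1 : 1 ≤ M) (hCM : C + C * M ≤ ρ / 4 * x) (hK : (2 * x + 1) ^ 2 ≤ Real.exp (ρ / 4 * x))
    (he : Real.exp (-((1 / 3 - ρ) * x / 2)) ≤ e) (he1 : e ≤ 1) :
    Scale n π₀ D₀ M (2 * x + 1) (e * Real.exp (-((1 / 3 + ρ / 4) * x))) e := by
  have hn' : (0 : ℝ) < n := by exact_mod_cast hn
  have hnx : (n : ℝ) = Real.exp x := by rw [hx, Real.exp_log hn']
  have hC0 : 0 ≤ C := by linarith
  have hCM' : C ≤ C * M := le_mul_of_one_le_right hC0 hM1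
  have hMC : M ≤ C * M := le_mul_of_one_le_left (by linarith) hC5
  have hx0 : 0 < x := by
    by_contra hc
    have : ρ / 4 * x ≤ 0 := mul_nonpos_of_nonneg_of_nonpos (by positivity) (not_lt.1 hc)
    linarith
  have hρx : ρ / 4 * x ≤ 1 / 12 * x :=
    mul_le_mul_of_nonneg_right (by linarith) hx0.le
  have hρx0 : 0 < ρ * x := by positivity
  have hM2 : M ^ 2 = 2 / 3 * x := by rw [hM, Real.sq_sqrt (by positivity)]
  have he0 : 0 < e := (Real.exp_pos _).trans_le he
  have hpi : 0 < √(2 * Real.pi) := by positivity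
  have hlog : ∀ {c y : ℝ}, 0 < c → Real.log c ≤ y → c ≤ Real.exp y := fun hc hy => by
    rwa [Real.log_le_iff_le_exp hc] at hy
  have hpdf : stdPdf (M + 1) = (√(2 * Real.pi))⁻¹ * Real.exp (-(x / 3 + M + 1 / 2)) := by
    rw [stdPdf_eq]
    congr 2
    linear_combination (-1 / 2) * hM2
  have hτ1 : e * Real.exp (-((1 / 3 + ρ / 4) * x)) ≤ Real.exp (-((1 / 3 + ρ / 4) * x)) :=
    mul_le_of_le_one_left (Real.exp_pos _).le he1
  have he2 : Real.exp (-((1 / 3 - ρ) * x)) ≤ e ^ 2 := by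
    calc Real.exp (-((1 / 3 - ρ) * x)) = Real.exp (-((1 / 3 - ρ) * x / 2)) ^ 2 := by
          rw [← Real.exp_nat_mul]; congr 1; push_cast; ring
      _ ≤ e ^ 2 := by gcongr
  constructor
  · have h1 := hlog (by positivity) (hC4.trans (by linarith : C ≤ x))
    rw [div_le_iff₀ hπ₀, ← hnx] at h1
    linarith
  · have h1 : (2 : ℝ) ≤ Real.exp 1 := by linarith [Real.add_one_le_exp (1 : ℝ)]
    have h2 : 1 / (n : ℝ) = Real.exp (-x) := by rw [hnx, Real.exp_neg, one_div]
    have h3 : 2 * Real.exp (-x) ≤ e := by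
      calc 2 * Real.exp (-x) ≤ Real.exp 1 * Real.exp (-x) := by gcongr
        _ = Real.exp (1 + -x) := (Real.exp_add _ _).symm
        _ ≤ Real.exp (-((1 / 3 - ρ) * x / 2)) := by
          refine Real.exp_le_exp.2 ?_
          linarith
        _ ≤ e := he
    rw [h2]; linarith
  · exact he0
  · exact he1
  · exact hM1
  · linarith
  · have := Real.add_one_le_exp x
    rw [hnx]
    linarith
  · have h1 := hlog (c := 4 / π₀ ^ 2 * √(2 * Real.pi)) (y := 2 * x - (x / 3 + M + 1 / 2))
      (by positivity) (by linarith)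
    rw [hpdf, hnx]
    calc 4 / (π₀ * Real.exp x) ^ 2 =
          (√(2 * Real.pi))⁻¹ * (4 / π₀ ^ 2 * √(2 * Real.pi)) * Real.exp (-(2 * x)) := by
          have h2 : Real.exp (2 * x) = Real.exp x ^ 2 := by
            rw [← Real.exp_nat_mul]; norm_num
          rw [Real.exp_neg, h2]
          field_simp
      _ ≤ (√(2 * Real.pi))⁻¹ * Real.exp (2 * x - (x / 3 + M + 1 / 2)) * Real.exp (-(2 * x)) := by
          gcongr
      _ = _ := by
          rw [mul_assoc, ← Real.exp_add]
          congr 2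
          ring
  · rw [hnx, ← Real.exp_nat_mul, one_div (Real.exp _), ← Real.exp_neg]
    refine Real.exp_le_exp.2 ?_
    push_cast
    linarith
  · have h1 := hlog (by positivity) (hC4.trans (by linarith : C ≤ x / 3))
    calc _ ≤ Real.exp (-((1 / 3 + ρ / 4) * x)) := hτ1
      _ ≤ Real.exp (-(x / 3)) := Real.exp_le_exp.2 (by linarith)
      _ = (Real.exp (x / 3))⁻¹ := Real.exp_neg _
      _ ≤ (4 / π₀)⁻¹ := by gcongr
      _ = π₀ / 4 := by rw [inv_div]
      _ ≤ π₀ / 2 := by linarith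
  · have h1 := hlog (c := 8 * √(2 * Real.pi) / π₀) (y := ρ / 4 * x - (M + 1 / 2))
      (by positivity) (by linarith)
    rw [hpdf]
    calc 4 * (e * Real.exp (-((1 / 3 + ρ / 4) * x))) / π₀ =
        e / 2 * ((√(2 * Real.pi))⁻¹ * ((8 * √(2 * Real.pi) / π₀) *
          Real.exp (-((1 / 3 + ρ / 4) * x)))) := by
          have h2 : (√(2 * Real.pi))⁻¹ * √(2 * Real.pi) = 1 := inv_mul_cancel₀ hpi.ne'
          linear_combination (-(4 * (e * Real.exp (-((1 / 3 + ρ / 4) * x))) / π₀)) * h2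
      _ ≤ e / 2 * ((√(2 * Real.pi))⁻¹ * (Real.exp (ρ / 4 * x - (M + 1 / 2)) *
          Real.exp (-((1 / 3 + ρ / 4) * x)))) := by gcongr
      _ = _ := by
          rw [← Real.exp_add]
          congr 3
          ring
  · calc (2 * x + 1) ^ 2 * (e * Real.exp (-((1 / 3 + ρ / 4) * x))) ≤
        Real.exp (ρ / 4 * x) * (e * Real.exp (-((1 / 3 + ρ / 4) * x))) := by gcongr
      _ = e * Real.exp (-(x / 3)) := by
          rw [mul_left_comm, ← Real.exp_add]
          congr 2
          ring
      _ ≤ e * Real.exp (-((1 / 3 - ρ) * x / 2)) := by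
          refine mul_le_mul_of_nonneg_left (Real.exp_le_exp.2 ?_) he0.le
          linarith
      _ ≤ e * e := by gcongr
      _ = e ^ 2 := by ring
  · calc M ^ 2 * (e * Real.exp (-((1 / 3 + ρ / 4) * x))) ≤
        Real.exp (ρ / 4 * x) * (e * Real.exp (-((1 / 3 + ρ / 4) * x))) := by
          gcongr
          refine le_trans ?_ hK
          rw [hM2]
          nlinarith
      _ = e * Real.exp (-(x / 3)) := by
          rw [mul_left_comm, ← Real.exp_add]
          congr 2
          ring
      _ ≤ e * 1 := by
          gcongr
          exact Real.exp_le_one_iff.2 (by linarith)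
      _ = e := mul_one e
  -- Exponents: ρx/4 for K², another ρx/4 for the constants and the terms linear in M, and -x/3 from
  -- the Gaussian tail. Their sum stays below -(1/3 - ρ)x, the exponent of the lower bound for e².
  · have h1 := hlog (c := 4) (y := C) (by norm_num) (by linarith)
    have h2 : (D₀ + 1) * M ≤ C * M := by
      have : 0 ≤ Real.log 4 := Real.log_nonneg (by norm_num)
      gcongr
      linarith
    have h3 : (4 : ℝ) = Real.exp (Real.log 4) := (Real.exp_log (by norm_num)).symm
    calc (2 * x + 1) ^ 2 * (4 * Real.exp (-M ^ 2 / 2 + (M + 1) * (D₀ + 1))) ≤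
        Real.exp (ρ / 4 * x) * (4 * Real.exp (-M ^ 2 / 2 + (M + 1) * (D₀ + 1))) := by gcongr
      _ = Real.exp (ρ / 4 * x + (Real.log 4 + (-M ^ 2 / 2 + (M + 1) * (D₀ + 1)))) := by
          rw [Real.exp_add (ρ / 4 * x), Real.exp_add (Real.log 4), ← h3]
      _ ≤ Real.exp (-((1 / 3 - ρ) * x)) := by
          refine Real.exp_le_exp.2 ?_
          rw [neg_div, hM2]
          linarith
      _ ≤ e ^ 2 := he2

/-- The bound for the probability of atypical samples. -/
lemma tail_bound_le {p n : ℕ} {ρ x e : ℝ} (hp : 0 < p) (hn : 0 < n) (hx : x = Real.log n)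
    (hx2 : 2 ≤ x) (hL : 1 ≤ Real.log p) (hK : (2 * x + 1) ^ 2 ≤ Real.exp (ρ / 4 * x))
    (he : e ^ 2 = Real.log p * Real.exp (-((1 / 3 - ρ) * x))) :
    28 * (p : ℝ) ^ 2 * n ^ 2 *
      Real.exp (-(n * (e * Real.exp (-((1 / 3 + ρ / 4) * x))) ^ 2 / 2)) ≤ 28 / n := by
  have hn' : (0 : ℝ) < n := by exact_mod_cast hn
  have hp' : (0 : ℝ) < p := by exact_mod_cast hp
  have hnx : (n : ℝ) = Real.exp x := by rw [hx, Real.exp_log hn']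
  set L := Real.log p with hLdef
  have hpL : (p : ℝ) = Real.exp L := (Real.exp_log hp').symm
  -- The powers of n combine to 1 - (1/3 - ρ) - 2(1/3 + ρ/4) = ρ/2. The surplus n^(ρ/2) outgrows log
  -- n and so beats the union bound over p²n² functions.
  have h1 : (n : ℝ) * (e * Real.exp (-((1 / 3 + ρ / 4) * x))) ^ 2 = L * Real.exp (ρ / 4 * x) ^ 2 := by
    rw [mul_pow, he, hnx, ← Real.exp_nat_mul, ← Real.exp_nat_mul]
    have : Real.exp x * (L * Real.exp (-((1 / 3 - ρ) * x)) *
        Real.exp ((2 : ℕ) * -((1 / 3 + ρ / 4) * x))) = L * (Real.exp x *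
        (Real.exp (-((1 / 3 - ρ) * x)) * Real.exp ((2 : ℕ) * -((1 / 3 + ρ / 4) * x)))) := by ring
    rw [this, ← Real.exp_add, ← Real.exp_add]
    congr 2
    push_cast
    ring
  have h2 : 2 * (2 + 3 * x) ≤ Real.exp (ρ / 4 * x) ^ 2 := by
    calc 2 * (2 + 3 * x) ≤ (2 * x + 1) ^ 2 := by nlinarith
      _ ≤ ((2 * x + 1) ^ 2) ^ 2 := by
        refine le_self_pow₀ ?_ two_ne_zero
        nlinarith
      _ ≤ _ := by gcongr
  have h3 : 2 * L + 2 * x - L * Real.exp (ρ / 4 * x) ^ 2 / 2 ≤ -x := by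
    have h4 : L * (2 * (2 + 3 * x)) ≤ L * Real.exp (ρ / 4 * x) ^ 2 := by gcongr
    nlinarith
  rw [h1]
  have h5 : (p : ℝ) ^ 2 * n ^ 2 * Real.exp (-(L * Real.exp (ρ / 4 * x) ^ 2 / 2)) =
      Real.exp (2 * L + 2 * x - L * Real.exp (ρ / 4 * x) ^ 2 / 2) := by
    rw [hpL, hnx, ← Real.exp_nat_mul, ← Real.exp_nat_mul, ← Real.exp_add, ← Real.exp_add]
    congr 1
  have h6 : Real.exp (-x) = 1 / n := by rw [hnx, Real.exp_neg, one_div]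
  calc _ = 28 * ((p : ℝ) ^ 2 * n ^ 2 * Real.exp (-(L * Real.exp (ρ / 4 * x) ^ 2 / 2))) := by ring
    _ ≤ 28 * Real.exp (-x) := by
      rw [h5]
      gcongr
    _ = _ := by rw [h6]; ring

lemma IsSeLDA.exists_sign {p : ℕ} {P : Measure (ℝ × (Fin p → ℝ))} {θ : Params p}
    (h : IsSeLDA P θ) : ∃ (σ : Fin p → ℝ) (S : Fin p → Set ℝ), (∀ j, σ j * σ j = 1) ∧
      (∀ j, StrictMonoOn (fun x => σ j * θ.h j x) (S j)) ∧ ∀ j, ∀ᵐ z ∂P, z.2 j ∈ S j := by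
  have key : ∀ j, ∃ (ς : ℝ) (S : Set ℝ), ς * ς = 1 ∧
      StrictMonoOn (fun x => ς * θ.h j x) S ∧ ∀ᵐ z ∂P, z.2 j ∈ S := by
    intro j
    obtain ⟨S, hS, hmem⟩ := h.strictMono j
    rcases hS with hS | hS
    · exact ⟨1, S, one_mul 1, by simpa using hS, hmem⟩
    · refine ⟨-1, S, by norm_num, fun x hx y hy hxy => ?_, hmem⟩
      have := hS hx hy hxy
      simp only [neg_one_mul]
      linarith
  choose σ S h1 h2 h3 using key
  exact ⟨σ, S, h1, h2, h3⟩

/-- The error of the fitted classifier exceeds the Bayes error by `ε` with small probability only,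
provided that the penalty parameter is on the right scale. -/
lemma exists_measureReal_error_le {π₀ g φ D₀ ε : ℝ} (hπ₀ : 0 < π₀) (hg : 0 < g) (hφ : 1 ≤ φ)
    (hD : 1 ≤ D₀) (hε : 0 < ε) :
    ∃ η : ℝ, 0 < η ∧ ∀ {n p : ℕ} {P : Measure (ℝ × (Fin p → ℝ))} {θ : Params p} {Ω : Type*}
      [MeasurableSpace Ω] {Pr : Measure Ω} [IsProbabilityMeasure Pr]
      {Z : Fin n → Ω → ℝ × (Fin p → ℝ)} {lam e M K τ : ℝ} {b : Ω → Fin p → ℝ},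
      IsRegular P θ π₀ g φ D₀ → (∀ i, HasLaw (Z i) P Pr) → iIndepFun Z Pr → 1 ≤ p →
      0 < lam → (∀ ω, IsLassoSlope (fun i => Z i ω) lam (b ω)) →
      Scale n π₀ D₀ M K τ e → 0 ≤ τ →
      (active P θ).card * e ≤ η * lam → lam ≤ η * minSignal P θ → (active P θ).card * e ≤ η →
      Pr.real {ω | ε ≤ |ssdaError (fun i => Z i ω) P (b ω) - bayesError P θ|} ≤
        28 * p ^ 2 * n ^ 2 * Real.exp (-(n * τ ^ 2 / 2)) := by
  obtain ⟨η, hη, hclose⟩ := exists_closeness hπ₀ hg hφ hD (half_pos hε)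
  have hD2 : 1 ≤ D₀ ^ 2 := one_le_pow₀ hD
  -- Typical samples have moments within 20D₀²e, and this factor is absorbed into `η`.
  refine ⟨η / (20 * D₀ ^ 2), by positivity, ?_⟩
  intro n p P θ Ω _ Pr _ Z lam e M K τ b hr hlaw hindep hp hlam hb hs hτ h1 h2 h3
  obtain ⟨σ, S, hσ, hmono, hS⟩ := hr.model.exists_sign
  refine le_trans (measureReal_mono fun ω hω => ?_) (measureReal_not_isTypical_le hr.model hlaw
    hindep hσ hS hs.one_le_level hτ hp (Nat.one_le_iff_ne_zero.2 hs.ne_zero))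
  intro ht
  have hmin := hr.minSignal_pos_and_le.1
  have hscale : ∀ y : ℝ, (active P θ).card * e ≤ η / (20 * D₀ ^ 2) * y →
      (active P θ).card * (20 * D₀ ^ 2 * e) ≤ η * y := by
    intro y hy
    calc (active P θ).card * (20 * D₀ ^ 2 * e) = 20 * D₀ ^ 2 * ((active P θ).card * e) := by ring
      _ ≤ 20 * D₀ ^ 2 * (η / (20 * D₀ ^ 2) * y) := by gcongr
      _ = η * y := by field_simp
  have h5 : |ssdaError (fun i => Z i ω) P (b ω) - bayesError P θ| ≤ ε / 2 := by
    refine hclose hr (fun i => Z i ω) σ hσ lam (20 * D₀ ^ 2 * e) (b ω) _ hlam (hb ω)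
      (ht.momentsClose hr hs hσ hmono) (fun j => (IsTypical.integrable_majorant hr hs j).1)
      (fun j => (IsTypical.integrable_majorant hr hs j).2) ?_ (hscale lam h1) (h2.trans ?_) ?_
    · filter_upwards [ae_all_iff.2 hS] with z hz j
      exact ht.sq_sign_mul_hHat_sub_le hr hs hσ hmono (hz j)
    · gcongr
      exact div_le_self hη.le (by linarith)
    · have := hscale 1 (by rwa [mul_one])
      rwa [mul_one] at this
  have h6 : ε ≤ |ssdaError (fun i => Z i ω) P (b ω) - bayesError P θ| := hω
  linarith

lemma eventually_log_relations {ρ : ℝ} (hρ : 0 < ρ) (C : ℝ) :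
    ∀ᶠ n : ℕ in atTop, 2 ≤ Real.log n ∧ 1 ≤ √(2 / 3 * Real.log n) ∧
      C + C * √(2 / 3 * Real.log n) ≤ ρ / 4 * Real.log n ∧
      (2 * Real.log n + 1) ^ 2 ≤ Real.exp (ρ / 4 * Real.log n) := by
  have hlog : Tendsto (fun n : ℕ => Real.log n) atTop atTop :=
    Real.tendsto_log_atTop.comp tendsto_natCast_atTop_atTop
  refine hlog.eventually (p := fun x : ℝ => 2 ≤ x ∧ 1 ≤ √(2 / 3 * x) ∧
    C + C * √(2 / 3 * x) ≤ ρ / 4 * x ∧ (2 * x + 1) ^ 2 ≤ Real.exp (ρ / 4 * x)) ?_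
  have hM : Tendsto (fun x : ℝ => √(2 / 3 * x)) atTop atTop :=
    Real.tendsto_sqrt_atTop.comp (tendsto_id.const_mul_atTop (by norm_num))
  -- The constant 1/9 is used with (2x + 1)² ≤ 9x² for x ≥ 1.
  have hexp := (isLittleO_pow_exp_pos_mul_atTop 2 (by positivity : 0 < ρ / 4)).bound
    (by norm_num : (0 : ℝ) < 1 / 9)
  filter_upwards [eventually_ge_atTop (2 : ℝ), hM.eventually_ge_atTop 1,
    -- This threshold gives 16|C|M ≤ 3ρM² = 2ρx, so that each of |C| and |C|M is at most ρx/8.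
    hM.eventually_ge_atTop (16 * |C| / (3 * ρ)), hexp] with x h1 h2 h3 h4
  refine ⟨h1, h2, ?_, ?_⟩
  · set M := √(2 / 3 * x) with hMdef
    have hM2 : M ^ 2 = 2 / 3 * x := Real.sq_sqrt (by positivity)
    rw [div_le_iff₀ (by positivity)] at h3
    have h5 : 16 * |C| * M ≤ M * (3 * ρ) * M := by gcongr
    have h6 : |C| ≤ |C| * M := le_mul_of_one_le_right (abs_nonneg _) h2
    have h7 : C * M ≤ |C| * M := by
      gcongr
      exact le_abs_self C
    have h8 : M * (3 * ρ) * M = 2 * ρ * x := by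
      linear_combination (3 * ρ) * hM2
    have := le_abs_self C
    linarith
  · rw [Real.norm_of_nonneg (by positivity), Real.norm_of_nonneg (by positivity)] at h4
    nlinarith

end SSDA

end

theorem corollary2
    -- for each sample size `n`: a model with `p n` predictors
    (p : ℕ → ℕ)
    (P : ∀ n, Measure (ℝ × (Fin (p n) → ℝ)))
    (θ : ∀ n, SSDA.Params (p n))
    (hmodel : ∀ n, SSDA.IsSeLDA (P n) (θ n))
    -- an i.i.d. sample of size `n` from this model
    {Ω : ℕ → Type*} [∀ n, MeasurableSpace (Ω n)]
    (Pr : ∀ n, Measure (Ω n)) [∀ n, IsProbabilityMeasure (Pr n)]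
    (Z : ∀ n, Fin n → Ω n → ℝ × (Fin (p n) → ℝ))
    (hlaw : ∀ n i, HasLaw (Z n i) (P n) (Pr n))
    (hindep : ∀ n, iIndepFun (Z n) (Pr n))
    -- the number `s n` of important predictors
    (s : ℕ → ℕ) (hs : ∀ n, s n = (SSDA.active (P n) (θ n)).card) (hs_pos : ∀ n, 0 < s n)
    -- the class probabilities, `κ`, `φ` and `Δ` are controlled uniformly in `n`
    (π₀ : ℝ) (hπ₀ : 0 < π₀)
    (hprior : ∀ n, π₀ ≤ (θ n).priorPos ∧ π₀ ≤ (θ n).priorNeg)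
    (κ₀ : ℝ) (hκ₀ : κ₀ < 1) (hκ : ∀ n, SSDA.kappa (P n) (θ n) ≤ κ₀)
    (φ₀ : ℝ) (hφ : ∀ n, SSDA.phi (P n) (θ n) ≤ φ₀)
    (Δ₀ : ℝ) (hΔ : ∀ n, SSDA.Delta (P n) (θ n) ≤ Δ₀)
    -- condition (C1)
    (ρ : ℝ) (hρ_pos : 0 < ρ) (hρ_lt : ρ < 1 / 3)
    (hp : Tendsto p atTop atTop)
    (hC1 : Tendsto
      (fun n : ℕ => (s n : ℝ) ^ 2 * Real.log (p n * s n) / (n : ℝ) ^ (1 / 3 - ρ)) atTop (𝓝 0))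
    -- condition (C2)
    (hC2 : (fun n : ℕ => max ((s n : ℝ) * (n : ℝ) ^ (-ρ / 2))
        ((s n : ℝ) * Real.sqrt (Real.log (p n * s n) / (n : ℝ) ^ (1 / 3 - ρ))))
      =o[atTop] fun n => SSDA.minSignal (P n) (θ n))
    -- the penalty parameter
    (lam : ℕ → ℝ) (hlam_pos : ∀ n, 0 < lam n)
    (hlam_upper : lam =o[atTop] fun n => SSDA.minSignal (P n) (θ n))
    (hlam_lower :
      (fun n : ℕ => Real.sqrt (Real.log (p n * s n) * ((s n : ℝ) ^ 2 / (n : ℝ) ^ (1 / 3 - ρ))))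
        =o[atTop] lam)
    -- the slope of the SSDA classifier, an arbitrary minimizer if there are several ones
    (betaHat : ∀ n, Ω n → Fin (p n) → ℝ)
    (hbetaHat : ∀ n ω, SSDA.IsLassoSlope (fun i => Z n i ω) (lam n) (betaHat n ω)) :
    -- `R_n - R → 0` in probability
    ∀ ε : ℝ, 0 < ε →
      Tendsto (fun n => Pr n {ω | ε ≤ |SSDA.ssdaError (fun i => Z n i ω) (P n) (betaHat n ω) -
        SSDA.bayesError (P n) (θ n)|}) atTop (𝓝 0) := by
  intro ε hε
  set g := 1 - κ₀ with hg
  set φ := max φ₀ 1 with hφ'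
  set D₀ := max Δ₀ 1 with hD'
  have hg0 : 0 < g := by rw [hg]; linarith
  have hφ1 : 1 ≤ φ := le_max_right _ _
  have hD1 : 1 ≤ D₀ := le_max_right _ _
  have hr : ∀ n, SSDA.IsRegular (P n) (θ n) π₀ g φ D₀ := fun n =>
    { model := hmodel n
      prior_bound_pos := hπ₀
      le_priorPos := (hprior n).1
      le_priorNeg := (hprior n).2
      gap_pos := hg0
      kappa_le := (hκ n).trans (by rw [hg]; linarith)
      phi_le := (hφ n).trans (le_max_left _ _)
      one_le := hφ1
      Delta_le := (hΔ n).trans (le_max_left _ _)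
      one_le' := hD1
      card_pos := by rw [← hs n]; exact hs_pos n }
  obtain ⟨η, hη, hmain⟩ := SSDA.exists_measureReal_error_le hπ₀ hg0 hφ1 hD1 hε
  set a := 1 / 3 - ρ with ha
  set L : ℕ → ℝ := fun n => Real.log (p n) with hL
  -- The precision √(log p / n^(1/3-ρ)). Using log p instead of log(ps) only makes it smaller, so
  -- s·e is below the lower scale for the penalty.
  set e : ℕ → ℝ := fun n => √(L n * Real.exp (-(a * Real.log n))) with he
  set C := |Real.log (8 * √(2 * Real.pi) / π₀)| + |Real.log (4 / π₀ ^ 2 * √(2 * Real.pi))| +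
    |Real.log 4 + (D₀ + 1)| + |Real.log (4 / π₀)| + 1 with hC
  have hLtop : Tendsto L atTop atTop :=
    Real.tendsto_log_atTop.comp (tendsto_natCast_atTop_atTop.comp hp)
  have hse : ∀ n : ℕ, 0 < n → 1 ≤ p n → (s n : ℝ) * e n ≤
      √(Real.log (p n * s n) * ((s n : ℝ) ^ 2 / (n : ℝ) ^ a)) := by
    intro n hn hpn
    have hn' : (0 : ℝ) < n := by exact_mod_cast hn
    have hs1 : (1 : ℝ) ≤ s n := by exact_mod_cast hs_pos n
    have hp1 : (1 : ℝ) ≤ p n := by exact_mod_cast hpn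
    have h1 : L n ≤ Real.log (p n * s n) :=
      Real.log_le_log (by linarith) (le_mul_of_one_le_right (by linarith) hs1)
    have h2 : (n : ℝ) ^ a = Real.exp (a * Real.log n) := by
      rw [Real.rpow_def_of_pos hn', mul_comm]
    refine Real.le_sqrt_of_sq_le ?_
    have h3 : 0 ≤ L n * Real.exp (-(a * Real.log n)) :=
      mul_nonneg (Real.log_nonneg hp1) (Real.exp_pos _).le
    rw [mul_pow, he, Real.sq_sqrt h3, h2, Real.exp_neg]
    calc (s n : ℝ) ^ 2 * (L n * (Real.exp (a * Real.log n))⁻¹) =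
        L n * ((s n : ℝ) ^ 2 / Real.exp (a * Real.log n)) := by ring
      _ ≤ _ := by gcongr
  -- By (C1) this scale tends to 0, which makes both e ≤ 1 and s·e ≤ η hold eventually.
  have hu : Tendsto (fun n : ℕ => √(Real.log (p n * s n) * ((s n : ℝ) ^ 2 / (n : ℝ) ^ a)))
      atTop (𝓝 0) := by
    have h1 := (Real.continuous_sqrt.tendsto 0).comp hC1
    rw [Real.sqrt_zero] at h1
    refine h1.congr fun n => ?_
    simp only [Function.comp]
    congr 1
    ring
  have hevent : ∀ᶠ n : ℕ in atTop, Pr n {ω | ε ≤ |SSDA.ssdaError (fun i => Z n i ω) (P n)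
      (betaHat n ω) - SSDA.bayesError (P n) (θ n)|} ≤ ENNReal.ofReal (28 / n) := by
    filter_upwards [eventually_gt_atTop 0, hp.eventually_ge_atTop 1, hLtop.eventually_ge_atTop 1,
      hu.eventually (eventually_le_nhds (lt_min one_pos hη)), hlam_lower.bound hη,
      hlam_upper.bound hη, SSDA.eventually_log_relations hρ_pos C] with n hn hpn hLn hun hl1 hl2 hlog
    obtain ⟨hx2, hM1, hCM, hK⟩ := hlog
    have hmin := (hr n).minSignal_pos_and_le.1
    have hs1 : (1 : ℝ) ≤ s n := by exact_mod_cast hs_pos n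
    have hcard : ((SSDA.active (P n) (θ n)).card : ℝ) = s n := by rw [hs n]
    rw [Real.norm_of_nonneg (Real.sqrt_nonneg _), Real.norm_of_nonneg (hlam_pos n).le] at hl1
    rw [Real.norm_of_nonneg (hlam_pos n).le, Real.norm_of_nonneg hmin.le] at hl2
    have hle : 0 ≤ L n * Real.exp (-(a * Real.log n)) := by positivity
    have he2 : e n ^ 2 = L n * Real.exp (-(a * Real.log n)) := Real.sq_sqrt hle
    have he0 : 0 ≤ e n := Real.sqrt_nonneg _
    have hse' := hse n hn hpn
    have he1 : e n ≤ 1 :=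
      (le_mul_of_one_le_left he0 hs1).trans (hse'.trans (hun.trans (min_le_left _ _)))
    have helow : Real.exp (-(a * Real.log n / 2)) ≤ e n := by
      refine Real.le_sqrt_of_sq_le ?_
      calc Real.exp (-(a * Real.log n / 2)) ^ 2 = 1 * Real.exp (-(a * Real.log n)) := by
            rw [← Real.exp_nat_mul, one_mul]; congr 1; push_cast; ring
        _ ≤ _ := by gcongr
    have b1 := le_abs_self (Real.log (8 * √(2 * Real.pi) / π₀))
    have b2 := le_abs_self (Real.log (4 / π₀ ^ 2 * √(2 * Real.pi)))
    have b3 := le_abs_self (Real.log 4 + (D₀ + 1))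
    have b4 := le_abs_self (Real.log (4 / π₀))
    have c1 := abs_nonneg (Real.log (8 * √(2 * Real.pi) / π₀))
    have c2 := abs_nonneg (Real.log (4 / π₀ ^ 2 * √(2 * Real.pi)))
    have c3 := abs_nonneg (Real.log 4 + (D₀ + 1))
    have c4 := abs_nonneg (Real.log (4 / π₀))
    have hscale := SSDA.Scale.of_log hn rfl rfl hπ₀ hD1 hρ_pos hρ_lt (C := C) (by linarith)
      (by linarith) (by linarith) (by linarith) (by linarith) hM1 hCM hK helow he1
    have hbound := hmain (hr n) (hlaw n) (hindep n) hpn (hlam_pos n) (hbetaHat n) hscale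
      (by positivity) (by rw [hcard]; exact hse'.trans hl1) hl2
      (by rw [hcard]; exact hse'.trans (hun.trans (min_le_right _ _)))
    rw [← ofReal_measureReal]
    exact ENNReal.ofReal_le_ofReal (hbound.trans (SSDA.tail_bound_le hpn hn rfl hx2 hLn hK he2))
  refine tendsto_of_tendsto_of_tendsto_of_le_of_le' tendsto_const_nhds ?_
    (Eventually.of_forall fun n => zero_le) hevent
  have h0 : Tendsto (fun n : ℕ => 28 / (n : ℝ)) atTop (𝓝 0) :=
    tendsto_const_nhds.div_atTop tendsto_natCast_atTop_atTop
  simpa using ENNReal.tendsto_ofReal h0
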